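/- Let $\mathfrak n=\mathfrak v\oplus\mathfrak z$ be a generalized Heisenberg (H-type) algebra with $\dim\mathfrak v=p$, $\dim\mathfrak z=q$ ($p,q\ge 0$): a Euclidean vector space with a Lie bracket that vanishes on $\mathfrak z$ and maps $\mathfrak v\times\mathfrak v$ to $\mathfrak z$, such that the maps $J_Z:\mathfrak v\to\mathfrak v$ defined by $\langle J_ZV,W\rangle=\langle Z,[V,W]\rangle$ satisfy $J_Z^2=-|Z|^2\,\mathrm{id}$ for all $Z\in\mathfrak z$. Let $X=X^{(p,q)}=\mathbb R\ltimes N$, $N=\exp\mathfrak n$, where $t\in\mathbb R$ acts on $\mathfrak v$ by $e^{t/2}$ and on $\mathfrak z$ by $e^{t}$, be the corresponding Damek-Ricci space, with the left-invariant Riemannian metric given at the identity $e$ by the orthogonal direct sum $\mathfrak v\oplus\mathfrak z\oplus\mathbb R$. Put $n=p+q+1=\dim X$ and $\rho=\frac p4+\frac q2$. Let $B_r$ and $S_r$ be the geodesic ball and sphere of radius $r>0$ around $e$. For $p,q\ge0$, $\lambda\in\mathbb C$ and $r\ge 0$ let $$\varphi_\lambda^{(p,q)}(r)=F\bigl(\rho-i\lambda,\rho+i\lambda,\tfrac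 n2,-\sinh^2(r/2)\bigr),$$ where $F$ is the Gauss hypergeometric function (with $n$, $\rho$ computed from the pair $(p,q)$ in the superscript, so that $\varphi_\lambda^{(p,q+2)}$ uses $n+2$ and $\rho+1$). For every $\lambda\in\mathbb C$ there is a unique smooth radial function $\varphi_\lambda$ on $X$ with $\Delta\varphi_\lambda=-(\lambda^2+\rho^2)\varphi_\lambda$ and $\varphi_\lambda(e)=1$, where $\Delta=\mathrm{div}\,\mathrm{grad}$ is the Laplacian of $X$. The spherical Fourier transform of a radial distribution $T$ of compact support is $\mathcal FT(\lambda)=\langle T,\varphi_\lambda\rangle$. Then for all $r>0$ and $\lambda\in\mathbb C$: a) if $\langle T_r,f\rangle=\int_{B_r}f$ (with respect to the Riemannian volume), then $\varphi_\lambda$ is integrable on $B_r$ and $$\mathcal F T_r(\lambda)=\frac{2^n\pi^{n/2}}{\Gamma(1+n/2)}\,\bigl(\sinh(r/2)\bigr)^n\bigl(\cosh(r/2)\bigr)^{q+1}\,\varphi_\lambda^{(p,q+2)}(r);$$ b) if $\langle T_r,f\rangle=\int_{S_r}f$ (with respect to the induced $(n-1)$-dimensional Riemannian measure), then $\mathrm{vol}(S_r)<\infty$,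 $\varphi_\lambda$ is integrable on $S_r$, and $$\mathcal F T_r(\lambda)=\mathrm{vol}(S_r)\,\varphi_\lambda^{(p,q)}(r).$$ -/

import Mathlib

open MeasureTheory Bundle
open scoped Manifold ContDiff

noncomputable section

/-- A generalized Heisenberg (H-type) algebra `𝔫 = 𝔳 ⊕ 𝔷`, written in orthonormal bases of
`𝔳 = ℝ^p` and `𝔷 = ℝ^q`.  The Lie bracket of `𝔫` vanishes on `𝔷`, maps `𝔳 × 𝔳` to `𝔷`, and the maps
`J_Z : 𝔳 → 𝔳` determined by `⟨J_Z V, W⟩ = ⟨Z, [V, W]⟩` satisfy `J_Z² = -|Z|² id`. -/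
structure HTypeAlgebra (p q : ℕ) where
  bracket : EuclideanSpace ℝ (Fin p) →ₗ[ℝ] EuclideanSpace ℝ (Fin p) →ₗ[ℝ] EuclideanSpace ℝ (Fin q)
  bracket_self : ∀ v, bracket v v = 0
  J : EuclideanSpace ℝ (Fin q) →ₗ[ℝ] EuclideanSpace ℝ (Fin p) →ₗ[ℝ] EuclideanSpace ℝ (Fin p)
  inner_J : ∀ z v w, inner ℝ (J z v) w = inner ℝ z (bracket v w)
  J_sq : ∀ z v, J z (J z v) = -(‖z‖ ^ 2) • v

/-- The Euclidean space `𝔰 = 𝔳 ⊕ 𝔷 ⊕ ℝ` (orthogonal direct sum). -/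
def DRCoord (p q : ℕ) : Type :=
  WithLp 2 (EuclideanSpace ℝ (Fin p) × WithLp 2 (EuclideanSpace ℝ (Fin q) × ℝ))

namespace DRCoord

variable {p q : ℕ}

instance : NormedAddCommGroup (DRCoord p q) := inferInstanceAs (NormedAddCommGroup
  (WithLp 2 (EuclideanSpace ℝ (Fin p) × WithLp 2 (EuclideanSpace ℝ (Fin q) × ℝ))))
instance : InnerProductSpace ℝ (DRCoord p q) := inferInstanceAs (InnerProductSpace ℝ
  (WithLp 2 (EuclideanSpace ℝ (Fin p) × WithLp 2 (EuclideanSpace ℝ (Fin q) × ℝ))))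
instance : FiniteDimensional ℝ (DRCoord p q) := Module.Finite.equiv
  ((WithLp.linearEquiv 2 ℝ (EuclideanSpace ℝ (Fin p) × WithLp 2 (EuclideanSpace ℝ (Fin q) × ℝ))).trans
    ((LinearEquiv.refl ℝ _).prodCongr (WithLp.linearEquiv 2 ℝ _))).symm
instance : MeasurableSpace (DRCoord p q) := inferInstanceAs (MeasurableSpace
  (WithLp 2 (EuclideanSpace ℝ (Fin p) × WithLp 2 (EuclideanSpace ℝ (Fin q) × ℝ))))
instance : BorelSpace (DRCoord p q) := inferInstanceAs (BorelSpace
  (WithLp 2 (EuclideanSpace ℝ (Fin p) × WithLp 2 (EuclideanSpace ℝ (Fin q) × ℝ))))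

/-- The element of `𝔳 ⊕ 𝔷 ⊕ ℝ` with the given components. -/
def mk (v : EuclideanSpace ℝ (Fin p)) (z : EuclideanSpace ℝ (Fin q)) (t : ℝ) : DRCoord p q :=
  WithLp.toLp 2 (v, WithLp.toLp 2 (z, t))

/-- The component in `𝔳`. -/
def v (x : DRCoord p q) : EuclideanSpace ℝ (Fin p) := WithLp.fst x
/-- The component in `𝔷`. -/
def z (x : DRCoord p q) : EuclideanSpace ℝ (Fin q) := (WithLp.snd x).fst
/-- The component in `ℝ`. -/
def t (x : DRCoord p q) : ℝ := (WithLp.snd x).snd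

@[ext] theorem ext {x y : DRCoord p q} (hv : x.v = y.v) (hz : x.z = y.z) (ht : x.t = y.t) :
    x = y :=
  WithLp.ofLp_injective 2 (Prod.ext hv (WithLp.ofLp_injective 2 (Prod.ext hz ht)))

@[simp] theorem v_mk (v : EuclideanSpace ℝ (Fin p)) (z : EuclideanSpace ℝ (Fin q)) (t : ℝ) :
    (mk v z t).v = v := rfl
@[simp] theorem z_mk (v : EuclideanSpace ℝ (Fin p)) (z : EuclideanSpace ℝ (Fin q)) (t : ℝ) :
    (mk v z t).z = z := rfl
@[simp] theorem t_mk (v : EuclideanSpace ℝ (Fin p)) (z : EuclideanSpace ℝ (Fin q)) (t : ℝ) :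
    (mk v z t).t = t := rfl
@[simp] theorem v_add (x y : DRCoord p q) : (x + y).v = x.v + y.v := rfl
@[simp] theorem z_add (x y : DRCoord p q) : (x + y).z = x.z + y.z := rfl
@[simp] theorem t_add (x y : DRCoord p q) : (x + y).t = x.t + y.t := rfl
@[simp] theorem v_smul (c : ℝ) (x : DRCoord p q) : (c • x).v = c • x.v := rfl
@[simp] theorem z_smul (c : ℝ) (x : DRCoord p q) : (c • x).z = c • x.z := rfl
@[simp] theorem t_smul (c : ℝ) (x : DRCoord p q) : (c • x).t = c * x.t := rfl

theorem inner_eq (x y : DRCoord p q) :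
    inner ℝ x y = inner ℝ x.v y.v + (inner ℝ x.z y.z + x.t * y.t) := by
  rw [mul_comm]; rfl

theorem contDiff_v {n : ℕ∞ω} : ContDiff ℝ n (v : DRCoord p q → _) :=
  (LinearMap.toContinuousLinearMap (E := DRCoord p q)
    ⟨⟨v, v_add⟩, v_smul⟩).contDiff
theorem contDiff_z {n : ℕ∞ω} : ContDiff ℝ n (z : DRCoord p q → _) :=
  (LinearMap.toContinuousLinearMap (E := DRCoord p q)
    ⟨⟨z, z_add⟩, z_smul⟩).contDiff
theorem contDiff_t {n : ℕ∞ω} : ContDiff ℝ n (t : DRCoord p q → _) :=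
  (LinearMap.toContinuousLinearMap (E := DRCoord p q)
    ⟨⟨t, t_add⟩, t_smul⟩).contDiff


theorem contDiff_mk {n : ℕ∞ω} : ContDiff ℝ n
    (fun y : EuclideanSpace ℝ (Fin p) × EuclideanSpace ℝ (Fin q) × ℝ => mk y.1 y.2.1 y.2.2) :=
  (LinearMap.toContinuousLinearMap (F' := DRCoord p q)
    ⟨⟨fun y : EuclideanSpace ℝ (Fin p) × EuclideanSpace ℝ (Fin q) × ℝ => mk y.1 y.2.1 y.2.2,
      fun _ _ => rfl⟩, fun _ _ => rfl⟩).contDiff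

end DRCoord

/-- The Damek-Ricci space of an H-type algebra.  The coordinates `(v, z, t)` stand for the group
element `exp (v + z) · t` of the semidirect product of `N = exp 𝔫` with `ℝ`, where `t` acts on `𝔳`
by `e^{t/2}` and on `𝔷` by `e^t`. -/
def DamekRicci {p q : ℕ} (_S : HTypeAlgebra p q) : Type := DRCoord p q

namespace DamekRicci

variable {p q : ℕ} {S : HTypeAlgebra p q}

/-- The point with coordinates `x`. -/
def ofCoord (S : HTypeAlgebra p q) (x : DRCoord p q) : DamekRicci S := x

/-- The coordinates of a point. -/
def coord (x : DamekRicci S) : DRCoord p q := x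

def v (x : DamekRicci S) : EuclideanSpace ℝ (Fin p) := x.coord.v
def z (x : DamekRicci S) : EuclideanSpace ℝ (Fin q) := x.coord.z
def t (x : DamekRicci S) : ℝ := x.coord.t

@[ext] theorem ext {x y : DamekRicci S} (hv : x.v = y.v) (hz : x.z = y.z) (ht : x.t = y.t) :
    x = y := DRCoord.ext (x := x) (y := y) hv hz ht

instance : Mul (DamekRicci S) where
  mul x y := ofCoord S (DRCoord.mk (x.v + Real.exp (x.t / 2) • y.v)
    (x.z + Real.exp x.t • y.z + (Real.exp (x.t / 2) / 2) • S.bracket x.v y.v) (x.t + y.t))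

instance : One (DamekRicci S) where
  one := ofCoord S (DRCoord.mk 0 0 0)

instance : Inv (DamekRicci S) where
  inv x := ofCoord S
    (DRCoord.mk (-(Real.exp (-x.t / 2) • x.v)) (-(Real.exp (-x.t) • x.z)) (-x.t))

@[simp] theorem mul_v (x y : DamekRicci S) : (x * y).v = x.v + Real.exp (x.t / 2) • y.v := rfl
@[simp] theorem mul_z (x y : DamekRicci S) : (x * y).z =
    x.z + Real.exp x.t • y.z + (Real.exp (x.t / 2) / 2) • S.bracket x.v y.v := rfl
@[simp] theorem mul_t (x y : DamekRicci S) : (x * y).t = x.t + y.t := rfl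
@[simp] theorem one_v : (1 : DamekRicci S).v = 0 := rfl
@[simp] theorem one_z : (1 : DamekRicci S).z = 0 := rfl
@[simp] theorem one_t : (1 : DamekRicci S).t = 0 := rfl
@[simp] theorem inv_v (x : DamekRicci S) : (x⁻¹).v = -(Real.exp (-x.t / 2) • x.v) := rfl
@[simp] theorem inv_z (x : DamekRicci S) : (x⁻¹).z = -(Real.exp (-x.t) • x.z) := rfl
@[simp] theorem inv_t (x : DamekRicci S) : (x⁻¹).t = -x.t := rfl

/-- The group structure of the Damek-Ricci space. -/
instance : Group (DamekRicci S) := Group.ofLeftAxioms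
  (by
    intro a b c
    ext1
    · simp only [mul_v, mul_t, add_div, Real.exp_add, smul_add, mul_smul]
      module
    · have h : Real.exp (a.t / 2) * Real.exp (a.t / 2) = Real.exp a.t := by
        rw [← Real.exp_add]; ring_nf
      simp only [mul_v, mul_z, mul_t, add_div, Real.exp_add, smul_add, mul_smul, map_add,
        map_smul, LinearMap.add_apply, LinearMap.smul_apply, ← h]
      module
    · simp only [mul_t]; ring)
  (by
    intro a
    ext1 <;> simp)
  (by
    intro a
    ext1
    · simp
    · simp [S.bracket_self]
    · simp)

/-! ### The left-invariant Riemannian metric -/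

/-- The differential at the identity of the left translation by `x`, in coordinates. -/
def frameₗ (x : DamekRicci S) : DRCoord p q ≃ₗ[ℝ] DRCoord p q where
  toFun ξ := DRCoord.mk (Real.exp (x.t / 2) • ξ.v)
    (Real.exp x.t • ξ.z + (Real.exp (x.t / 2) / 2) • S.bracket x.v ξ.v) ξ.t
  invFun ξ := DRCoord.mk (Real.exp (-x.t / 2) • ξ.v)
    (Real.exp (-x.t) • (ξ.z - (1 / 2 : ℝ) • S.bracket x.v ξ.v)) ξ.t
  map_add' ξ η := by
    ext1
    · simp
    · simp; module
    · simp
  map_smul' c ξ := by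
    ext1
    · simp; module
    · simp; module
    · simp
  left_inv ξ := by
    have h1 : Real.exp (-x.t / 2) * Real.exp (x.t / 2) = 1 := by
      rw [← Real.exp_add]; ring_nf; simp
    have h2 : Real.exp (-x.t) * Real.exp x.t = 1 := by
      rw [← Real.exp_add]; ring_nf; simp
    ext1
    · simp [smul_smul, h1]
    · have : (Real.exp (x.t / 2) / 2) = (1 / 2 : ℝ) * Real.exp (x.t / 2) := by ring
      simp [smul_smul, h2, this]
    · simp
  right_inv ξ := by
    have h1 : Real.exp (x.t / 2) * Real.exp (-x.t / 2) = 1 := by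
      rw [← Real.exp_add]; ring_nf; simp
    have h2 : Real.exp x.t * Real.exp (-x.t) = 1 := by
      rw [← Real.exp_add]; ring_nf; simp
    ext1
    · simp [smul_smul, h1]
    · have : (Real.exp (x.t / 2) / 2) * Real.exp (-x.t / 2) = (2⁻¹ : ℝ) := by
        rw [div_mul_eq_mul_div, h1]; norm_num
      simp [smul_smul, h2, this]
    · simp

/-- The left-invariant frame: `frame x = d(L_x)_e : 𝔰 → T_x X`. -/
def frame (x : DamekRicci S) : DRCoord p q ≃L[ℝ] DRCoord p q :=
  (frameₗ x).toContinuousLinearEquiv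

/-- `frame x` is indeed the derivative at the identity of left translation by `x`. -/
theorem hasFDerivAt_mul_left (x : DamekRicci S) :
    HasFDerivAt (fun y : DRCoord p q => (x * ofCoord S y).coord)
      (frame x : DRCoord p q →L[ℝ] DRCoord p q) (1 : DamekRicci S).coord := by
  have h : (fun y : DRCoord p q => (x * ofCoord S y).coord) =
      fun y => x.coord + (frame x : DRCoord p q →L[ℝ] DRCoord p q) y := by
    funext y
    ext1
    · rfl
    · change x.z + _ + _ = x.z + (_ + _)
      rw [add_assoc]; rfl
    · rfl
  rw [h]
  exact (ContinuousLinearMap.hasFDerivAt _).const_add _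

/-- The left-invariant metric `g_x(ξ, η) = ⟨d(L_x)⁻¹ ξ, d(L_x)⁻¹ η⟩`. -/
def metric (x : DamekRicci S) : DRCoord p q →L[ℝ] DRCoord p q →L[ℝ] ℝ :=
  (innerSL ℝ).bilinearComp ((frame x).symm : DRCoord p q →L[ℝ] DRCoord p q)
    ((frame x).symm : DRCoord p q →L[ℝ] DRCoord p q)

theorem metric_apply (x : DamekRicci S) (ξ η : DRCoord p q) :
    metric x ξ η = inner ℝ ((frame x).symm ξ) ((frame x).symm η) := rfl

theorem metric_symm (x : DamekRicci S) (ξ η : DRCoord p q) : metric x ξ η = metric x η ξ := by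
  simp only [metric_apply, real_inner_comm]

theorem metric_pos (x : DamekRicci S) (ξ : DRCoord p q) (h : ξ ≠ 0) : 0 < metric x ξ ξ := by
  rw [metric_apply]
  exact real_inner_self_pos.2 (by simpa using h)

theorem metric_isVonNBounded (x : DamekRicci S) :
    Bornology.IsVonNBounded ℝ {ξ : DRCoord p q | metric x ξ ξ < 1} := by
  have h : {ξ : DRCoord p q | metric x ξ ξ < 1} ⊆
      (frame x : DRCoord p q →L[ℝ] DRCoord p q) '' Metric.ball 0 1 := by
    intro ξ hξ
    refine ⟨(frame x).symm ξ, ?_, by simp⟩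
    have h1 : ‖(frame x).symm ξ‖ ^ 2 < 1 := by
      rw [← real_inner_self_eq_norm_sq]; exact hξ
    rw [mem_ball_zero_iff]
    nlinarith [norm_nonneg ((frame x).symm ξ)]
  exact ((NormedSpace.isVonNBounded_ball ℝ (DRCoord p q) 1).image _).subset h

theorem contDiff_metric {n : ℕ∞ω} :
    ContDiff ℝ n (fun x : DRCoord p q => metric (ofCoord S x)) := by
  have hA : ∀ ξ : DRCoord p q,
      ContDiff ℝ n (fun x : DRCoord p q => (frame (ofCoord S x)).symm ξ) := by
    intro ξ
    have hb : ContDiff ℝ n (fun x : DRCoord p q => S.bracket x.v ξ.v) :=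
      (LinearMap.toContinuousLinearMap (S.bracket.flip ξ.v)).contDiff.comp DRCoord.contDiff_v
    have ht : ContDiff ℝ n (fun x : DRCoord p q => x.t) := DRCoord.contDiff_t
    have h1 : ContDiff ℝ n (fun x : DRCoord p q => Real.exp (-x.t / 2) • ξ.v) :=
      (Real.contDiff_exp.comp (ht.neg.div_const 2)).smul contDiff_const
    have h2 : ContDiff ℝ n (fun x : DRCoord p q =>
        Real.exp (-x.t) • (ξ.z - (1 / 2 : ℝ) • S.bracket x.v ξ.v)) :=
      (Real.contDiff_exp.comp ht.neg).smul (contDiff_const.sub (hb.const_smul (1 / 2 : ℝ)))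
    exact DRCoord.contDiff_mk.comp (h1.prodMk (h2.prodMk (contDiff_const (c := ξ.t))))
  refine contDiff_clm_apply_iff.2 fun ξ => contDiff_clm_apply_iff.2 fun η => ?_
  exact (hA ξ).inner ℝ (hA η)

instance : TopologicalSpace (DamekRicci S) := inferInstanceAs (TopologicalSpace (DRCoord p q))
instance : T3Space (DamekRicci S) := inferInstanceAs (T3Space (DRCoord p q))
instance : ChartedSpace (DRCoord p q) (DamekRicci S) := chartedSpaceSelf (DRCoord p q)
instance (n : ℕ∞ω) : IsManifold 𝓘(ℝ, DRCoord p q) n (DamekRicci S) :=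
  inferInstanceAs (IsManifold 𝓘(ℝ, DRCoord p q) n (DRCoord p q))

/-- The left-invariant metric on the tangent space at `x`. -/
def tangentMetric (x : DamekRicci S) : TangentSpace 𝓘(ℝ, DRCoord p q) x →L[ℝ]
    TangentSpace 𝓘(ℝ, DRCoord p q) x →L[ℝ] ℝ := metric x

/-- The standard trivialization of the tangent bundle is the identity in coordinates. -/
theorem triv_aux (x y : DamekRicci S) (w : DRCoord p q) :
    (trivializationAt (DRCoord p q) (TangentSpace 𝓘(ℝ, DRCoord p q)) x).symm y w = w := by
  have h := TangentBundle.symmL_trivializationAt_eq_core (𝕜 := ℝ) (I := 𝓘(ℝ, DRCoord p q))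
    (b₀ := x) (b := y) (Set.mem_univ _)
  refine ((Trivialization.symmL_apply (R := ℝ) _ (Set.mem_univ _) w).symm.trans
    (congrArg (fun L => L w) h)).trans ?_
  exact (tangentBundleCore 𝓘(ℝ, DRCoord p q) (DamekRicci S)).coordChange_self
    (achart _ y) y (Set.mem_univ _) w

/-- The left-invariant metric as a smooth Riemannian metric. -/
def riemannianMetric (S : HTypeAlgebra p q) : ContMDiffRiemannianMetric 𝓘(ℝ, DRCoord p q) ∞
    (DRCoord p q) (fun x : DamekRicci S => TangentSpace 𝓘(ℝ, DRCoord p q) x) where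
  inner x := tangentMetric x
  symm x := metric_symm x
  pos x := metric_pos x
  isVonNBounded x := metric_isVonNBounded x
  contMDiff := by
    intro x
    rw [contMDiffAt_hom_bundle]
    refine ⟨contMDiffAt_id, ?_⟩
    refine ((contDiff_metric (S := S) (n := ∞)).contMDiff x).congr_of_eventuallyEq ?_
    refine Filter.Eventually.of_forall fun y => ?_
    ext v w
    have h := inCoordinates_apply_eq₂ (F₁ := DRCoord p q) (F₂ := DRCoord p q) (F₃ := ℝ)
      (E₁ := fun b : DamekRicci S => TangentSpace 𝓘(ℝ, DRCoord p q) b)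
      (E₂ := fun b : DamekRicci S => TangentSpace 𝓘(ℝ, DRCoord p q) b)
      (E₃ := fun _ : DamekRicci S => ℝ)
      (x₀ := x) (x := ofCoord S y) (ϕ := tangentMetric (ofCoord S y)) (v := v) (w := w)
      (Set.mem_univ _) (Set.mem_univ _) (Set.mem_univ _)
    rw [triv_aux, triv_aux] at h
    exact h.trans (congrArg (fun L : ℝ →ₗ[ℝ] ℝ => L (metric (ofCoord S y) v w))
      (Bundle.Trivial.linearMapAt_trivialization ℝ (DamekRicci S) ℝ (ofCoord S y)))

instance : RiemannianBundle (fun x : DamekRicci S => TangentSpace 𝓘(ℝ, DRCoord p q) x) :=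
  ⟨(riemannianMetric S).toRiemannianMetric⟩

instance : IsContMDiffRiemannianBundle 𝓘(ℝ, DRCoord p q) ∞ (DRCoord p q)
    (fun x : DamekRicci S => TangentSpace 𝓘(ℝ, DRCoord p q) x) :=
  ⟨(riemannianMetric S).inner, (riemannianMetric S).contMDiff, fun _ _ _ => rfl⟩

instance : IsContinuousRiemannianBundle (DRCoord p q)
    (fun x : DamekRicci S => TangentSpace 𝓘(ℝ, DRCoord p q) x) :=
  ⟨(riemannianMetric S).inner, (riemannianMetric S).contMDiff.continuous, fun _ _ _ => rfl⟩

/-- The distance of a Damek-Ricci space is its Riemannian distance. -/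
instance : EMetricSpace (DamekRicci S) :=
  EMetricSpace.ofRiemannianMetric 𝓘(ℝ, DRCoord p q) (DamekRicci S)

instance : IsRiemannianManifold 𝓘(ℝ, DRCoord p q) (DamekRicci S) := ⟨fun _ _ => rfl⟩

instance : MeasurableSpace (DamekRicci S) := inferInstanceAs (MeasurableSpace (DRCoord p q))
instance : BorelSpace (DamekRicci S) := inferInstanceAs (BorelSpace (DRCoord p q))

/-! ### Riemannian volume, surface measure, gradient, divergence and Laplacian -/

/-- The Riemannian volume density `√(det g_x) = |det d(L_x)⁻¹|` in coordinates. -/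
def volDensity (x : DamekRicci S) : ℝ :=
  |LinearMap.det ((frame x).symm : DRCoord p q →ₗ[ℝ] DRCoord p q)|

/-- The Riemannian volume measure. -/
def vol (S : HTypeAlgebra p q) : Measure (DamekRicci S) :=
  ((volume : Measure (DRCoord p q)).withDensity
    fun x => ENNReal.ofReal (volDensity (ofCoord S x))).map (ofCoord S)

/-- The open geodesic ball of radius `r` around the identity. -/
def geodBall (S : HTypeAlgebra p q) (r : ℝ) : Set (DamekRicci S) :=
  {x | edist x 1 < ENNReal.ofReal r}

/-- The geodesic sphere of radius `r` around the identity. -/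
def geodSphere (S : HTypeAlgebra p q) (r : ℝ) : Set (DamekRicci S) :=
  {x | edist x 1 = ENNReal.ofReal r}

/-- The hypersurface measure: the `(p + q)`-dimensional Hausdorff measure of the Riemannian
distance, normalized so as to agree with Lebesgue measure on Euclidean space.  (The space has
dimension `p + q + 1`.) -/
def surfaceMeasure (S : HTypeAlgebra p q) : Measure (DamekRicci S) := μHE[p + q]

/-- The Riemannian gradient of a real function: `grad f (x) = d(L_x) d(L_x)ᵀ (∇ f)(x)`, where `∇`
is the Euclidean gradient in coordinates. -/
def grad (f : DamekRicci S → ℝ) (x : DamekRicci S) : DRCoord p q :=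
  frame x (ContinuousLinearMap.adjoint (frame x : DRCoord p q →L[ℝ] DRCoord p q)
    (gradient (fun y : DRCoord p q => f (ofCoord S y)) x.coord))

/-- The gradient represents the differential with respect to the metric. -/
theorem metric_grad (f : DamekRicci S → ℝ) (x : DamekRicci S) (ξ : DRCoord p q) :
    metric x (grad f x) ξ = fderiv ℝ (fun y : DRCoord p q => f (ofCoord S y)) x.coord ξ := by
  simp only [metric_apply, grad, ContinuousLinearEquiv.symm_apply_apply,
    ContinuousLinearMap.adjoint_inner_left]
  simp [gradient]

/-- The Riemannian divergence `(√det g)⁻¹ ∑ ∂_i (√det g W_i)` of a vector field. -/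
def divergence (W : DamekRicci S → DRCoord p q) (x : DamekRicci S) : ℝ :=
  (volDensity x)⁻¹ * LinearMap.trace ℝ (DRCoord p q)
    (fderiv ℝ (fun y : DRCoord p q => volDensity (ofCoord S y) • W (ofCoord S y)) x.coord :
      DRCoord p q →L[ℝ] DRCoord p q)

/-- The Laplacian `Δ = div grad`, extended complex linearly to complex valued functions. -/
def laplacian (f : DamekRicci S → ℂ) (x : DamekRicci S) : ℂ :=
  (divergence (grad fun y => (f y).re) x : ℂ) + Complex.I * divergence (grad fun y => (f y).im) x

/-! ### Spherical functions and the spherical Fourier transform -/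

/-- A function is radial if it depends only on the distance to the identity. -/
def IsRadial (f : DamekRicci S → ℂ) : Prop :=
  ∀ x y : DamekRicci S, edist x 1 = edist y 1 → f x = f y

/-- `φ` is the spherical function with parameter `lam`: a smooth radial function with
`Δ φ = -(lam² + ρ²) φ` and `φ(e) = 1`, where `ρ = p/4 + q/2`. -/
structure IsSphericalFunction (S : HTypeAlgebra p q) (lam : ℂ) (φ : DamekRicci S → ℂ) : Prop where
  smooth : ContMDiff 𝓘(ℝ, DRCoord p q) 𝓘(ℝ, ℂ) ∞ φ
  radial : IsRadial φ
  eigen : ∀ x, laplacian φ x = -(lam ^ 2 + ((p : ℂ) / 4 + (q : ℂ) / 2) ^ 2) * φ x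
  map_one : φ 1 = 1

/-- The spherical function `φ_lam` of the Damek-Ricci space. -/
def sphericalFunction (S : HTypeAlgebra p q) (lam : ℂ) : DamekRicci S → ℂ :=
  Classical.epsilon (IsSphericalFunction S lam)

/-- The spherical Fourier transform `(F T)(lam) = ⟨T, φ_lam⟩`. -/
def sphericalFourier (S : HTypeAlgebra p q) (T : (DamekRicci S → ℂ) → ℂ) (lam : ℂ) : ℂ :=
  T (sphericalFunction S lam)

/-- The distribution `f ↦ ∫_{B_r} f`. -/
def ballDistribution (S : HTypeAlgebra p q) (r : ℝ) (f : DamekRicci S → ℂ) : ℂ :=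
  ∫ x in geodBall S r, f x ∂(vol S)

/-- The distribution `f ↦ ∫_{S_r} f`. -/
def sphereDistribution (S : HTypeAlgebra p q) (r : ℝ) (f : DamekRicci S → ℂ) : ℂ :=
  ∫ x in geodSphere S r, f x ∂(surfaceMeasure S)

end DamekRicci

/-- `G` is the branch on the half plane `Re z < 1/2` (which contains `(-∞, 0]`) of the Gauss
hypergeometric function, that is, the analytic continuation of the hypergeometric series. -/
def IsHypergeometricBranch (a b c : ℂ) (G : ℂ → ℂ) : Prop :=
  DifferentiableOn ℂ G {z | z.re < 1 / 2} ∧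
    ∀ᶠ z in nhds (0 : ℂ), G z = ordinaryHypergeometric a b c z

/-- The Gauss hypergeometric function `F(a, b, c, z)` for `Re z < 1/2` (the principal branch, defined
by analytic continuation of the series). -/
def gaussF (a b c : ℂ) : ℂ → ℂ := Classical.epsilon (IsHypergeometricBranch a b c)

/-- `φ_lam^{(p,q)}(r) = F(ρ - i lam, ρ + i lam, n/2, -sinh²(r/2))`, where `n = p + q + 1` and
`ρ = p/4 + q/2`. -/
def sphericalPhi (p q : ℕ) (lam : ℂ) (r : ℝ) : ℂ :=
  gaussF (((p : ℂ) / 4 + (q : ℂ) / 2) - Complex.I * lam)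
    (((p : ℂ) / 4 + (q : ℂ) / 2) + Complex.I * lam)
    (((p + q + 1 : ℕ) : ℂ) / 2) (-((Real.sinh (r / 2) ^ 2 : ℝ) : ℂ))

end

noncomputable section

/-! ### The Gauss hypergeometric function -/

/-! All radial analysis is carried by one explicit function. With H = 1 + e^t + |v|²/4 put u = (H² +
|z|²)/(4e^t) − 1 (`sinhSq`). The H-type identities give |grad u|² = u(u + 1)
(`norm_sinhSqFrameGradient_sq`), so 2 arsinh √u is a lower bound for the distance to the identity.
Conversely, the Cayley transform from the ball model carries Euclidean rays, parametrized by θ =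
tanh(s/2), to unit speed curves which reach each point at time 2 arsinh √u. Hence u = sinh²(r/2)
(`edist_one`).

The divergence of grad u is n/2 + (p/2 + q + 1)u, so Δ(g ∘ u) = u(u + 1)g'' + (n/2 + (p/2 + q +
1)u)g'. With z = −u the eigenvalue equation becomes Gauss's equation with a, b = ρ ∓ iλ and c = n/2,
since a + b + 1 = p/2 + q + 1 and ab = ρ² + λ². Therefore F(a, b, c, −u) is a spherical function
(`isSphericalFunction_gaussF`). It is the only one, because the radial equation has nonnegative
damping and an energy estimate applies (`eq_zero_of_damped_ode`). The values of F needed here lie in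
Re z < 1/2, where Pfaff's transformation supplies the continuation of the series.

Part b) is then immediate: φ_λ is constant on S_r, which has finite measure as a compact regular
level set of u.

For a), the Riemannian volume has the same image under u as the measure 2^n (1 − |x|²)^{−(p/2+q+1)}
dx on the Euclidean unit ball under |x|²/(1 − |x|²), that is, with |x| = tanh(r/2)
(`lintegral_comp_sinhSq`). Polar coordinates leave a one-variable integral with an explicit
primitive: `gaussF_contiguous` is the expanded form of (z^c (1−z)^{a+b+1−c} F(a+1, b+1, c+1))' = c
z^{c−1} (1−z)^{a+b−c} F(a, b, c), and raising a, b, c by one amounts to replacing q by q + 2. -/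

open Filter Topology in
theorem hasSum_deriv_of_hasSum_pow {c : ℕ → ℂ} {f : ℂ → ℂ}
    (h : HasFPowerSeriesOnBall f (FormalMultilinearSeries.ofScalars ℂ c) 0 1) {z : ℂ}
    (hz : ‖z‖ < 1) : HasSum (fun n : ℕ => ((n : ℂ) + 1) * c (n + 1) * z ^ n) (deriv f z) := by
  have h1 := h.fderiv.hasSum (y := z) (by simpa [← enorm_eq_nnnorm, ← ofReal_norm] using hz)
  have h2 := h1.mapL (ContinuousLinearMap.apply ℂ ℂ (1 : ℂ))
  simp only [zero_add, ContinuousLinearMap.apply_apply, fderiv_apply_one_eq_deriv] at h2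
  convert! h2 using 2 with n
  have h3 := FormalMultilinearSeries.derivSeries_coeff_one
    (FormalMultilinearSeries.ofScalars ℂ c) n
  rw [FormalMultilinearSeries.apply_eq_pow_smul_coeff, smul_apply, h3]
  simp [FormalMultilinearSeries.coeff_ofScalars]
  ring

/-- The radius is 1 unless a parameter is a nonpositive integer. In that case almost all
coefficients vanish (for c because 0⁻¹ = 0) and the radius is infinite. -/
theorem one_le_radius_ordinaryHypergeometricSeries (a b c : ℂ) :
    1 ≤ (ordinaryHypergeometricSeries ℂ a b c).radius := by
  by_cases h : ∀ kn : ℕ, (kn : ℂ) ≠ -a ∧ (kn : ℂ) ≠ -b ∧ (kn : ℂ) ≠ -c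
  · rw [ordinaryHypergeometricSeries_radius_eq_one ℂ a b c h]
  · push Not at h
    obtain ⟨k, hk⟩ := h
    by_cases ha : (k : ℂ) = -a
    · rw [show a = -(k : ℂ) by rw [ha, neg_neg], ordinaryHypergeometric_radius_top_of_neg_nat₁]
      exact le_top
    by_cases hb : (k : ℂ) = -b
    · rw [show b = -(k : ℂ) by rw [hb, neg_neg], ordinaryHypergeometric_radius_top_of_neg_nat₂]
      exact le_top
    · rw [show c = -(k : ℂ) by rw [hk ha hb, neg_neg],
        ordinaryHypergeometric_radius_top_of_neg_nat₃]
      exact le_top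

theorem hasFPowerSeriesOnBall_ordinaryHypergeometric (a b c : ℂ) :
    HasFPowerSeriesOnBall (ordinaryHypergeometric a b c : ℂ → ℂ)
      (FormalMultilinearSeries.ofScalars ℂ (ordinaryHypergeometricCoefficient a b c)) 0 1 := by
  have h := one_le_radius_ordinaryHypergeometricSeries a b c
  exact ((ordinaryHypergeometricSeries ℂ a b c).hasFPowerSeriesOnBall
    (zero_lt_one.trans_le h)).mono zero_lt_one h

theorem hasSum_ordinaryHypergeometric (a b c : ℂ) {z : ℂ} (hz : ‖z‖ < 1) :
    HasSum (fun n : ℕ => ordinaryHypergeometricCoefficient a b c n * z ^ n)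
      (ordinaryHypergeometric a b c z) := by
  have h := (hasFPowerSeriesOnBall_ordinaryHypergeometric a b c).hasSum (y := z)
    (by simpa [← enorm_eq_nnnorm, ← ofReal_norm] using hz)
  simpa [FormalMultilinearSeries.ofScalars_apply_eq, mul_comm] using h

theorem ordinaryHypergeometricCoefficient_zero (a b c : ℂ) :
    ordinaryHypergeometricCoefficient a b c 0 = 1 := by
  simp [ordinaryHypergeometricCoefficient]

theorem ordinaryHypergeometricCoefficient_succ (a b c : ℂ) (n : ℕ) (hc : c + n ≠ 0) :
    ordinaryHypergeometricCoefficient a b c (n + 1) * (c + n) * (n + 1) =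
      ordinaryHypergeometricCoefficient a b c n * (a + n) * (b + n) := by
  have hn : ((n : ℂ) + 1) ≠ 0 := Nat.cast_add_one_ne_zero n
  simp only [ordinaryHypergeometricCoefficient, ascPochhammer_succ_eval, Nat.factorial_succ,
    Nat.cast_mul, Nat.cast_add, Nat.cast_one, mul_inv]
  field_simp

theorem ordinaryHypergeometricCoefficient_shift (a b c : ℂ) (n : ℕ) (hc : c ≠ 0) :
    ordinaryHypergeometricCoefficient a b c (n + 1) * c * (n + 1) =
      a * b * ordinaryHypergeometricCoefficient (a + 1) (b + 1) (c + 1) n := by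
  have hn : ((n : ℂ) + 1) ≠ 0 := Nat.cast_add_one_ne_zero n
  simp only [ordinaryHypergeometricCoefficient, ascPochhammer_succ_left, Nat.factorial_succ,
    Nat.cast_mul, Nat.cast_add, Nat.cast_one, mul_inv, Polynomial.eval_mul, Polynomial.eval_X,
    Polynomial.eval_comp, Polynomial.eval_add, Polynomial.eval_one]
  field_simp

theorem deriv_ordinaryHypergeometric (a b c : ℂ) (hc : c ≠ 0) {z : ℂ} (hz : ‖z‖ < 1) :
    deriv (ordinaryHypergeometric a b c : ℂ → ℂ) z =
      a * b / c * ordinaryHypergeometric (a + 1) (b + 1) (c + 1) z := by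
  have h1 := hasSum_deriv_of_hasSum_pow (hasFPowerSeriesOnBall_ordinaryHypergeometric a b c) hz
  have h2 := (hasSum_ordinaryHypergeometric (a + 1) (b + 1) (c + 1) hz).mul_left (a * b / c)
  refine h1.unique (h2.congr_fun fun n => ?_) 
  have := ordinaryHypergeometricCoefficient_shift a b c n hc
  rw [div_mul_eq_mul_div, eq_div_iff hc]
  linear_combination (z ^ n) * this

/-- Comparison of coefficients: with e_n those of F(a, b, c) and k_n those of F(a+1, b+1, c+1), the
identity amounts to c e_{n+1} = (c + n + 1) k_{n+1} − (a + b + 1 + n) k_n. Together with the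
derivative formula it yields Gauss's equation. -/
theorem ordinaryHypergeometric_contiguous (a b c : ℂ) (hc : 0 < c.re) {z : ℂ} (hz : ‖z‖ < 1) :
    c * ordinaryHypergeometric a b c z =
      (c - (a + b + 1) * z) * ordinaryHypergeometric (a + 1) (b + 1) (c + 1) z +
      z * (1 - z) *
        deriv (ordinaryHypergeometric (a + 1) (b + 1) (c + 1) : ℂ → ℂ) z := by
  have hcn : ∀ n : ℕ, c + n ≠ 0 := fun n h => by
    have := congrArg Complex.re h
    simp at this
    have hn : (0 : ℝ) ≤ n := n.cast_nonneg
    linarith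
  have hc0 : c ≠ 0 := by simpa using hcn 0
  set e := ordinaryHypergeometricCoefficient a b c with he
  set k := ordinaryHypergeometricCoefficient (a + 1) (b + 1) (c + 1) with hk
  set H : ℂ → ℂ := ordinaryHypergeometric (a + 1) (b + 1) (c + 1) with hH
  have hE := (hasSum_ordinaryHypergeometric a b c hz).mul_left c
  have h0 := hasSum_ordinaryHypergeometric (a + 1) (b + 1) (c + 1) hz
  have h1 := (hasSum_deriv_of_hasSum_pow
    (hasFPowerSeriesOnBall_ordinaryHypergeometric (a + 1) (b + 1) (c + 1)) hz).mul_left z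
  rw [← he] at hE
  rw [← hk, ← hH] at h0 h1
  -- The Euler operator z d/dz multiplies the n-th coefficient by n.
  have hθ : HasSum (fun n : ℕ => (n : ℂ) * k n * z ^ n) (z * deriv H z) := by
    rw [← hasSum_nat_add_iff' 1]
    simp only [Finset.range_one, Finset.sum_singleton, Nat.cast_zero, zero_mul, sub_zero]
    refine h1.congr_fun fun n => ?_
    push_cast
    ring
  have hA : HasSum (fun n : ℕ => (c + n) * k n * z ^ n) (c * H z + z * deriv H z) :=
    ((h0.mul_left c).add hθ).congr_fun fun n => by ring
  have hB : HasSum (fun n : ℕ => (a + b + 1 + n) * k n * z ^ (n + 1))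
      (z * ((a + b + 1) * H z + z * deriv H z)) :=
    (((h0.mul_left (a + b + 1)).add hθ).mul_left z).congr_fun fun n => by ring
  -- The constant terms, both equal to c, are split off so that all three series run over z^(n+1).
  rw [← hasSum_nat_add_iff' 1] at hE hA
  have key := hE.unique ((hA.sub hB).congr_fun fun n => ?_)
  · simp only [Finset.range_one, Finset.sum_singleton, he, hk,
      ordinaryHypergeometricCoefficient_zero] at key
    simp only [Nat.cast_zero, add_zero, mul_one, pow_zero] at key
    linear_combination key
  · have e1 := ordinaryHypergeometricCoefficient_shift a b c n hc0
    have e2 := ordinaryHypergeometricCoefficient_succ (a + 1) (b + 1) (c + 1) n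
      (by have := hcn (n + 1); push_cast at this; convert this using 1; ring)
    rw [← he, ← hk] at e1
    rw [← hk] at e2
    have hn : ((n : ℂ) + 1) ≠ 0 := Nat.cast_add_one_ne_zero n
    have : c * e (n + 1) = (c + (n + 1)) * k (n + 1) - (a + b + 1 + n) * k n := by
      apply mul_right_cancel₀ hn
      linear_combination e1 - e2
    push_cast
    linear_combination z ^ (n + 1) * this

open Filter Topology in
/-- An analytic solution of the hypergeometric equation which vanishes at the origin is zero. -/
theorem eventually_eq_zero_of_hypergeometric_ode {D : ℂ → ℂ} (hD : AnalyticAt ℂ D 0)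
    (h0 : D 0 = 0) (c s m : ℂ) (hc : 0 < c.re)
    (hode : ∀ᶠ z in 𝓝 (0 : ℂ), z * (1 - z) * deriv (deriv D) z + (c - s * z) * deriv D z -
      m * D z = 0) : ∀ᶠ z in 𝓝 (0 : ℂ), D z = 0 := by
  by_contra hne
  obtain ⟨k, g, hg, hg0, hk⟩ := (hD.exists_eventuallyEq_pow_smul_nonzero_iff).2 hne
  simp only [sub_zero, smul_eq_mul] at hk
  obtain ⟨j, rfl⟩ : ∃ j, k = j + 1 := by
    refine Nat.exists_eq_succ_of_ne_zero fun hk0 => hg0 ?_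
    have := hk.self_of_nhds
    simpa [hk0, h0] using this.symm
  set g1 : ℂ → ℂ := fun z => (j + 1) * g z + z * deriv g z with hg1
  have hg1a : AnalyticAt ℂ g1 0 := by fun_prop
  have hd1 : ∀ᶠ z in 𝓝 (0 : ℂ), deriv D z = z ^ j * g1 z := by
    filter_upwards [Filter.Eventually.eventually_nhds hk, hg.eventually_analyticAt] with z hz hgz
    rw [Filter.EventuallyEq.deriv_eq hz]
    have := (hasDerivAt_pow (j + 1) z).fun_mul hgz.differentiableAt.hasDerivAt
    rw [this.deriv, hg1]
    simp
    ring
  have hd2 : ∀ᶠ z in 𝓝 (0 : ℂ), z * deriv (deriv D) z = z ^ j * (j * g1 z + z * deriv g1 z) := by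
    filter_upwards [Filter.Eventually.eventually_nhds hd1, hg1a.eventually_analyticAt] with z hz hgz
    rw [Filter.EventuallyEq.deriv_eq hz]
    have := (hasDerivAt_pow j z).fun_mul hgz.differentiableAt.hasDerivAt
    rw [this.deriv]
    rcases j with _ | j
    · simp
    · simp
      ring
  -- B is the left side of the equation divided by z^j, where j + 1 is the order of vanishing of D.
  set B : ℂ → ℂ := fun z => (1 - z) * (j * g1 z + z * deriv g1 z) + (c - s * z) * g1 z -
    m * z * g z with hB
  have hBa : ContinuousAt B 0 := by
    have : AnalyticAt ℂ B 0 := by fun_prop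
    exact this.continuousAt
  have hB0 : ∀ᶠ z in 𝓝[≠] (0 : ℂ), B z = 0 := by
    have hall := (hode.and (hd1.and (hd2.and hk))).filter_mono
      (nhdsWithin_le_nhds (s := {(0 : ℂ)}ᶜ))
    filter_upwards [hall, self_mem_nhdsWithin] with z hz hz0
    obtain ⟨e, e1, e2, e3⟩ := hz
    have hzj : z ^ j ≠ 0 := pow_ne_zero _ hz0
    apply mul_left_cancel₀ hzj
    rw [hB]
    rw [e1, e3] at e
    linear_combination e - (1 - z) * e2
  have hlim : B 0 = 0 := by
    have h1 : Tendsto B (𝓝[≠] 0) (𝓝 (B 0)) := hBa.tendsto.mono_left nhdsWithin_le_nhds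
    exact tendsto_nhds_unique_of_eventuallyEq h1 tendsto_const_nhds hB0
  -- The value at 0 is the indicial equation (j + c)(j + 1) g(0) = 0, which Re c > 0 excludes.
  simp only [hB, hg1] at hlim
  have hj : (j : ℂ) + c ≠ 0 := fun h => by
    have := congrArg Complex.re h
    simp at this
    have hn : (0 : ℝ) ≤ j := j.cast_nonneg
    linarith
  have hj1 : (j : ℂ) + 1 ≠ 0 := Nat.cast_add_one_ne_zero j
  have : ((j : ℂ) + c) * ((j + 1) * g 0) = 0 := by linear_combination hlim
  exact (mul_ne_zero hj (mul_ne_zero hj1 hg0)) this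


theorem analyticAt_ordinaryHypergeometric (a b c : ℂ) {z : ℂ} (hz : ‖z‖ < 1) :
    AnalyticAt ℂ (ordinaryHypergeometric a b c : ℂ → ℂ) z :=
  (hasFPowerSeriesOnBall_ordinaryHypergeometric a b c).analyticAt_of_mem
    (by simpa [← ofReal_norm] using hz)

open Filter Topology in
theorem deriv_deriv_ordinaryHypergeometric (a b c : ℂ) (hc : c ≠ 0) {z : ℂ} (hz : ‖z‖ < 1) :
    deriv (deriv (ordinaryHypergeometric a b c : ℂ → ℂ)) z =
      a * b / c * deriv (ordinaryHypergeometric (a + 1) (b + 1) (c + 1) : ℂ → ℂ) z := by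
  have h : deriv (ordinaryHypergeometric a b c : ℂ → ℂ) =ᶠ[𝓝 z]
      fun z => a * b / c * ordinaryHypergeometric (a + 1) (b + 1) (c + 1) z := by
    filter_upwards [continuous_norm.continuousAt.eventually (gt_mem_nhds hz)] with y hy
    exact deriv_ordinaryHypergeometric a b c hc hy
  rw [h.deriv_eq, deriv_const_mul]
  exact (analyticAt_ordinaryHypergeometric _ _ _ hz).differentiableAt

theorem ordinaryHypergeometric_ode (a b c : ℂ) (hc : 0 < c.re) {z : ℂ} (hz : ‖z‖ < 1) :
    z * (1 - z) * deriv (deriv (ordinaryHypergeometric a b c : ℂ → ℂ)) z +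
      (c - (a + b + 1) * z) * deriv (ordinaryHypergeometric a b c : ℂ → ℂ) z -
      a * b * ordinaryHypergeometric a b c z = 0 := by
  have hc0 : c ≠ 0 := fun h => by simp [h] at hc
  rw [deriv_deriv_ordinaryHypergeometric a b c hc0 hz, deriv_ordinaryHypergeometric a b c hc0 hz]
  have h := ordinaryHypergeometric_contiguous a b c hc hz
  field_simp
  linear_combination -(a * b) * h

theorem one_sub_ne_zero_of_re_lt {z : ℂ} (hz : z.re < 1 / 2) : 1 - z ≠ 0 := fun h => by
  have := congrArg Complex.re h
  simp at this
  linarith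

/-- In this half plane z is closer to 0 than to 1. Hence the series may be evaluated at z/(z − 1)
for every z in it. -/
theorem norm_div_sub_one_lt_one {z : ℂ} (hz : z.re < 1 / 2) : ‖z / (z - 1)‖ < 1 := by
  have h : z - 1 ≠ 0 := fun h => one_sub_ne_zero_of_re_lt hz (by linear_combination -h)
  rw [norm_div, div_lt_one (norm_pos_iff.2 h), ← sq_lt_sq₀ (norm_nonneg _) (norm_nonneg _),
    ← Complex.normSq_eq_norm_sq, ← Complex.normSq_eq_norm_sq, Complex.normSq_apply,
    Complex.normSq_apply]
  simp
  nlinarith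

/-- The right hand side of the Pfaff transformation of the hypergeometric function. -/
def pfaffTransform (a b c : ℂ) (z : ℂ) : ℂ :=
  (1 - z) ^ (-a) * ordinaryHypergeometric a (c - b) c (z / (z - 1))

/-- `K` is arbitrary so that the same formula also applies with K' in place of K when the second
derivative is computed. -/
theorem hasDerivAt_pfaffTransform_aux (a : ℂ) {K K' : ℂ → ℂ} {z : ℂ} (hz : z.re < 1 / 2)
    (hK : HasDerivAt K (K' (z / (z - 1))) (z / (z - 1))) :
    HasDerivAt (fun z : ℂ => (1 - z) ^ (-a) * K (z / (z - 1)))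
      ((1 - z) ^ (-a) * (a / (1 - z) * K (z / (z - 1)) - K' (z / (z - 1)) / (1 - z) ^ 2)) z := by
  have h1 := one_sub_ne_zero_of_re_lt hz
  have h1' : z - 1 ≠ 0 := fun h => h1 (by linear_combination -h)
  have hs : 1 - z ∈ Complex.slitPlane := Or.inl (by simp; linarith)
  have hp := ((hasDerivAt_id z).const_sub 1).cpow_const (c := -a) hs
  have hw := (hasDerivAt_id z).fun_div ((hasDerivAt_id z).sub_const 1) h1'
  have := hp.mul (HasDerivAt.comp z hK hw)
  refine this.congr_deriv ?_
  simp only [id, Function.comp_apply, Complex.cpow_sub _ _ h1, Complex.cpow_one]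
  rw [show z - 1 = -(1 - z) by ring]
  field_simp
  ring

open Filter Topology in
theorem isOpen_halfPlane : IsOpen {z : ℂ | z.re < 1 / 2} :=
  isOpen_lt Complex.continuous_re continuous_const

theorem hasDerivAt_pfaffTransform (a b c : ℂ) {z : ℂ} (hz : z.re < 1 / 2) :
    HasDerivAt (pfaffTransform a b c)
      ((1 - z) ^ (-a) * (a / (1 - z) * ordinaryHypergeometric a (c - b) c (z / (z - 1)) -
        deriv (ordinaryHypergeometric a (c - b) c : ℂ → ℂ) (z / (z - 1)) / (1 - z) ^ 2)) z :=
  hasDerivAt_pfaffTransform_aux a hz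
    (analyticAt_ordinaryHypergeometric _ _ _ (norm_div_sub_one_lt_one hz)).differentiableAt.hasDerivAt

-- The substitution w = z/(z − 1), with the factor (1 − z)^(−a), turns Gauss's equation for (a, c −
-- b, c) at w into a multiple of the equation for (a, b, c) at z.
open Filter Topology in
theorem pfaffTransform_ode (a b c : ℂ) (hc : 0 < c.re) {z : ℂ} (hz : z.re < 1 / 2) :
    z * (1 - z) * deriv (deriv (pfaffTransform a b c)) z +
      (c - (a + b + 1) * z) * deriv (pfaffTransform a b c) z -
      a * b * pfaffTransform a b c z = 0 := by
  set K : ℂ → ℂ := ordinaryHypergeometric a (c - b) c with hK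
  have h1 := one_sub_ne_zero_of_re_lt hz
  have h1' : z - 1 ≠ 0 := fun h => h1 (by linear_combination -h)
  have hw := norm_div_sub_one_lt_one hz
  have hKa := analyticAt_ordinaryHypergeometric a (c - b) c hw
  have e : deriv (pfaffTransform a b c) =ᶠ[𝓝 z] fun z => (1 - z)⁻¹ *
      (a * ((1 - z) ^ (-a) * K (z / (z - 1)))) -
        ((1 - z) ^ 2)⁻¹ * ((1 - z) ^ (-a) * deriv K (z / (z - 1))) := by
    filter_upwards [isOpen_halfPlane.mem_nhds hz] with y hy
    rw [(hasDerivAt_pfaffTransform a b c hy).deriv]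
    ring
  have d0 := hasDerivAt_pfaffTransform_aux (K := K) (K' := deriv K) a hz
    hKa.differentiableAt.hasDerivAt
  have d1 := hasDerivAt_pfaffTransform_aux (K := deriv K) (K' := deriv (deriv K)) a hz
    hKa.deriv.differentiableAt.hasDerivAt
  have i1 : HasDerivAt (fun z : ℂ => (1 - z)⁻¹) (1 / (1 - z) ^ 2) z :=
    (((hasDerivAt_id z).const_sub 1).fun_inv h1).congr_deriv (by simp)
  have i2 : HasDerivAt (fun z : ℂ => ((1 - z) ^ 2)⁻¹) (2 / (1 - z) ^ 3) z :=
    ((((hasDerivAt_id z).const_sub 1).fun_pow 2).fun_inv (pow_ne_zero 2 h1)).congr_deriv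
      (by simp; field_simp)
  have d2 := (i1.fun_mul (d0.const_mul a)).fun_sub (i2.fun_mul d1)
  rw [e.deriv_eq, e.self_of_nhds, d2.deriv]
  have ode := ordinaryHypergeometric_ode a (c - b) c hc hw
  rw [← hK] at ode
  simp only [pfaffTransform, ← hK]
  generalize deriv (deriv K) (z / (z - 1)) = k2 at *
  generalize deriv K (z / (z - 1)) = k1 at *
  generalize K (z / (z - 1)) = k0 at *
  generalize (1 - z) ^ (-a) = P
  rw [show z - 1 = -(1 - z) by ring] at ode
  generalize hy : 1 - z = y at *
  obtain rfl : z = 1 - y := by rw [← hy]; ring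
  field_simp at ode ⊢
  linear_combination -P * ode


open Filter Topology in
theorem differentiableOn_pfaffTransform (a b c : ℂ) :
    DifferentiableOn ℂ (pfaffTransform a b c) {z | z.re < 1 / 2} := fun _ hz =>
  (hasDerivAt_pfaffTransform a b c hz).differentiableAt.differentiableWithinAt

open Filter Topology in
/-- The Pfaff transformation gives the analytic continuation of the hypergeometric series. -/
theorem isHypergeometricBranch_pfaffTransform (a b c : ℂ) (hc : 0 < c.re) :
    IsHypergeometricBranch a b c (pfaffTransform a b c) := by
  refine ⟨differentiableOn_pfaffTransform a b c, ?_⟩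
  have h0 : (0 : ℂ) ∈ {z : ℂ | z.re < 1 / 2} := by simp
  have hP := (differentiableOn_pfaffTransform a b c).analyticAt (isOpen_halfPlane.mem_nhds h0)
  have hF := analyticAt_ordinaryHypergeometric a b c (z := 0) (by simp)
  have hball : ∀ᶠ z : ℂ in 𝓝 0, ‖z‖ < 1 :=
    continuous_norm.continuousAt.eventually (gt_mem_nhds (by simp))
  have h := eventually_eq_zero_of_hypergeometric_ode (hP.sub hF)
    (by simp [pfaffTransform]) c (a + b + 1) (a * b) hc ?_
  · filter_upwards [h] with z hz using sub_eq_zero.1 hz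
  · have e1 : deriv (pfaffTransform a b c - ordinaryHypergeometric a b c) =ᶠ[𝓝 0]
        fun z => deriv (pfaffTransform a b c) z - deriv (ordinaryHypergeometric a b c) z := by
      filter_upwards [hP.eventually_analyticAt, hF.eventually_analyticAt] with z h1 h2
      exact deriv_sub h1.differentiableAt h2.differentiableAt
    filter_upwards [isOpen_halfPlane.mem_nhds h0, hball, hP.deriv.eventually_analyticAt,
      hF.deriv.eventually_analyticAt, Filter.Eventually.eventually_nhds e1] with z hz hz1 h1 h2 e
    rw [Filter.EventuallyEq.deriv_eq e, e.self_of_nhds,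
      deriv_fun_sub h1.differentiableAt h2.differentiableAt]
    simp only [Pi.sub_apply]
    linear_combination pfaffTransform_ode a b c hc hz - ordinaryHypergeometric_ode a b c hc hz1

/-- `gaussF` is a choice, so it carries information only once a branch is known to exist; the Pfaff
transform is one. -/
theorem isHypergeometricBranch_gaussF (a b c : ℂ) (hc : 0 < c.re) :
    IsHypergeometricBranch a b c (gaussF a b c) :=
  Classical.epsilon_spec ⟨_, isHypergeometricBranch_pfaffTransform a b c hc⟩

theorem analyticOnNhd_gaussF (a b c : ℂ) (hc : 0 < c.re) :
    AnalyticOnNhd ℂ (gaussF a b c) {z | z.re < 1 / 2} :=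
  (isHypergeometricBranch_gaussF a b c hc).1.analyticOnNhd isOpen_halfPlane

theorem gaussF_zero (a b c : ℂ) (hc : 0 < c.re) : gaussF a b c 0 = 1 := by
  rw [(isHypergeometricBranch_gaussF a b c hc).2.self_of_nhds, ordinaryHypergeometric_zero]

/-- The identity theorem on the convex half plane. It carries relations between power series near 0
to all arguments −sinh²(r/2). -/
theorem eqOn_halfPlane_of_eventuallyEq {f g : ℂ → ℂ} (hf : AnalyticOnNhd ℂ f {z | z.re < 1 / 2})
    (hg : AnalyticOnNhd ℂ g {z | z.re < 1 / 2}) (h : f =ᶠ[nhds 0] g) {z : ℂ}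
    (hz : z.re < 1 / 2) : f z = g z :=
  hf.eqOn_of_preconnected_of_eventuallyEq hg
    (convex_halfSpace_re_lt (1 / 2)).isPreconnected (z₀ := 0) (by simp) h hz

open Filter Topology in
theorem deriv_gaussF (a b c : ℂ) (hc : 0 < c.re) {z : ℂ} (hz : z.re < 1 / 2) :
    deriv (gaussF a b c) z = a * b / c * gaussF (a + 1) (b + 1) (c + 1) z := by
  have hc0 : c ≠ 0 := fun h => by simp [h] at hc
  have hc1 : 0 < (c + 1).re := by simp; linarith
  refine eqOn_halfPlane_of_eventuallyEq (analyticOnNhd_gaussF a b c hc).deriv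
    (analyticOnNhd_const.mul (analyticOnNhd_gaussF _ _ _ hc1)) ?_ hz
  have hball : ∀ᶠ z : ℂ in 𝓝 0, ‖z‖ < 1 :=
    continuous_norm.continuousAt.eventually (gt_mem_nhds (by simp))
  filter_upwards [(isHypergeometricBranch_gaussF a b c hc).2.eventually_nhds, hball,
    (isHypergeometricBranch_gaussF (a + 1) (b + 1) (c + 1) hc1).2] with w h1 hw h2
  rw [Filter.EventuallyEq.deriv_eq h1, deriv_ordinaryHypergeometric a b c hc0 hw]
  simp [h2]

-- This is the divergence form of Gauss's equation; it provides the primitive needed for the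
-- integral over a ball.
open Filter Topology in
theorem gaussF_contiguous (a b c : ℂ) (hc : 0 < c.re) {z : ℂ} (hz : z.re < 1 / 2) :
    c * gaussF a b c z = (c - (a + b + 1) * z) * gaussF (a + 1) (b + 1) (c + 1) z +
      z * (1 - z) * deriv (gaussF (a + 1) (b + 1) (c + 1)) z := by
  have hc1 : 0 < (c + 1).re := by simp; linarith
  have hH := analyticOnNhd_gaussF (a + 1) (b + 1) (c + 1) hc1
  refine eqOn_halfPlane_of_eventuallyEq (f := fun z => c * gaussF a b c z)
    (g := fun z => (c - (a + b + 1) * z) * gaussF (a + 1) (b + 1) (c + 1) z +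
      z * (1 - z) * deriv (gaussF (a + 1) (b + 1) (c + 1)) z)
    (analyticOnNhd_const.mul (analyticOnNhd_gaussF _ _ _ hc)) ?_ ?_ hz
  · exact ((analyticOnNhd_const.sub (analyticOnNhd_const.mul analyticOnNhd_id)).mul hH).add
      ((analyticOnNhd_id.mul (analyticOnNhd_const.sub analyticOnNhd_id)).mul hH.deriv)
  have hball : ∀ᶠ z : ℂ in 𝓝 0, ‖z‖ < 1 :=
    continuous_norm.continuousAt.eventually (gt_mem_nhds (by simp))
  filter_upwards [(isHypergeometricBranch_gaussF a b c hc).2, hball,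
    (isHypergeometricBranch_gaussF (a + 1) (b + 1) (c + 1) hc1).2.eventually_nhds] with w h1 hw h2
  simp only [h1, Filter.EventuallyEq.deriv_eq h2, h2.self_of_nhds,
    ordinaryHypergeometric_contiguous a b c hc hw]

open Filter Topology in
theorem gaussF_ode (a b c : ℂ) (hc : 0 < c.re) {z : ℂ} (hz : z.re < 1 / 2) :
    z * (1 - z) * deriv (deriv (gaussF a b c)) z + (c - (a + b + 1) * z) * deriv (gaussF a b c) z =
      a * b * gaussF a b c z := by
  have hc0 : c ≠ 0 := fun h => by simp [h] at hc
  have hc1 : 0 < (c + 1).re := by simp; linarith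
  have e : deriv (gaussF a b c) =ᶠ[𝓝 z] fun z => a * b / c * gaussF (a + 1) (b + 1) (c + 1) z := by
    filter_upwards [isOpen_halfPlane.mem_nhds hz] with w hw using deriv_gaussF a b c hc hw
  rw [e.deriv_eq, e.self_of_nhds, deriv_const_mul _
    (analyticOnNhd_gaussF (a + 1) (b + 1) (c + 1) hc1 z hz).differentiableAt]
  have h := gaussF_contiguous a b c hc hz
  field_simp
  linear_combination -(a * b) * h

end

/-! ### H-type identities and the function u = sinh²(r/2) -/

noncomputable section

namespace HTypeAlgebra

variable {p q : ℕ} (S : HTypeAlgebra p q)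

theorem bracket_swap (v w : EuclideanSpace ℝ (Fin p)) : S.bracket w v = -S.bracket v w := by
  have h := S.bracket_self (v + w)
  simp only [map_add, LinearMap.add_apply, S.bracket_self, zero_add, add_zero] at h
  exact eq_neg_of_add_eq_zero_right (by rw [← h]; abel)

theorem inner_J_swap (z : EuclideanSpace ℝ (Fin q)) (v w : EuclideanSpace ℝ (Fin p)) :
    inner ℝ (S.J z v) w = -inner ℝ v (S.J z w) := by
  rw [S.inner_J, S.bracket_swap, inner_neg_right, ← S.inner_J, real_inner_comm]

theorem inner_J_self (z : EuclideanSpace ℝ (Fin q)) (v : EuclideanSpace ℝ (Fin p)) :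
    inner ℝ (S.J z v) v = 0 := by
  rw [S.inner_J, S.bracket_self, inner_zero_right]

theorem inner_self_J (z : EuclideanSpace ℝ (Fin q)) (v : EuclideanSpace ℝ (Fin p)) :
    inner ℝ v (S.J z v) = 0 := by
  rw [real_inner_comm, S.inner_J_self]

theorem inner_J_J_self (z : EuclideanSpace ℝ (Fin q)) (v : EuclideanSpace ℝ (Fin p)) :
    inner ℝ (S.J z v) (S.J z v) = ‖z‖ ^ 2 * ‖v‖ ^ 2 := by
  rw [S.inner_J_swap, S.J_sq, inner_smul_right, real_inner_self_eq_norm_sq]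
  ring

theorem norm_J_sq (z : EuclideanSpace ℝ (Fin q)) (v : EuclideanSpace ℝ (Fin p)) :
    ‖S.J z v‖ ^ 2 = ‖z‖ ^ 2 * ‖v‖ ^ 2 := by
  rw [← S.inner_J_J_self, real_inner_self_eq_norm_sq]

/-- Polarization in z of |J_z v|² = |z|²|v|². -/
theorem inner_J_J (z z' : EuclideanSpace ℝ (Fin q)) (v : EuclideanSpace ℝ (Fin p)) :
    inner ℝ (S.J z v) (S.J z' v) = inner ℝ z z' * ‖v‖ ^ 2 := by
  have h := S.inner_J_J_self (z + z') v
  rw [map_add, LinearMap.add_apply, inner_add_left, inner_add_right, inner_add_right,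
    S.inner_J_J_self, S.inner_J_J_self, norm_add_sq_real,
    real_inner_comm (S.J z v) (S.J z' v)] at h
  linarith

/-- Pairing with z' gives ⟨J_{z'} v, J_z v⟩ = ⟨z', z⟩|v|². This determines brackets in the span of v
and J_z v, the span in which both grad u and the radial curves have their 𝔳-components. -/
theorem bracket_J (z : EuclideanSpace ℝ (Fin q)) (v : EuclideanSpace ℝ (Fin p)) :
    S.bracket v (S.J z v) = ‖v‖ ^ 2 • z := by
  refine ext_inner_left ℝ fun z' => ?_
  rw [← S.inner_J, S.inner_J_J, inner_smul_right, mul_comm]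

end HTypeAlgebra

namespace DRCoord

variable {p q : ℕ}

theorem norm_sq_eq (x : DRCoord p q) : ‖x‖ ^ 2 = ‖x.v‖ ^ 2 + ‖x.z‖ ^ 2 + x.t ^ 2 := by
  rw [← real_inner_self_eq_norm_sq, inner_eq, real_inner_self_eq_norm_sq,
    real_inner_self_eq_norm_sq]
  ring

/-- The component in `𝔳` as a continuous linear map. -/
def vL : DRCoord p q →L[ℝ] EuclideanSpace ℝ (Fin p) :=
  LinearMap.toContinuousLinearMap (E := DRCoord p q) ⟨⟨v, v_add⟩, v_smul⟩
/-- The component in `𝔷` as a continuous linear map. -/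
def zL : DRCoord p q →L[ℝ] EuclideanSpace ℝ (Fin q) :=
  LinearMap.toContinuousLinearMap (E := DRCoord p q) ⟨⟨z, z_add⟩, z_smul⟩
/-- The component in `ℝ` as a continuous linear map. -/
def tL : DRCoord p q →L[ℝ] ℝ :=
  LinearMap.toContinuousLinearMap (E := DRCoord p q) ⟨⟨t, t_add⟩, t_smul⟩

@[simp] theorem vL_apply (x : DRCoord p q) : vL x = x.v := rfl
@[simp] theorem zL_apply (x : DRCoord p q) : zL x = x.z := rfl
@[simp] theorem tL_apply (x : DRCoord p q) : tL x = x.t := rfl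

/-- The coordinates as a continuous linear map on the product. -/
def mkL : EuclideanSpace ℝ (Fin p) × EuclideanSpace ℝ (Fin q) × ℝ →L[ℝ] DRCoord p q :=
  LinearMap.toContinuousLinearMap (F' := DRCoord p q)
    ⟨⟨fun y => mk y.1 y.2.1 y.2.2, fun _ _ => rfl⟩, fun _ _ => rfl⟩

@[simp] theorem mkL_apply (y : EuclideanSpace ℝ (Fin p) × EuclideanSpace ℝ (Fin q) × ℝ) :
    mkL y = mk y.1 y.2.1 y.2.2 := rfl

theorem hasFDerivAt_v (x : DRCoord p q) : HasFDerivAt v (vL : DRCoord p q →L[ℝ] _) x :=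
  vL.hasFDerivAt
theorem hasFDerivAt_z (x : DRCoord p q) : HasFDerivAt z (zL : DRCoord p q →L[ℝ] _) x :=
  zL.hasFDerivAt
theorem hasFDerivAt_t (x : DRCoord p q) : HasFDerivAt t (tL : DRCoord p q →L[ℝ] _) x :=
  tL.hasFDerivAt

theorem hasFDerivAt_mk {E : Type*} [NormedAddCommGroup E] [NormedSpace ℝ E]
    {f : E → EuclideanSpace ℝ (Fin p)} {g : E → EuclideanSpace ℝ (Fin q)} {k : E → ℝ}
    {f' : E →L[ℝ] EuclideanSpace ℝ (Fin p)} {g' : E →L[ℝ] EuclideanSpace ℝ (Fin q)}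
    {k' : E →L[ℝ] ℝ} {y : E} (hf : HasFDerivAt f f' y) (hg : HasFDerivAt g g' y)
    (hk : HasFDerivAt k k' y) :
    HasFDerivAt (fun y => mk (f y) (g y) (k y)) (mkL ∘L (f'.prod (g'.prod k'))) y :=
  HasFDerivAt.comp y mkL.hasFDerivAt (hf.prodMk (hg.prodMk hk))

theorem hasDerivAt_mk {f : ℝ → EuclideanSpace ℝ (Fin p)} {g : ℝ → EuclideanSpace ℝ (Fin q)}
    {k : ℝ → ℝ} {f' : EuclideanSpace ℝ (Fin p)} {g' : EuclideanSpace ℝ (Fin q)}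
    {k' : ℝ} {s : ℝ} (hf : HasDerivAt f f' s) (hg : HasDerivAt g g' s)
    (hk : HasDerivAt k k' s) :
    HasDerivAt (fun y => mk (f y) (g y) (k y)) (mk f' g' k') s :=
  mkL.hasFDerivAt.comp_hasDerivAt s (hf.prodMk (hg.prodMk hk))

/-- `1 + e^t + |v|²/4`. -/
def height (x : DRCoord p q) : ℝ := 1 + Real.exp x.t + ‖x.v‖ ^ 2 / 4

/-- The function `sinh² (r / 2)`, where `r` is the distance to the identity. -/
def sinhSq (x : DRCoord p q) : ℝ :=
  (x.height ^ 2 + ‖x.z‖ ^ 2) / (4 * Real.exp x.t) - 1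

theorem sinhSq_add_one (x : DRCoord p q) :
    4 * Real.exp x.t * (x.sinhSq + 1) = x.height ^ 2 + ‖x.z‖ ^ 2 := by
  have := Real.exp_pos x.t
  rw [sinhSq]; field_simp; ring

/-- Expanding, 4e^t u = (1 − e^t)² + |z|² + (1 + e^t)|v|²/2 + |v|⁴/16. The same expansion shows that
u vanishes only at the origin. -/
theorem sinhSq_nonneg (x : DRCoord p q) : 0 ≤ x.sinhSq := by
  have h := x.sinhSq_add_one
  have ha := Real.exp_pos x.t
  have : 0 ≤ 4 * Real.exp x.t * x.sinhSq := by
    have e : 4 * Real.exp x.t * x.sinhSq = x.height ^ 2 + ‖x.z‖ ^ 2 - 4 * Real.exp x.t := by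
      linarith
    rw [e, height]
    nlinarith [sq_nonneg (1 - Real.exp x.t), sq_nonneg ‖x.z‖, sq_nonneg ‖x.v‖,
      mul_nonneg ha.le (sq_nonneg ‖x.v‖), sq_nonneg (‖x.v‖ ^ 2)]
  exact nonneg_of_mul_nonneg_right this (by positivity)

theorem eq_zero_of_sinhSq_eq_zero {x : DRCoord p q} (h0 : x.sinhSq = 0) : x = 0 := by
  have h := x.sinhSq_add_one
  have ha := Real.exp_pos x.t
  rw [h0, height] at h
  have e : (1 - Real.exp x.t) ^ 2 + ‖x.z‖ ^ 2 + ‖x.v‖ ^ 2 / 2 + Real.exp x.t * ‖x.v‖ ^ 2 / 2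
    + (‖x.v‖ ^ 2) ^ 2 / 16 = 0 := by linarith
  have e0 := mul_nonneg ha.le (sq_nonneg ‖x.v‖)
  have e1 : (1 - Real.exp x.t) ^ 2 = 0 := by nlinarith [sq_nonneg (1 - Real.exp x.t)]
  have e2 : ‖x.z‖ ^ 2 = 0 := by nlinarith [sq_nonneg (1 - Real.exp x.t), sq_nonneg ‖x.z‖]
  have e3 : ‖x.v‖ ^ 2 = 0 := by nlinarith [sq_nonneg (1 - Real.exp x.t), sq_nonneg ‖x.z‖]
  have e4 : Real.exp x.t = 1 := by
    have := pow_eq_zero_iff (two_ne_zero) |>.1 e1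
    linarith
  ext1
  · exact norm_eq_zero.1 (pow_eq_zero_iff two_ne_zero |>.1 e3)
  · exact norm_eq_zero.1 (pow_eq_zero_iff two_ne_zero |>.1 e2)
  · exact (Real.exp_eq_one_iff _).1 e4

theorem sinhSq_mk_zero_zero (t : ℝ) : (mk 0 0 t : DRCoord p q).sinhSq = Real.sinh (t / 2) ^ 2 := by
  have : Real.exp t = Real.exp (t / 2) ^ 2 := by rw [← Real.exp_nat_mul]; ring_nf
  rw [sinhSq, height, Real.sinh_eq, Real.exp_neg]
  simp only [v_mk, z_mk, t_mk, norm_zero, this]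
  field_simp
  ring

@[simp] theorem sinhSq_zero : (0 : DRCoord p q).sinhSq = 0 := by
  have := sinhSq_mk_zero_zero (p := p) (q := q) 0
  rw [show (0 : DRCoord p q) = mk 0 0 0 from rfl, this]
  simp

theorem contDiff_height {n : ℕ∞ω} : ContDiff ℝ n (height : DRCoord p q → ℝ) :=
  (contDiff_const.add (Real.contDiff_exp.comp contDiff_t)).add
    ((contDiff_v.norm_sq ℝ).div_const 4)

theorem contDiff_sinhSq {n : ℕ∞ω} : ContDiff ℝ n (sinhSq : DRCoord p q → ℝ) := by
  refine ContDiff.sub (ContDiff.div ((contDiff_height.pow 2).add (contDiff_z.norm_sq ℝ))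
    (contDiff_const.mul (Real.contDiff_exp.comp contDiff_t)) fun x => ?_) contDiff_const
  exact (mul_pos four_pos (Real.exp_pos _)).ne'

theorem hasFDerivAt_height (x : DRCoord p q) :
    HasFDerivAt height ((2⁻¹ : ℝ) • (innerSL ℝ x.v ∘L vL) + Real.exp x.t • tL) x := by
  have h := (((hasFDerivAt_t x).exp.const_add 1).add ((hasFDerivAt_v x).norm_sq.mul_const (1 / 4)))
  refine HasFDerivAt.congr_fderiv (h.congr_of_eventuallyEq (Filter.Eventually.of_forall fun y => by
    simp only [height, Pi.add_apply]; ring)) ?_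
  ext ξ
  simp
  ring

/-- The Euclidean gradient of `sinhSq`. -/
def sinhSqGradient (x : DRCoord p q) : DRCoord p q :=
  mk ((x.height / (4 * Real.exp x.t)) • x.v) ((1 / (2 * Real.exp x.t)) • x.z)
    (x.height / 2 - (x.sinhSq + 1))

theorem hasFDerivAt_sinhSq (x : DRCoord p q) :
    HasFDerivAt sinhSq (innerSL ℝ x.sinhSqGradient) x := by
  have ha := (Real.exp_pos x.t).ne'
  have h := ((((hasFDerivAt_height x).pow 2).add (hasFDerivAt_z x).norm_sq).mul
    ((hasFDerivAt_t x).neg.exp.mul_const (1 / 4))).sub_const 1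
  have h' : HasFDerivAt sinhSq _ x := h.congr_of_eventuallyEq (Filter.Eventually.of_forall
    fun y => by
      simp only [sinhSq, Pi.add_apply, Pi.mul_apply, Pi.neg_apply, Real.exp_neg]
      field_simp)
  refine h'.congr_fderiv ?_
  ext ξ
  simp [inner_eq, sinhSqGradient, inner_smul_left, sinhSq, Real.exp_neg]
  field_simp
  ring

end DRCoord

end

/-! ### The gradient of u for the left-invariant metric -/

noncomputable section

namespace DamekRicci

variable {p q : ℕ} {S : HTypeAlgebra p q}

theorem frame_symm_apply (x : DamekRicci S) (ξ : DRCoord p q) :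
    (frame x).symm ξ = DRCoord.mk (Real.exp (-x.t / 2) • ξ.v)
      (Real.exp (-x.t) • (ξ.z - (1 / 2 : ℝ) • S.bracket x.v ξ.v)) ξ.t := rfl

/-- The gradient of `sinhSq` in the left-invariant frame. -/
def sinhSqFrameGradient (S : HTypeAlgebra p q) (x : DRCoord p q) : DRCoord p q :=
  DRCoord.mk ((Real.exp (-x.t / 2) / 4) • (x.height • x.v + S.J x.z x.v)) ((1 / 2 : ℝ) • x.z)
    (x.height / 2 - (x.sinhSq + 1))

/-- The Riemannian gradient of `sinhSq`. -/
def sinhSqGrad (S : HTypeAlgebra p q) (x : DRCoord p q) : DRCoord p q :=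
  DRCoord.mk ((1 / 4 : ℝ) • (x.height • x.v + S.J x.z x.v))
    ((Real.exp x.t / 2 + ‖x.v‖ ^ 2 / 8) • x.z) (x.height / 2 - (x.sinhSq + 1))

theorem adjoint_frame_sinhSqGradient (x : DRCoord p q) :
    ContinuousLinearMap.adjoint (frame (ofCoord S x) : DRCoord p q →L[ℝ] DRCoord p q)
      x.sinhSqGradient = sinhSqFrameGradient S x := by
  refine ext_inner_right ℝ fun ξ => ?_
  rw [ContinuousLinearMap.adjoint_inner_left]
  have e : Real.exp x.t = Real.exp (x.t / 2) ^ 2 := by rw [← Real.exp_nat_mul]; ring_nf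
  have ha := (Real.exp_pos (x.t / 2)).ne'
  change inner ℝ _ (DRCoord.mk (Real.exp (x.t / 2) • ξ.v)
      (Real.exp x.t • ξ.z + (Real.exp (x.t / 2) / 2) • S.bracket x.v ξ.v) ξ.t) = _
  simp only [DRCoord.inner_eq, DRCoord.sinhSqGradient, sinhSqFrameGradient, DRCoord.v_mk,
    DRCoord.z_mk, DRCoord.t_mk, inner_smul_left, inner_smul_right, inner_add_left,
    inner_add_right, ← S.inner_J, map_smul, LinearMap.smul_apply, e, neg_div, Real.exp_neg,
    RCLike.conj_to_real]
  field_simp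
  ring

theorem frame_sinhSqFrameGradient (x : DRCoord p q) :
    frame (ofCoord S x) (sinhSqFrameGradient S x) = sinhSqGrad S x := by
  have h1 : Real.exp (x.t / 2) * Real.exp (-x.t / 2) = 1 := by
    rw [← Real.exp_add]; ring_nf; simp
  change DRCoord.mk (Real.exp (x.t / 2) • _) (Real.exp x.t • _ + (Real.exp (x.t / 2) / 2) •
    S.bracket x.v _) _ = _
  ext1
  · simp only [sinhSqFrameGradient, sinhSqGrad, DRCoord.v_mk, smul_smul]
    congr 1
    linear_combination h1 / 4
  · simp only [sinhSqFrameGradient, sinhSqGrad, DRCoord.z_mk, DRCoord.v_mk, map_smul, map_add,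
      S.bracket_self, S.bracket_J, smul_zero, zero_add, smul_smul, ← add_smul]
    congr 1
    linear_combination h1 * ‖x.v‖ ^ 2 / 8
  · rfl

/-- Put R = H² + |z|² = 4e^t(u + 1). Since J_z v is orthogonal to v and |J_z v| = |z||v|, the
𝔳-component has square R|v|²/(16e^t) = (u + 1)|v|²/4, and |z|²/4 + H²/4 = e^t(u + 1). The total is
(u + 1)(|v|²/4 + e^t − H + u + 1) = (u + 1)u. -/
theorem norm_sinhSqFrameGradient_sq (x : DRCoord p q) :
    ‖sinhSqFrameGradient S x‖ ^ 2 = x.sinhSq * (x.sinhSq + 1) := by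
  have e : Real.exp x.t = Real.exp (x.t / 2) ^ 2 := by rw [← Real.exp_nat_mul]; ring_nf
  have ha := (Real.exp_pos (x.t / 2)).ne'
  have h := x.sinhSq_add_one
  rw [DRCoord.norm_sq_eq]
  simp only [sinhSqFrameGradient, DRCoord.v_mk, DRCoord.z_mk, DRCoord.t_mk, norm_smul, mul_pow,
    norm_add_sq_real, inner_smul_left, S.inner_self_J, S.norm_J_sq, Real.norm_eq_abs, sq_abs,
    neg_div, Real.exp_neg]
  rw [e] at h
  have hh : x.height = 1 + Real.exp (x.t / 2) ^ 2 + ‖x.v‖ ^ 2 / 4 := by rw [DRCoord.height, e]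
  generalize Real.exp (x.t / 2) = b at *
  generalize x.sinhSq = u at *
  have hv : ‖x.v‖ ^ 2 = 4 * (x.height - 1 - b ^ 2) := by linarith
  generalize x.height = H at *
  rw [hv]
  field_simp
  linear_combination (-16 * (H - 1) + 0 * b ^ 2) * h

theorem fderiv_sinhSq_apply (x ξ : DRCoord p q) :
    inner ℝ x.sinhSqGradient ξ =
      inner ℝ (sinhSqFrameGradient S x) ((frame (ofCoord S x)).symm ξ) := by
  rw [← adjoint_frame_sinhSqGradient, ContinuousLinearMap.adjoint_inner_left]
  simp

theorem inner_sinhSqGradient_sinhSqGrad (x : DRCoord p q) :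
    inner ℝ x.sinhSqGradient (sinhSqGrad S x) = x.sinhSq * (x.sinhSq + 1) := by
  rw [fderiv_sinhSq_apply (S := S), ← frame_sinhSqFrameGradient,
    ContinuousLinearEquiv.symm_apply_apply, real_inner_self_eq_norm_sq,
    norm_sinhSqFrameGradient_sq]

theorem abs_inner_sinhSqGradient_le (x ξ : DRCoord p q) :
    |inner ℝ x.sinhSqGradient ξ| ≤
      Real.sqrt (x.sinhSq * (x.sinhSq + 1)) * ‖(frame (ofCoord S x)).symm ξ‖ := by
  rw [fderiv_sinhSq_apply (S := S), ← norm_sinhSqFrameGradient_sq (S := S),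
    Real.sqrt_sq (norm_nonneg _)]
  exact abs_real_inner_le_norm _ _

/-! ### The Riemannian distance to the identity -/

theorem enorm_tangent (x : DamekRicci S) (ξ : TangentSpace 𝓘(ℝ, DRCoord p q) x) :
    ‖ξ‖ₑ = ‖(frame x).symm (ξ : DRCoord p q)‖ₑ := by
  have h1 : ‖ξ‖ ^ 2 = ‖(frame x).symm (ξ : DRCoord p q)‖ ^ 2 := by
    rw [← real_inner_self_eq_norm_sq, ← real_inner_self_eq_norm_sq]
    rfl
  have h : ‖ξ‖ = ‖(frame x).symm (ξ : DRCoord p q)‖ := by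
    rwa [sq_eq_sq₀ (norm_nonneg _) (norm_nonneg _)] at h1
  rw [← ofReal_norm, ← ofReal_norm, h]

theorem mfderiv_path (γ : ℝ → DamekRicci S) (s : ℝ) :
    mfderiv 𝓘(ℝ, ℝ) 𝓘(ℝ, DRCoord p q) γ s = fderiv ℝ (fun s => (γ s).coord) s :=
  mfderiv_eq_fderiv (f := fun s => (γ s).coord)

/-- A function with gradient of norm at most 1 maps an almost minimal path to a path in ℝ that is no
longer, and the Riemannian distance of ℝ is the usual one. -/
theorem ofReal_sub_le_edist {f : DRCoord p q → ℝ} (hf : ContDiff ℝ 1 f)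
    (hf' : ∀ x ξ, |fderiv ℝ f x ξ| ≤ ‖(frame (ofCoord S x)).symm ξ‖) (x y : DamekRicci S) :
    ENNReal.ofReal (f x.coord - f y.coord) ≤ edist x y := by
  refine le_of_forall_gt fun r hr => ?_
  rw [IsRiemannianManifold.out (I := 𝓘(ℝ, DRCoord p q)) x y] at hr
  obtain ⟨γ, h0, h1, hγ, hlen⟩ := Manifold.exists_lt_of_riemannianEDist_lt hr
  have hγ' : ContDiffOn ℝ 1 (fun s => (γ s).coord) (Set.Icc 0 1) :=
    contMDiffOn_iff_contDiffOn (f := fun s => (γ s).coord).1 hγ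
  set g : ℝ → ℝ := fun s => f (γ s).coord with hg
  have hgd : ContDiffOn ℝ 1 g (Set.Icc 0 1) := hf.comp_contDiffOn hγ'
  have e1 : Manifold.riemannianEDist 𝓘(ℝ, ℝ) (f x.coord) (f y.coord) ≤
      Manifold.pathELength 𝓘(ℝ, ℝ) g 0 1 :=
    Manifold.riemannianEDist_le_pathELength hgd.contMDiffOn (by simp [hg, h0]) (by simp [hg, h1])
      zero_le_one
  have e2 : Manifold.pathELength 𝓘(ℝ, ℝ) g 0 1 ≤
      Manifold.pathELength 𝓘(ℝ, DRCoord p q) γ 0 1 := by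
    rw [Manifold.pathELength_eq_lintegral_mfderiv_Ioo, Manifold.pathELength_eq_lintegral_mfderiv_Ioo]
    refine setLIntegral_mono' measurableSet_Ioo fun s hs => ?_
    have hd : DifferentiableAt ℝ (fun s => (γ s).coord) s :=
      (hγ'.differentiableOn one_ne_zero s ⟨hs.1.le, hs.2.le⟩).differentiableAt
        (Icc_mem_nhds hs.1 hs.2)
    have hc : fderiv ℝ g s 1 = fderiv ℝ f (γ s).coord (fderiv ℝ (fun s => (γ s).coord) s 1) := by
      have := fderiv_comp s (hf.differentiable one_ne_zero (γ s).coord) hd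
      exact congrArg (fun L => L 1) this
    rw [enorm_tangent, mfderiv_path, mfderiv_eq_fderiv, enorm_tangentSpace_vectorSpace]
    erw [hc]
    rw [← ofReal_norm, ← ofReal_norm]
    exact ENNReal.ofReal_le_ofReal (hf' _ _)
  have e3 : edist (f x.coord) (f y.coord) < r := by
    rw [IsRiemannianManifold.out (I := 𝓘(ℝ, ℝ)) (f x.coord) (f y.coord)]
    exact (e1.trans e2).trans_lt hlen
  refine lt_of_le_of_lt ?_ e3
  rw [edist_dist, Real.dist_eq]
  exact ENNReal.ofReal_le_ofReal (le_abs_self _)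

end DamekRicci

end

/-! ### Radial curves from the ball model -/

noncomputable section

namespace DamekRicci

variable {p q : ℕ} {S : HTypeAlgebra p q}

theorem norm_frame_symm_sq (x : DamekRicci S) (ξ : DRCoord p q) :
    ‖(frame x).symm ξ‖ ^ 2 = Real.exp (-x.t) * ‖ξ.v‖ ^ 2 +
      Real.exp (-x.t) ^ 2 * ‖ξ.z - (1 / 2 : ℝ) • S.bracket x.v ξ.v‖ ^ 2 + ξ.t ^ 2 := by
  have e : Real.exp (-x.t) = Real.exp (-x.t / 2) ^ 2 := by rw [← Real.exp_nat_mul]; ring_nf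
  rw [frame_symm_apply, DRCoord.norm_sq_eq]
  simp only [DRCoord.v_mk, DRCoord.z_mk, DRCoord.t_mk, norm_smul, mul_pow, Real.norm_eq_abs,
    sq_abs, ← e]

/-- The denominator of the Cayley transform along a ray. -/
def cayleyDenom (y σ θ : ℝ) : ℝ := (1 - σ * θ) ^ 2 + y ^ 2 * θ ^ 2

/-- The Cayley transform along the ray through `(V, Y, σ)`. -/
def cayley (S : HTypeAlgebra p q) (η : DRCoord p q) (θ : ℝ) : DRCoord p q :=
  DRCoord.mk
    ((2 * θ * (1 - η.t * θ) / cayleyDenom ‖η.z‖ η.t θ) • η.v +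
      (2 * θ ^ 2 / cayleyDenom ‖η.z‖ η.t θ) • S.J η.z η.v)
    ((2 * θ / cayleyDenom ‖η.z‖ η.t θ) • η.z)
    (Real.log ((1 - θ ^ 2) / cayleyDenom ‖η.z‖ η.t θ))

/-- The derivative of `cayley`. -/
def cayleyDeriv (S : HTypeAlgebra p q) (η : DRCoord p q) (θ : ℝ) : DRCoord p q :=
  DRCoord.mk
    ((2 * ((1 - η.t * θ) ^ 2 - ‖η.z‖ ^ 2 * θ ^ 2) / cayleyDenom ‖η.z‖ η.t θ ^ 2) • η.v +
      (4 * θ * (1 - η.t * θ) / cayleyDenom ‖η.z‖ η.t θ ^ 2) • S.J η.z η.v)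
    ((2 * (1 - θ ^ 2 * (η.t ^ 2 + ‖η.z‖ ^ 2)) / cayleyDenom ‖η.z‖ η.t θ ^ 2) • η.z)
    (-(2 * θ / (1 - θ ^ 2)) -
      (-(2 * η.t * (1 - η.t * θ)) + 2 * θ * ‖η.z‖ ^ 2) / cayleyDenom ‖η.z‖ η.t θ)

theorem cayleyDenom_pos {y σ θ : ℝ} (hσ : σ ^ 2 ≤ 1) (hθ : θ ^ 2 < 1) :
    0 < cayleyDenom y σ θ := by
  have : σ * θ < 1 := by nlinarith [sq_nonneg (σ - θ)]
  rw [cayleyDenom]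
  have h1 : 0 < (1 - σ * θ) ^ 2 := pow_pos (by linarith) 2
  positivity

theorem hasDerivAt_cayleyDenom (y σ θ : ℝ) :
    HasDerivAt (cayleyDenom y σ) (-(2 * σ * (1 - σ * θ)) + 2 * θ * y ^ 2) θ := by
  have h := ((((hasDerivAt_id θ).const_mul σ).const_sub 1).fun_pow 2).fun_add
    (((hasDerivAt_id θ).fun_pow 2).const_mul (y ^ 2))
  refine h.congr_deriv ?_
  simp
  ring

theorem hasDerivAt_cayley {η : DRCoord p q} (hη : η.t ^ 2 ≤ 1) {θ : ℝ} (hθ : θ ^ 2 < 1) :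
    HasDerivAt (cayley S η) (cayleyDeriv S η θ) θ := by
  have hχ := (cayleyDenom_pos (y := ‖η.z‖) hη hθ).ne'
  have h1 : 1 - θ ^ 2 ≠ 0 := by linarith
  have d := hasDerivAt_cayleyDenom ‖η.z‖ η.t θ
  have i := hasDerivAt_id θ
  have dv1 := ((((i.const_mul 2).fun_mul ((i.const_mul η.t).const_sub 1)).fun_div d hχ)).smul_const η.v
  have dv2 := (((i.fun_pow 2).const_mul 2).fun_div d hχ).smul_const (S.J η.z η.v)
  have dz := ((i.const_mul 2).fun_div d hχ).smul_const η.z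
  have dt := (((i.fun_pow 2).const_sub 1).fun_div d hχ).log (div_ne_zero h1 hχ)
  refine (DRCoord.hasDerivAt_mk (dv1.fun_add dv2) dz dt).congr_deriv ?_
  simp only [id]
  rw [cayleyDeriv]
  congr 1
  · congr 2
    · simp only [cayleyDenom] at hχ ⊢
      field_simp
      ring
    · simp only [cayleyDenom] at hχ ⊢
      field_simp
      ring
  · congr 1
    simp only [cayleyDenom] at hχ ⊢
    field_simp
    ring
  · field_simp
    ring

/-- Along rays the metric of the ball model is 4dθ²/(1 − θ²)², whatever the direction. -/
theorem norm_frame_symm_cayleyDeriv {η : DRCoord p q} (hη : ‖η‖ = 1) {θ : ℝ} (hθ : θ ^ 2 < 1) :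
    ‖(frame (ofCoord S (cayley S η θ))).symm (cayleyDeriv S η θ)‖ = 2 / (1 - θ ^ 2) := by
  have hn := DRCoord.norm_sq_eq η
  rw [hη] at hn
  have hη' : η.t ^ 2 ≤ 1 := by nlinarith [sq_nonneg ‖η.v‖, sq_nonneg ‖η.z‖]
  have hχ' := (cayleyDenom_pos (y := ‖η.z‖) hη' hθ)
  have hχ := hχ'.ne'
  have h1' : 0 < 1 - θ ^ 2 := by linarith
  have h1 : 1 - θ ^ 2 ≠ 0 := h1'.ne'
  rw [← sq_eq_sq₀ (norm_nonneg _) (by positivity), norm_frame_symm_sq]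
  have hv : ‖η.v‖ ^ 2 = 1 - ‖η.z‖ ^ 2 - η.t ^ 2 := by linarith
  have hD : cayleyDenom ‖η.z‖ η.t θ = (1 - η.t * θ) ^ 2 + ‖η.z‖ ^ 2 * θ ^ 2 := rfl
  have ht : Real.exp (-(ofCoord S (cayley S η θ)).t) = cayleyDenom ‖η.z‖ η.t θ / (1 - θ ^ 2) := by
    change Real.exp (-Real.log _) = _
    rw [Real.exp_neg, Real.exp_log (by positivity), inv_div]
  -- The unit length of η enters here through |V|² = 1 − |Y|² − σ²; with it the corrected
  -- 𝔷-component collapses to a simple multiple of Y.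
  have hb : (cayleyDeriv S η θ).z - (1 / 2 : ℝ) • S.bracket (ofCoord S (cayley S η θ)).v
      (cayleyDeriv S η θ).v = (2 * (1 - θ ^ 2) / cayleyDenom ‖η.z‖ η.t θ ^ 2) • η.z := by
    change _ - (1 / 2 : ℝ) • S.bracket (_ • η.v + _ • S.J η.z η.v) _ = _
    simp only [cayleyDeriv, DRCoord.z_mk, DRCoord.v_mk, map_add, map_smul, LinearMap.add_apply,
      LinearMap.smul_apply, S.bracket_self, S.bracket_J, S.bracket_swap η.v (S.J η.z η.v),
      smul_zero, zero_add, add_zero, smul_smul, ← neg_smul, ← add_smul, ← sub_smul]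
    congr 1
    rw [hv]
    field_simp
    linear_combination 2 * θ ^ 2 * (1 - ‖η.z‖ ^ 2 - η.t ^ 2) * hD
  have hw : ‖(cayleyDeriv S η θ).v‖ ^ 2 =
      4 * ‖η.v‖ ^ 2 / cayleyDenom ‖η.z‖ η.t θ ^ 2 := by
    simp only [cayleyDeriv, DRCoord.v_mk, norm_smul, norm_add_sq_real, mul_pow,
      inner_smul_left, inner_smul_right, S.inner_self_J, S.norm_J_sq, Real.norm_eq_abs, sq_abs]
    field_simp
    linear_combination -4 * ‖η.v‖ ^ 2 * (cayleyDenom ‖η.z‖ η.t θ + ((1 - η.t * θ) ^ 2 +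
      ‖η.z‖ ^ 2 * θ ^ 2)) * hD
  rw [ht, hb, hw, hv, norm_smul, mul_pow, Real.norm_eq_abs, sq_abs]
  simp only [cayleyDeriv, DRCoord.t_mk]
  -- The denominator is a quadratic polynomial D in θ, and these are its discriminant identity D'² =
  -- 4(σ² + |Y|²)D − 4|Y|² and the formula for θD'.
  have e1 : (-(2 * η.t * (1 - η.t * θ)) + 2 * θ * ‖η.z‖ ^ 2) ^ 2 =
      4 * (η.t ^ 2 + ‖η.z‖ ^ 2) * cayleyDenom ‖η.z‖ η.t θ - 4 * ‖η.z‖ ^ 2 := by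
    rw [hD]; ring
  have e2 : θ * (-(2 * η.t * (1 - η.t * θ)) + 2 * θ * ‖η.z‖ ^ 2) =
      cayleyDenom ‖η.z‖ η.t θ - 1 + θ ^ 2 * (η.t ^ 2 + ‖η.z‖ ^ 2) := by
    rw [hD]; ring
  generalize -(2 * η.t * (1 - η.t * θ)) + 2 * θ * ‖η.z‖ ^ 2 = P at *
  generalize cayleyDenom ‖η.z‖ η.t θ = D at *
  field_simp
  linear_combination 4 * D * (1 - θ ^ 2) * e2 + (1 - θ ^ 2) ^ 2 * e1

theorem contDiffAt_cayley {η : DRCoord p q} (hη : η.t ^ 2 ≤ 1) {θ : ℝ} (hθ : θ ^ 2 < 1)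
    {n : ℕ∞ω} : ContDiffAt ℝ n (cayley S η) θ := by
  have hχ := (cayleyDenom_pos (y := ‖η.z‖) hη hθ).ne'
  have h1 : 1 - θ ^ 2 ≠ 0 := by linarith
  have d : ContDiffAt ℝ n (cayleyDenom ‖η.z‖ η.t) θ := by unfold cayleyDenom; fun_prop
  refine DRCoord.mkL.contDiff.contDiffAt.comp θ (ContDiffAt.prodMk ?_ (ContDiffAt.prodMk ?_ ?_))
  · exact ((ContDiffAt.div (by fun_prop) d hχ).smul contDiffAt_const).add
      ((ContDiffAt.div (by fun_prop) d hχ).smul contDiffAt_const)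
  · exact (ContDiffAt.div (by fun_prop) d hχ).smul contDiffAt_const
  · exact (ContDiffAt.div (by fun_prop) d hχ).log (div_ne_zero h1 hχ)


theorem hasDerivAt_arsinh_sqrt {s : ℝ} (hs : 0 < s) :
    HasDerivAt (fun s => 2 * Real.arsinh (Real.sqrt s)) (1 / Real.sqrt (s * (s + 1))) s := by
  have h := ((Real.hasDerivAt_sqrt hs.ne').arsinh).const_mul 2
  refine h.congr_deriv ?_
  rw [Real.sq_sqrt hs.le, Real.sqrt_mul hs.le, add_comm 1 s, smul_eq_mul]
  have := (Real.sqrt_pos.2 hs).ne'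
  have := (Real.sqrt_pos.2 (add_pos hs one_pos)).ne'
  field_simp

/-- The function 2 arsinh √u need not be differentiable where u = 0, so u is replaced by u + ε. The
gradient stays bounded by 1 because u(u + 1) ≤ (u + ε)(u + ε + 1), and then ε tends to 0. -/
theorem ofReal_arsinh_le_edist (x : DamekRicci S) :
    ENNReal.ofReal (2 * Real.arsinh (Real.sqrt x.coord.sinhSq)) ≤ edist x 1 := by
  have key : ∀ ε : ℝ, 0 < ε → ENNReal.ofReal (2 * Real.arsinh (Real.sqrt (x.coord.sinhSq + ε)) -
      2 * Real.arsinh (Real.sqrt ε)) ≤ edist x 1 := by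
    intro ε hε
    have hpos : ∀ y : DRCoord p q, 0 < y.sinhSq + ε := fun y => by
      have := y.sinhSq_nonneg; linarith
    have hu : ContDiff ℝ 1 (fun y : DRCoord p q => y.sinhSq + ε) :=
      DRCoord.contDiff_sinhSq.add contDiff_const
    have h := ofReal_sub_le_edist (S := S)
      (f := fun y : DRCoord p q => 2 * Real.arsinh (Real.sqrt (y.sinhSq + ε)))
      (contDiff_const.mul (hu.sqrt fun y => (hpos y).ne').arsinh) ?_ x 1
    · have h1 : (1 : DamekRicci S).coord = 0 := rfl
      simpa [h1] using h
    · intro y ξ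
      have hd := (hasDerivAt_arsinh_sqrt (hpos y)).comp_hasFDerivAt y
        ((DRCoord.hasFDerivAt_sinhSq y).add_const ε)
      have hd' : HasFDerivAt (fun y : DRCoord p q => 2 * Real.arsinh (Real.sqrt (y.sinhSq + ε)))
        _ y := hd
      rw [hd'.fderiv]
      simp only [smul_apply, innerSL_apply_apply, smul_eq_mul, abs_mul]
      have h2 := abs_inner_sinhSqGradient_le (S := S) y ξ
      have h0 := y.sinhSq_nonneg
      have hs : 0 < Real.sqrt ((y.sinhSq + ε) * (y.sinhSq + ε + 1)) :=
        Real.sqrt_pos.2 (mul_pos (hpos y) (by linarith))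
      rw [abs_of_pos (by positivity), one_div, inv_mul_le_iff₀ hs]
      refine h2.trans (mul_le_mul_of_nonneg_right (Real.sqrt_le_sqrt ?_) (norm_nonneg _))
      nlinarith
  have hc : Filter.Tendsto (fun ε => ENNReal.ofReal
      (2 * Real.arsinh (Real.sqrt (x.coord.sinhSq + ε)) - 2 * Real.arsinh (Real.sqrt ε)))
      (nhdsWithin 0 (Set.Ioi 0))
      (nhds (ENNReal.ofReal (2 * Real.arsinh (Real.sqrt (x.coord.sinhSq + 0)) -
        2 * Real.arsinh (Real.sqrt 0)))) := by
    refine Filter.Tendsto.mono_left (Continuous.tendsto ?_ 0) nhdsWithin_le_nhds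
    have h1 : Continuous fun ε : ℝ => Real.arsinh (Real.sqrt (x.coord.sinhSq + ε)) :=
      Real.continuous_arsinh.comp (by fun_prop)
    have h2 : Continuous fun ε : ℝ => Real.arsinh (Real.sqrt ε) :=
      Real.continuous_arsinh.comp (by fun_prop)
    exact ENNReal.continuous_ofReal.comp ((h1.const_mul 2).sub (h2.const_mul 2))
  have := le_of_tendsto hc (Filter.eventually_of_mem self_mem_nhdsWithin key)
  simpa using this

/-- For θ = tanh(s/2) one has dθ/ds = (1 − θ²)/2, which cancels the speed 2/(1 − θ²). The curve thus
has unit speed and length r. -/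
theorem edist_cayley_le {η : DRCoord p q} (hη : ‖η‖ = 1) {r : ℝ} (hr : 0 ≤ r) :
    edist (ofCoord S (cayley S η (Real.tanh (r / 2)))) 1 ≤ ENNReal.ofReal r := by
  have hn := DRCoord.norm_sq_eq η
  rw [hη] at hn
  have hη' : η.t ^ 2 ≤ 1 := by nlinarith [sq_nonneg ‖η.v‖, sq_nonneg ‖η.z‖]
  have hθ : ∀ s : ℝ, 1 - Real.tanh (s / 2) ^ 2 = 1 / Real.cosh (s / 2) ^ 2 := fun s => by
    have := (Real.cosh_pos (s / 2)).ne'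
    rw [Real.tanh_eq_sinh_div_cosh]
    field_simp
    rw [Real.cosh_sq]
    ring
  have hθ1 : ∀ s : ℝ, Real.tanh (s / 2) ^ 2 < 1 := fun s => by
    have h1 : 0 < 1 / Real.cosh (s / 2) ^ 2 := by
      have := Real.cosh_pos (s / 2)
      positivity
    linarith [hθ s]
  have ht : ∀ s : ℝ, HasDerivAt (fun s => Real.tanh (s / 2))
      ((1 - Real.tanh (s / 2) ^ 2) / 2) s := fun s => by
    have h1 := ((hasDerivAt_id s).div_const 2).sinh.fun_div ((hasDerivAt_id s).div_const 2).cosh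
      (Real.cosh_pos _).ne'
    have h2 : (fun s => Real.tanh (s / 2)) = fun x => Real.sinh (id x / 2) / Real.cosh (id x / 2) :=
      funext fun s => Real.tanh_eq_sinh_div_cosh _
    rw [h2]
    refine h1.congr_deriv ?_
    rw [hθ]
    simp only [id]
    have := (Real.cosh_pos (s / 2)).ne'
    have h3 := Real.cosh_sq (s / 2)
    field_simp
    linear_combination h3
  set γ : ℝ → DRCoord p q := fun s => cayley S η (Real.tanh (s / 2)) with hγ
  have hγd : ∀ s, HasDerivAt γ (((1 - Real.tanh (s / 2) ^ 2) / 2) •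
      cayleyDeriv S η (Real.tanh (s / 2))) s := fun s =>
    HasDerivAt.scomp (g₁ := cayley S η) (h := fun s => Real.tanh (s / 2)) s
      (hasDerivAt_cayley hη' (hθ1 s)) (ht s)
  have htc : ContDiff ℝ 1 (fun s => Real.tanh (s / 2)) := by
    have h2 : (fun s => Real.tanh (s / 2)) = fun x => Real.sinh (x / 2) / Real.cosh (x / 2) :=
      funext fun s => Real.tanh_eq_sinh_div_cosh _
    rw [h2]
    exact ContDiff.div (by fun_prop) (by fun_prop) fun x => (Real.cosh_pos _).ne'
  have hγc : ContDiff ℝ 1 γ := contDiff_iff_contDiffAt.2 fun s =>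
    ContDiffAt.comp (g := cayley S η) (f := fun s => Real.tanh (s / 2)) s
      (contDiffAt_cayley hη' (hθ1 s)) htc.contDiffAt
  let γ' : ℝ → DamekRicci S := fun s => ofCoord S (γ s)
  have hlen : Manifold.pathELength 𝓘(ℝ, DRCoord p q) γ' 0 r = ENNReal.ofReal r := by
    rw [Manifold.pathELength_eq_lintegral_mfderiv_Icc]
    have : ∀ s, ‖mfderiv 𝓘(ℝ, ℝ) 𝓘(ℝ, DRCoord p q) γ' s 1‖ₑ = 1 := fun s => by
      rw [enorm_tangent, mfderiv_path]
      have e : fderiv ℝ (fun s => (γ' s).coord) s 1 = ((1 - Real.tanh (s / 2) ^ 2) / 2) •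
          cayleyDeriv S η (Real.tanh (s / 2)) := by
        rw [fderiv_apply_one_eq_deriv]
        exact (hγd s).deriv
      erw [e]
      rw [← ofReal_norm, map_smul, norm_smul]
      erw [norm_frame_symm_cayleyDeriv hη (hθ1 s)]
      have : 0 < 1 - Real.tanh (s / 2) ^ 2 := by linarith [hθ1 s]
      rw [Real.norm_of_nonneg (by positivity)]
      rw [show (1 - Real.tanh (s / 2) ^ 2) / 2 * (2 / (1 - Real.tanh (s / 2) ^ 2)) = 1 by
        field_simp]
      simp
    simp only [this]
    simp
  have h0 : γ' 0 = 1 := by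
    have : γ 0 = 0 := by
      simp only [hγ, zero_div, Real.tanh_zero, cayley, cayleyDenom]
      ext1 <;> simp <;> rfl
    exact this
  rw [edist_comm, IsRiemannianManifold.out (I := 𝓘(ℝ, DRCoord p q)), ← hlen]
  exact Manifold.riemannianEDist_le_pathELength
    ((contMDiff_iff_contDiff (f := γ).2 hγc).contMDiffOn) h0 rfl hr

theorem exists_cayley_eq {x : DRCoord p q} (hx : x.sinhSq ≠ 0) :
    ∃ η : DRCoord p q, ‖η‖ = 1 ∧
      cayley S η (Real.sqrt x.sinhSq / Real.sqrt (1 + x.sinhSq)) = x := by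
  have hu : 0 < x.sinhSq := lt_of_le_of_ne x.sinhSq_nonneg hx.symm
  set θ := Real.sqrt x.sinhSq / Real.sqrt (1 + x.sinhSq) with hθ
  have hθ0 : θ ≠ 0 := div_ne_zero (Real.sqrt_pos.2 hu).ne' (Real.sqrt_pos.2 (by linarith)).ne'
  have hθ2 : θ ^ 2 = x.sinhSq / (1 + x.sinhSq) := by
    rw [hθ, div_pow, Real.sq_sqrt hu.le, Real.sq_sqrt (by linarith)]
  have ha := Real.exp_pos x.t
  have hR := x.sinhSq_add_one
  set R := x.height ^ 2 + ‖x.z‖ ^ 2 with hRdef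
  have hRpos : 0 < R := by rw [← hR]; positivity
  have hR0 := hRpos.ne'
  have hu1 : x.sinhSq + 1 = R / (4 * Real.exp x.t) := by field_simp; linarith
  have hθR : θ ^ 2 = 1 - 4 * Real.exp x.t / R := by
    rw [hθ2, add_comm 1, hu1, show x.sinhSq = R / (4 * Real.exp x.t) - 1 by linarith]
    field_simp
  have hv : ‖x.v‖ ^ 2 = 4 * (x.height - 1 - Real.exp x.t) := by rw [DRCoord.height]; ring
  have hz : ‖x.z‖ ^ 2 = R - x.height ^ 2 := by rw [hRdef]; ring
  -- The inverse Cayley transform: θη = R⁻¹(Hv − J_z v, 2z, R − 2H). It makes the denominator equal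
  -- to 4/R, and its norm is θ since θ² = 1 − 4e^t/R = u/(u + 1).
  set η : DRCoord p q := θ⁻¹ • DRCoord.mk (R⁻¹ • (x.height • x.v - S.J x.z x.v)) ((2 / R) • x.z)
    (1 - 2 * x.height / R) with hη
  have hηv : η.v = (θ⁻¹ * R⁻¹) • (x.height • x.v - S.J x.z x.v) := by simp [hη, smul_smul]
  have hηz : η.z = (θ⁻¹ * (2 / R)) • x.z := by simp [hη, smul_smul]
  have hηt : η.t = θ⁻¹ * (1 - 2 * x.height / R) := by simp [hη]
  have hden : cayleyDenom ‖η.z‖ η.t θ = 4 / R := by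
    rw [cayleyDenom, hηz, hηt, norm_smul, mul_pow, Real.norm_eq_abs, sq_abs, hz]
    field_simp
    ring
  refine ⟨η, ?_, ?_⟩
  · have : ‖η‖ ^ 2 = 1 := by
      rw [DRCoord.norm_sq_eq, hηv, hηz, hηt]
      simp only [norm_smul, mul_pow, norm_sub_sq_real, Real.norm_eq_abs, sq_abs, inner_smul_left,
        S.inner_self_J, S.norm_J_sq, hv, hz]
      field_simp
      rw [hθR]
      field_simp
      ring
    nlinarith [norm_nonneg η]
  · ext1
    · simp only [cayley, DRCoord.v_mk]
      rw [hden, hηv, hηz, hηt]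
      simp only [map_smul, map_sub, LinearMap.smul_apply, S.J_sq, smul_sub, smul_smul]
      rw [hz]
      have hRe : R ≠ 0 := hR0
      match_scalars
      · field_simp
        ring
      · field_simp
        ring
    · simp only [cayley, DRCoord.z_mk]
      rw [hden, hηz, smul_smul, show 2 * θ / (4 / R) * (θ⁻¹ * (2 / R)) = 1 by field_simp; norm_num,
        one_smul]
    · simp only [cayley, DRCoord.t_mk]
      rw [hden, hθR, show (1 - (1 - 4 * Real.exp x.t / R)) / (4 / R) = Real.exp x.t by
        field_simp; ring, Real.log_exp]

/-- The distance to the identity in a Damek-Ricci space. -/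
theorem edist_one (x : DamekRicci S) :
    edist x 1 = ENNReal.ofReal (2 * Real.arsinh (Real.sqrt x.coord.sinhSq)) := by
  refine le_antisymm ?_ (ofReal_arsinh_le_edist x)
  by_cases hx : x.coord.sinhSq = 0
  · have : x = 1 := DRCoord.eq_zero_of_sinhSq_eq_zero hx
    rw [this, edist_self]
    exact zero_le
  · obtain ⟨η, hη, h⟩ := exists_cayley_eq (S := S) hx
    have h1 := edist_cayley_le (S := S) hη (r := 2 * Real.arsinh (Real.sqrt x.coord.sinhSq))
      (by have := Real.arsinh_nonneg_iff.2 (Real.sqrt_nonneg x.coord.sinhSq); linarith)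
    rw [mul_div_cancel_left₀ _ two_ne_zero, Real.tanh_arsinh,
      Real.sq_sqrt x.coord.sinhSq_nonneg, h] at h1
    exact h1

end DamekRicci

end

noncomputable section

/-! ### The Laplacian of a radial function -/

theorem HTypeAlgebra.trace_J {p q : ℕ} (S : HTypeAlgebra p q) (z : EuclideanSpace ℝ (Fin q)) :
    LinearMap.trace ℝ (EuclideanSpace ℝ (Fin p)) (S.J z) = 0 := by
  rw [LinearMap.trace_eq_sum_inner _ (EuclideanSpace.basisFun (Fin p) ℝ)]
  exact Finset.sum_eq_zero fun i _ => S.inner_self_J _ _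

namespace DRCoord

variable {p q : ℕ}

/-- The coordinates as a linear equivalence with the product. -/
def prodEquiv (p q : ℕ) :
    DRCoord p q ≃ₗ[ℝ] EuclideanSpace ℝ (Fin p) × EuclideanSpace ℝ (Fin q) × ℝ where
  toFun x := (x.v, x.z, x.t)
  invFun y := mk y.1 y.2.1 y.2.2
  map_add' _ _ := rfl
  map_smul' _ _ := rfl

@[simp] theorem prodEquiv_apply (x : DRCoord p q) : prodEquiv p q x = (x.v, x.z, x.t) := rfl
@[simp] theorem prodEquiv_symm_apply
    (y : EuclideanSpace ℝ (Fin p) × EuclideanSpace ℝ (Fin q) × ℝ) :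
    (prodEquiv p q).symm y = mk y.1 y.2.1 y.2.2 := rfl

/-- The map is a sum of three maps factoring through the summands; cyclicity of the trace reduces
each one to its diagonal block. -/
theorem trace_mkL_comp (A : DRCoord p q →L[ℝ] EuclideanSpace ℝ (Fin p))
    (B : DRCoord p q →L[ℝ] EuclideanSpace ℝ (Fin q)) (C : DRCoord p q →L[ℝ] ℝ) :
    LinearMap.trace ℝ (DRCoord p q) (mkL ∘L (A.prod (B.prod C)) : DRCoord p q →L[ℝ] DRCoord p q) =
      LinearMap.trace ℝ _ ((A : DRCoord p q →ₗ[ℝ] _) ∘ₗ (prodEquiv p q).symm.toLinearMap ∘ₗ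
        LinearMap.inl ℝ _ _) +
      LinearMap.trace ℝ _ ((B : DRCoord p q →ₗ[ℝ] _) ∘ₗ (prodEquiv p q).symm.toLinearMap ∘ₗ
        LinearMap.inr ℝ _ _ ∘ₗ LinearMap.inl ℝ _ _) + C (mk 0 0 1) := by
  have e : ((mkL ∘L (A.prod (B.prod C)) : DRCoord p q →L[ℝ] DRCoord p q) :
      DRCoord p q →ₗ[ℝ] DRCoord p q) =
      ((prodEquiv p q).symm.toLinearMap ∘ₗ LinearMap.inl ℝ _ _) ∘ₗ (A : DRCoord p q →ₗ[ℝ] _) +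
      ((prodEquiv p q).symm.toLinearMap ∘ₗ LinearMap.inr ℝ _ _ ∘ₗ LinearMap.inl ℝ _ _) ∘ₗ
        (B : DRCoord p q →ₗ[ℝ] _) +
      (C : DRCoord p q →ₗ[ℝ] ℝ).smulRight (mk 0 0 1) := by
    ext ξ : 1
    ext1
    · simp
    · simp
    · simp
  have h1 := LinearMap.trace_comp_comm' ((prodEquiv p q).symm.toLinearMap ∘ₗ
    LinearMap.inl ℝ _ _) (A : DRCoord p q →ₗ[ℝ] _)
  have h2 := LinearMap.trace_comp_comm' ((prodEquiv p q).symm.toLinearMap ∘ₗ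
    LinearMap.inr ℝ _ _ ∘ₗ LinearMap.inl ℝ _ _) (B : DRCoord p q →ₗ[ℝ] _)
  rw [e, map_add, map_add, h1, h2, LinearMap.trace_smulRight]
  rfl

end DRCoord

namespace DamekRicci

variable {p q : ℕ} {S : HTypeAlgebra p q}

/-- The shear `(v, z, t) ↦ (v, z + B v, t)`. -/
def shear (B : EuclideanSpace ℝ (Fin p) →ₗ[ℝ] EuclideanSpace ℝ (Fin q)) :
    DRCoord p q →ₗ[ℝ] DRCoord p q where
  toFun ξ := DRCoord.mk ξ.v (ξ.z + B ξ.v) ξ.t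
  map_add' ξ η := by ext1 <;> simp; abel
  map_smul' c ξ := by ext1 <;> simp

theorem shear_comp (B C : EuclideanSpace ℝ (Fin p) →ₗ[ℝ] EuclideanSpace ℝ (Fin q)) :
    (shear B) ∘ₗ (shear C) = shear (C + B) := by
  ext ξ : 1
  ext1
  · rfl
  · change ξ.z + C ξ.v + B ξ.v = ξ.z + (C ξ.v + B ξ.v)
    rw [add_assoc]
  · rfl

/-- Doubling the 𝔳-coordinate conjugates the shear by 2B to the shear by B. As the former is the
square of the latter, its determinant d satisfies d = d², and d ≠ 0 by invertibility. -/
theorem det_shear (B : EuclideanSpace ℝ (Fin p) →ₗ[ℝ] EuclideanSpace ℝ (Fin q)) :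
    LinearMap.det (shear B) = 1 := by
  have h0 : LinearMap.det (shear B) ≠ 0 := by
    have h : shear B ∘ₗ shear (-B) = LinearMap.id := by
      rw [shear_comp, neg_add_cancel]
      ext ξ : 1
      ext1 <;> simp [shear]
    have := congrArg LinearMap.det h
    rw [LinearMap.det_comp, LinearMap.det_id] at this
    exact left_ne_zero_of_mul_eq_one this
  let e : DRCoord p q ≃ₗ[ℝ] DRCoord p q :=
    { toFun := fun ξ => DRCoord.mk ((2 : ℝ) • ξ.v) ξ.z ξ.t
      invFun := fun ξ => DRCoord.mk ((1 / 2 : ℝ) • ξ.v) ξ.z ξ.t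
      map_add' := fun ξ η => by ext1 <;> simp
      map_smul' := fun c ξ => by ext1 <;> simp [smul_smul, mul_comm]
      left_inv := fun ξ => by ext1 <;> simp [smul_smul]
      right_inv := fun ξ => by ext1 <;> simp [smul_smul] }
  have h1 : (e : DRCoord p q →ₗ[ℝ] DRCoord p q) ∘ₗ shear (B + B) ∘ₗ
      (e.symm : DRCoord p q →ₗ[ℝ] DRCoord p q) = shear B := by
    ext ξ : 1
    change DRCoord.mk ((2 : ℝ) • (1 / 2 : ℝ) • ξ.v)
      (ξ.z + (B ((1 / 2 : ℝ) • ξ.v) + B ((1 / 2 : ℝ) • ξ.v))) ξ.t = DRCoord.mk ξ.v (ξ.z + B ξ.v) ξ.t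
    rw [← map_add, ← add_smul, smul_smul]
    norm_num
  have h2 := LinearMap.det_conj (shear (B + B)) e
  rw [h1, ← shear_comp, LinearMap.det_comp] at h2
  exact (mul_eq_left₀ h0).1 h2.symm

theorem volDensity_eq (x : DamekRicci S) :
    volDensity x = Real.exp (-((p : ℝ) / 2 + q) * x.t) := by
  have h : ((frame x).symm : DRCoord p q →ₗ[ℝ] DRCoord p q) =
      ((DRCoord.prodEquiv p q).symm.toLinearMap ∘ₗ
        (LinearMap.prodMap (Real.exp (-x.t / 2) • LinearMap.id)
          (LinearMap.prodMap (Real.exp (-x.t) • LinearMap.id) LinearMap.id)) ∘ₗ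
        (DRCoord.prodEquiv p q).symm.symm.toLinearMap) ∘ₗ shear (-((1 / 2 : ℝ) • S.bracket x.v)) := by
    ext ξ : 1
    change (frame x).symm ξ = _
    rw [frame_symm_apply]
    ext1
    · simp [shear]
    · simp [shear, sub_eq_add_neg]
    · simp [shear]
  rw [volDensity, h, LinearMap.det_comp, det_shear, LinearMap.det_conj, LinearMap.det_prodMap,
    LinearMap.det_prodMap, LinearMap.det_smul, LinearMap.det_smul]
  simp only [LinearMap.det_id, mul_one, finrank_euclideanSpace_fin, ← Real.exp_nat_mul,
    ← Real.exp_add]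
  rw [abs_of_pos (Real.exp_pos _)]
  congr 1
  ring

theorem hasFDerivAt_volDensity (x : DRCoord p q) :
    HasFDerivAt (fun y => volDensity (ofCoord S y))
      ((-((p : ℝ) / 2 + q) * volDensity (ofCoord S x)) • (DRCoord.tL : DRCoord p q →L[ℝ] ℝ)) x := by
  have h : (fun y => volDensity (ofCoord S y)) =
      fun y : DRCoord p q => Real.exp (-((p : ℝ) / 2 + q) * y.t) :=
    funext fun y => volDensity_eq (ofCoord S y)
  rw [h]
  refine (((DRCoord.hasFDerivAt_t x).const_mul _).exp).congr_fderiv ?_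
  ext ξ
  simp [volDensity_eq]
  rw [show (ofCoord S x).t = x.t from rfl]
  ring

/-- The trace is the divergence with respect to Lebesgue measure. J_z contributes nothing, being
skew, and |v|² is eliminated through H. -/
theorem hasFDerivAt_sinhSqGrad (x : DRCoord p q) :
    ∃ L : DRCoord p q →L[ℝ] DRCoord p q, HasFDerivAt (sinhSqGrad S) L x ∧
      LinearMap.trace ℝ (DRCoord p q) L = ((p : ℝ) / 4 - 1 / 2) * x.height +
        (1 + (q : ℝ)) / 2 * (x.height - 1) + (x.sinhSq + 1) := by
  let J1 : EuclideanSpace ℝ (Fin q) →L[ℝ] EuclideanSpace ℝ (Fin p) →L[ℝ] EuclideanSpace ℝ (Fin p) :=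
    LinearMap.toContinuousLinearMap (LinearMap.toContinuousLinearMap.toLinearMap ∘ₗ S.J)
  have hJ : ∀ z v, J1 z v = S.J z v := fun _ _ => rfl
  have hv := (((DRCoord.hasFDerivAt_height x).fun_smul (DRCoord.hasFDerivAt_v x)).fun_add
    (J1.hasFDerivAt_of_bilinear (DRCoord.hasFDerivAt_z x) (DRCoord.hasFDerivAt_v x))).fun_const_smul
      (1 / 4 : ℝ)
  have hz := (((DRCoord.hasFDerivAt_t x).exp.mul_const (1 / 2)).fun_add
    ((DRCoord.hasFDerivAt_v x).norm_sq.mul_const (1 / 8))).fun_smul (DRCoord.hasFDerivAt_z x)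
  have ht := ((DRCoord.hasFDerivAt_height x).mul_const (1 / 2)).fun_sub
    ((DRCoord.hasFDerivAt_sinhSq x).add_const 1)
  refine ⟨_, (DRCoord.hasFDerivAt_mk hv hz ht).congr_of_eventuallyEq
    (Filter.Eventually.of_forall fun y => ?_), ?_⟩
  · simp only [sinhSqGrad, hJ, mul_one_div]
  · rw [DRCoord.trace_mkL_comp]
    have hA : LinearMap.trace ℝ (EuclideanSpace ℝ (Fin p)) ((1 / 4 : ℝ) •
        (x.height • LinearMap.id + S.J x.z +
          ((1 / 2 : ℝ) • (innerSL ℝ x.v : EuclideanSpace ℝ (Fin p) →ₗ[ℝ] ℝ)).smulRight x.v)) =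
        1 / 4 * (x.height * p + ‖x.v‖ ^ 2 / 2) := by
      simp only [map_smul, map_add, S.trace_J, LinearMap.trace_id, LinearMap.trace_smulRight,
        finrank_euclideanSpace_fin, smul_eq_mul, add_zero]
      simp
      ring
    have hB : LinearMap.trace ℝ (EuclideanSpace ℝ (Fin q))
        ((Real.exp x.t / 2 + ‖x.v‖ ^ 2 / 8) • LinearMap.id) =
        (Real.exp x.t / 2 + ‖x.v‖ ^ 2 / 8) * q := by
      simp
    refine (congrArg₂ (· + ·) (congrArg₂ (· + ·) ((congrArg _ ?_).trans hA)
      ((congrArg _ ?_).trans hB))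
      (show _ = Real.exp x.t / 2 - (x.height / 2 - (x.sinhSq + 1)) from ?_)).trans ?_
    · ext1 ξ
      simp [hJ]
      module
    · ext1 ξ
      simp
      module
    · simp [DRCoord.inner_eq, DRCoord.sinhSqGradient]
      ring
    · have : ‖x.v‖ ^ 2 = 4 * (x.height - 1 - Real.exp x.t) := by rw [DRCoord.height]; ring
      rw [this]
      ring

/-- The Laplacian of a real function of `sinhSq`. -/
theorem divergence_grad_of_eventuallyEq {f : DamekRicci S → ℝ} {g g' : ℝ → ℝ} {g'' : ℝ}
    {x : DRCoord p q} (hf : ∀ᶠ y in nhds x, f (ofCoord S y) = g y.sinhSq)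
    (hg : ∀ᶠ s in nhds x.sinhSq, HasDerivAt g (g' s) s) (hg' : HasDerivAt g' g'' x.sinhSq) :
    divergence (grad f) (ofCoord S x) = g'' * (x.sinhSq * (x.sinhSq + 1)) +
      g' x.sinhSq * (((p : ℝ) + q + 1) / 2 + ((p : ℝ) / 2 + q + 1) * x.sinhSq) := by
  have hcont : Continuous (DRCoord.sinhSq : DRCoord p q → ℝ) :=
    (DRCoord.contDiff_sinhSq (n := 0)).continuous
  have hgrad : ∀ᶠ y in nhds x, grad f (ofCoord S y) = g' y.sinhSq • sinhSqGrad S y := by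
    filter_upwards [hf.eventually_nhds, hcont.continuousAt.eventually hg] with y hy hgy
    have h1 : HasFDerivAt (fun y : DRCoord p q => f (ofCoord S y))
        (innerSL ℝ (g' y.sinhSq • y.sinhSqGradient)) y := by
      refine ((hgy.comp_hasFDerivAt y (DRCoord.hasFDerivAt_sinhSq y)).congr_of_eventuallyEq
        hy).congr_fderiv ?_
      ext ξ
      simp
    have h2 : gradient (fun y : DRCoord p q => f (ofCoord S y)) (ofCoord S y).coord =
        g' y.sinhSq • y.sinhSqGradient := by
      refine HasGradientAt.gradient ?_
      rw [hasGradientAt_iff_hasFDerivAt]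
      exact h1
    rw [grad, h2, map_smul, adjoint_frame_sinhSqGradient, map_smul, frame_sinhSqFrameGradient]
  obtain ⟨L, hL, htr⟩ := hasFDerivAt_sinhSqGrad (S := S) x
  have hψ := (hasFDerivAt_volDensity (S := S) x).fun_mul
    (hg'.comp_hasFDerivAt x (DRCoord.hasFDerivAt_sinhSq x))
  have hW := (hψ.fun_smul hL).congr_of_eventuallyEq (f₁ := fun y : DRCoord p q =>
    volDensity (ofCoord S y) • grad f (ofCoord S y)) (by
      filter_upwards [hgrad] with y hy
      rw [hy, smul_smul]
      rfl)
  rw [divergence]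
  erw [hW.fderiv]
  have hpos : volDensity (ofCoord S x) ≠ 0 := by
    rw [volDensity_eq]
    exact (Real.exp_pos _).ne'
  have htrace : ∀ (c : ℝ) (ℓ : DRCoord p q →L[ℝ] ℝ) (w : DRCoord p q),
      LinearMap.trace ℝ (DRCoord p q) ((c • L + ℓ.smulRight w : DRCoord p q →L[ℝ] DRCoord p q) :
        DRCoord p q →ₗ[ℝ] DRCoord p q) = c * LinearMap.trace ℝ (DRCoord p q) L + ℓ w := by
    intro c ℓ w
    rw [ContinuousLinearMap.toLinearMap_add, ContinuousLinearMap.toLinearMap_smul, map_add, map_smul]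
    congr 1
    exact LinearMap.trace_smulRight _ _
  rw [htrace, htr]
  simp only [Function.comp_apply, add_apply, smul_apply,
    smul_eq_mul, innerSL_apply_apply, inner_sinhSqGradient_sinhSqGrad, DRCoord.tL_apply]
  -- The logarithmic derivative −(p/2 + q) of the density, times the ℝ-component H/2 − (u + 1) of
  -- grad u, cancels every term of the trace that contains H. A polynomial in u remains.
  simp only [sinhSqGrad, DRCoord.t_mk]
  field_simp
  ring

/-- The Laplacian of a complex valued function of `sinhSq`. -/
theorem laplacian_of_eventuallyEq {f : DamekRicci S → ℂ} {g g' : ℝ → ℂ} {g'' : ℂ}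
    {x : DRCoord p q} (hf : ∀ᶠ y in nhds x, f (ofCoord S y) = g y.sinhSq)
    (hg : ∀ᶠ s in nhds x.sinhSq, HasDerivAt g (g' s) s) (hg' : HasDerivAt g' g'' x.sinhSq) :
    laplacian f (ofCoord S x) = g'' * (x.sinhSq * (x.sinhSq + 1)) +
      g' x.sinhSq * (((p : ℂ) + q + 1) / 2 + ((p : ℂ) / 2 + q + 1) * x.sinhSq) := by
  have hre := divergence_grad_of_eventuallyEq (S := S) (f := fun y => (f y).re)
    (g := fun s => (g s).re) (g' := fun s => (g' s).re) (g'' := g''.re)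
    (hf.mono fun y hy => by rw [hy])
    (hg.mono fun s hs => Complex.reCLM.hasFDerivAt.comp_hasDerivAt s hs)
    (Complex.reCLM.hasFDerivAt.comp_hasDerivAt _ hg')
  have him := divergence_grad_of_eventuallyEq (S := S) (f := fun y => (f y).im)
    (g := fun s => (g s).im) (g' := fun s => (g' s).im) (g'' := g''.im)
    (hf.mono fun y hy => by rw [hy])
    (hg.mono fun s hs => Complex.imCLM.hasFDerivAt.comp_hasDerivAt s hs)
    (Complex.imCLM.hasFDerivAt.comp_hasDerivAt _ hg')
  rw [laplacian, hre, him]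
  conv_rhs => rw [← Complex.re_add_im g'', ← Complex.re_add_im (g' x.sinhSq)]
  push_cast
  ring

end DamekRicci

end

noncomputable section

/-! ### Existence and uniqueness of the spherical functions -/

/-- The weighted energy e^{−Kt}(|D|² + |D'|²) with K = 1 + |c| is nonincreasing and starts at 0.
Only the sign of `m` is used, so a singularity of `m` at t = 0 is harmless. -/
theorem eq_zero_of_damped_ode {D : ℝ → ℂ} (hD : ContDiff ℝ 2 D) (h0 : D 0 = 0)
    (h0' : deriv D 0 = 0) (m : ℝ → ℝ) (hm : ∀ t, 0 < t → 0 ≤ m t) (c : ℂ)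
    (hode : ∀ t, 0 < t → deriv (deriv D) t = -(m t * deriv D t) - c * D t) {t : ℝ} (ht : 0 ≤ t) :
    D t = 0 := by
  have hd1 : ∀ t, HasDerivAt D (deriv D t) t := fun t =>
    (hD.differentiable two_ne_zero t).hasDerivAt
  have hD' : ContDiff ℝ 1 (deriv D) := (contDiff_succ_iff_deriv (n := 1).1 hD).2.2
  have hd2 : ∀ t, HasDerivAt (deriv D) (deriv (deriv D) t) t := fun t =>
    (hD'.differentiable one_ne_zero t).hasDerivAt
  set K : ℝ := 1 + ‖c‖ with hK
  set E : ℝ → ℝ := fun t => Real.exp (-K * t) * (‖D t‖ ^ 2 + ‖deriv D t‖ ^ 2) with hE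
  have hEd : ∀ t, HasDerivAt E (Real.exp (-K * t) * (-K) * (‖D t‖ ^ 2 + ‖deriv D t‖ ^ 2) +
      Real.exp (-K * t) * (2 * inner ℝ (D t) (deriv D t) +
        2 * inner ℝ (deriv D t) (deriv (deriv D) t))) t := fun t =>
    (((hasDerivAt_id t).const_mul (-K)).exp.congr_deriv (by simp)).fun_mul
      ((hd1 t).norm_sq.fun_add (hd2 t).norm_sq)
  have hanti : AntitoneOn E (Set.Ici 0) := by
    refine antitoneOn_of_deriv_nonpos (convex_Ici 0)
      (fun t _ => (hEd t).continuousAt.continuousWithinAt)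
      (fun t _ => (hEd t).differentiableAt.differentiableWithinAt) fun t ht => ?_
    rw [interior_Ici] at ht
    rw [(hEd t).deriv, hode t ht]
    have e1 : inner ℝ (D t) (deriv D t) ≤ ‖D t‖ * ‖deriv D t‖ := real_inner_le_norm _ _
    have e2 : inner ℝ (deriv D t) (-(m t * deriv D t) - c * D t) ≤
        ‖c‖ * (‖D t‖ * ‖deriv D t‖) := by
      rw [inner_sub_right, inner_neg_right]
      have e3 : inner ℝ (deriv D t) ((m t : ℂ) * deriv D t) = m t * ‖deriv D t‖ ^ 2 := by
        rw [← Complex.real_smul, inner_smul_right, real_inner_self_eq_norm_sq]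
      have e4 := neg_le_of_abs_le (abs_real_inner_le_norm (deriv D t) (c * D t))
      rw [norm_mul] at e4
      have := mul_nonneg (hm t ht) (sq_nonneg ‖deriv D t‖)
      rw [e3]
      nlinarith
    have e5 : ‖D t‖ * ‖deriv D t‖ ≤ (‖D t‖ ^ 2 + ‖deriv D t‖ ^ 2) / 2 := by
      nlinarith [sq_nonneg (‖D t‖ - ‖deriv D t‖)]
    have e6 : 2 * inner ℝ (D t) (deriv D t) + 2 * inner ℝ (deriv D t)
        (-(m t * deriv D t) - c * D t) ≤ K * (‖D t‖ ^ 2 + ‖deriv D t‖ ^ 2) := by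
      have := mul_le_mul_of_nonneg_left e5 (norm_nonneg c)
      rw [hK]
      nlinarith
    have := mul_le_mul_of_nonneg_left e6 (Real.exp_pos (-K * t)).le
    linarith
  have h := hanti Set.self_mem_Ici ht ht
  simp only [hE, h0, h0', norm_zero] at h
  have h1 : ‖D t‖ ^ 2 + ‖deriv D t‖ ^ 2 ≤ 0 := by
    by_contra hcon
    push Not at hcon
    have := mul_pos (Real.exp_pos (-K * t)) hcon
    refine absurd h (not_le.2 ?_)
    simpa using this
  have : ‖D t‖ ^ 2 = 0 := by nlinarith [sq_nonneg ‖D t‖, sq_nonneg ‖deriv D t‖]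
  simpa using this

namespace DamekRicci

variable {p q : ℕ} {S : HTypeAlgebra p q}

theorem edist_one_eq_iff (x y : DamekRicci S) :
    edist x 1 = edist y 1 ↔ x.coord.sinhSq = y.coord.sinhSq := by
  have h0 : ∀ x : DRCoord p q, 0 ≤ Real.arsinh (Real.sqrt x.sinhSq) := fun x =>
    Real.arsinh_nonneg_iff.2 (Real.sqrt_nonneg _)
  rw [edist_one, edist_one, ENNReal.ofReal_eq_ofReal_iff (by have := h0 x.coord; linarith)
    (by have := h0 y.coord; linarith), mul_right_inj' two_ne_zero, Real.arsinh_inj,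
    Real.sqrt_inj x.coord.sinhSq_nonneg y.coord.sinhSq_nonneg]

/-- The hypergeometric function of the spherical function. -/
def sphericalProfile (p q : ℕ) (lam : ℂ) : ℂ → ℂ :=
  gaussF (((p : ℂ) / 4 + (q : ℂ) / 2) - Complex.I * lam)
    (((p : ℂ) / 4 + (q : ℂ) / 2) + Complex.I * lam) (((p + q + 1 : ℕ) : ℂ) / 2)

theorem halfDim_re_pos (p q : ℕ) : 0 < (((p + q + 1 : ℕ) : ℂ) / 2).re := by
  rw [Complex.div_ofNat_re, Complex.natCast_re]
  positivity

theorem hasDerivAt_comp_neg_ofReal {G : ℂ → ℂ} {s : ℝ} (h : DifferentiableAt ℂ G (-(s : ℂ))) :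
    HasDerivAt (fun s : ℝ => G (-(s : ℂ))) (-deriv G (-(s : ℂ))) s := by
  have h1 : HasDerivAt (fun s : ℝ => -(s : ℂ)) (-1) s := (Complex.ofRealCLM.hasDerivAt (x := s)).neg
  have := HasDerivAt.comp s h.hasDerivAt h1
  exact this.congr_deriv (by ring)

theorem isSphericalFunction_gaussF (S : HTypeAlgebra p q) (lam : ℂ) :
    IsSphericalFunction S lam fun x => sphericalProfile p q lam (-(x.coord.sinhSq : ℂ)) := by
  have hc := halfDim_re_pos p q
  have han : AnalyticOnNhd ℂ (sphericalProfile p q lam) {z | z.re < 1 / 2} :=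
    analyticOnNhd_gaussF _ _ _ hc
  have hmem : ∀ s : ℝ, -(1 / 2) < s → -(s : ℂ) ∈ {z : ℂ | z.re < 1 / 2} := fun s hs => by
    simp only [Set.mem_ofPred_eq, Complex.neg_re, Complex.ofReal_re]
    linarith
  refine ⟨?_, ?_, ?_, ?_⟩
  · have : ContDiff ℝ ∞ (fun x : DRCoord p q => sphericalProfile p q lam (-(x.sinhSq : ℂ))) := by
      rw [contDiff_iff_contDiffAt]
      intro x
      have h1 : ContDiffAt ℝ ∞ (sphericalProfile p q lam) (-(x.sinhSq : ℂ)) :=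
        ((han _ (hmem _ (by have := x.sinhSq_nonneg; linarith))).contDiffAt).restrict_scalars ℝ
      exact h1.comp x (Complex.ofRealCLM.contDiff.comp DRCoord.contDiff_sinhSq).neg.contDiffAt
    exact this.contMDiff
  · intro x y hxy
    simp only [(edist_one_eq_iff x y).1 hxy]
  · intro x
    have hx := hmem _ (show -(1 / 2) < x.coord.sinhSq by
      have := x.coord.sinhSq_nonneg; linarith)
    have h := laplacian_of_eventuallyEq (S := S) (x := x.coord)
      (f := fun x => sphericalProfile p q lam (-(x.coord.sinhSq : ℂ)))
      (g := fun s => sphericalProfile p q lam (-(s : ℂ)))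
      (g' := fun s => -deriv (sphericalProfile p q lam) (-(s : ℂ)))
      (g'' := deriv (deriv (sphericalProfile p q lam)) (-(x.coord.sinhSq : ℂ)))
      (Filter.Eventually.of_forall fun _ => rfl)
      (by
        filter_upwards [lt_mem_nhds (show -(1 / 2) < x.coord.sinhSq by
          have := x.coord.sinhSq_nonneg; linarith)] with s hs
        exact hasDerivAt_comp_neg_ofReal (han _ (hmem s hs)).differentiableAt)
      ((hasDerivAt_comp_neg_ofReal (han _ hx).deriv.differentiableAt).neg.congr_deriv (by simp))
    refine Eq.trans h ?_
    have ode := gaussF_ode (((p : ℂ) / 4 + (q : ℂ) / 2) - Complex.I * lam)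
      (((p : ℂ) / 4 + (q : ℂ) / 2) + Complex.I * lam) (((p + q + 1 : ℕ) : ℂ) / 2) hc hx
    change _ = _ * sphericalProfile p q lam (-(x.coord.sinhSq : ℂ))
    rw [← sphericalProfile] at ode
    push_cast at ode
    -- Here a + b + 1 = p/2 + q + 1 and ab = ρ² − (iλ)².
    linear_combination (-1 : ℂ) * ode + lam ^ 2 * sphericalProfile p q lam (-(x.coord.sinhSq : ℂ)) *
      Complex.I_sq
  · change sphericalProfile p q lam (-((0 : DRCoord p q).sinhSq : ℂ)) = 1
    rw [DRCoord.sinhSq_zero, Complex.ofReal_zero, neg_zero]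
    exact gaussF_zero _ _ _ hc

/-- The coefficient of the first order term of the radial part of the Laplacian. -/
def radialDamping (p q : ℕ) (t : ℝ) : ℝ :=
  (((p : ℝ) + q) / 2 + ((p : ℝ) / 2 + q) * Real.sinh (t / 2) ^ 2) /
    Real.sqrt (Real.sinh (t / 2) ^ 2 * (Real.sinh (t / 2) ^ 2 + 1))

theorem arsinh_sqrt_sinh_sq {t : ℝ} (ht : 0 ≤ t) :
    2 * Real.arsinh (Real.sqrt (Real.sinh (t / 2) ^ 2)) = t := by
  rw [Real.sqrt_sq (Real.sinh_nonneg_iff.2 (by linarith)), Real.arsinh_sinh]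
  ring

theorem IsSphericalFunction.contDiff_comp_mk {lam : ℂ} {φ : DamekRicci S → ℂ}
    (h : IsSphericalFunction S lam φ) :
    ContDiff ℝ ∞ fun t => φ (ofCoord S (DRCoord.mk 0 0 t)) := by
  have h1 : ContDiff ℝ ∞ (fun x : DRCoord p q => φ (ofCoord S x)) :=
    (contMDiff_iff_contDiff (f := fun x : DRCoord p q => φ (ofCoord S x))).1 h.smooth
  exact h1.comp (DRCoord.contDiff_mk.comp (contDiff_const.prodMk (contDiff_const.prodMk contDiff_id)))

/-- Every sphere about the identity meets the line v = z = 0, at t = 2 arsinh √u, so φ is determined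
by its restriction to that line. -/
theorem IsSphericalFunction.apply_eq {lam : ℂ} {φ : DamekRicci S → ℂ}
    (h : IsSphericalFunction S lam φ) (x : DamekRicci S) :
    φ x = φ (ofCoord S (DRCoord.mk 0 0 (2 * Real.arsinh (Real.sqrt x.coord.sinhSq)))) := by
  refine h.radial _ _ ((edist_one_eq_iff _ _).2 ?_)
  change _ = (DRCoord.mk 0 0 (2 * Real.arsinh (Real.sqrt x.coord.sinhSq)) : DRCoord p q).sinhSq
  rw [DRCoord.sinhSq_mk_zero_zero, mul_div_cancel_left₀ _ two_ne_zero, Real.sinh_arsinh,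
    Real.sq_sqrt x.coord.sinhSq_nonneg]

/-- With g(u) = k(2 arsinh √u) one has g' = k'/√(u(u + 1)), and the formula for Δ(g ∘ u) becomes the
radial equation. The damping equals ((p + q)/2) coth(t/2) + (q/2) tanh(t/2). -/
theorem IsSphericalFunction.ode {lam : ℂ} {φ : DamekRicci S → ℂ}
    (h : IsSphericalFunction S lam φ) {k : ℝ → ℂ}
    (hk : k = fun t => φ (ofCoord S (DRCoord.mk 0 0 t))) {t : ℝ} (ht : 0 < t) :
    deriv (deriv k) t = -(radialDamping p q t * deriv k t) -
      (lam ^ 2 + ((p : ℂ) / 4 + (q : ℂ) / 2) ^ 2) * k t := by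
  have hkc : ContDiff ℝ ∞ k := hk ▸ h.contDiff_comp_mk
  have hkc2 : ContDiff ℝ 2 k := contDiff_infty.1 hkc 2
  have hd1 : ∀ t, HasDerivAt k (deriv k t) t := fun t =>
    (hkc2.differentiable two_ne_zero t).hasDerivAt
  have hD' : ContDiff ℝ 1 (deriv k) := (contDiff_succ_iff_deriv (n := 1).1 hkc2).2.2
  have hd2 : ∀ t, HasDerivAt (deriv k) (deriv (deriv k) t) t := fun t =>
    (hD'.differentiable one_ne_zero t).hasDerivAt
  set x : DRCoord p q := DRCoord.mk 0 0 t with hx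
  have hxs : x.sinhSq = Real.sinh (t / 2) ^ 2 := DRCoord.sinhSq_mk_zero_zero t
  have hpos : 0 < x.sinhSq := by
    rw [hxs]
    exact pow_pos (Real.sinh_pos_iff.2 (by linarith)) 2
  have hr : 2 * Real.arsinh (Real.sqrt x.sinhSq) = t := by rw [hxs, arsinh_sqrt_sinh_sq ht.le]
  have hw : ∀ s : ℝ, 0 < s → 0 < s * (s + 1) := fun s hs => by positivity
  have hg : ∀ᶠ s in nhds x.sinhSq, HasDerivAt (fun s => k (2 * Real.arsinh (Real.sqrt s)))
      ((Real.sqrt (s * (s + 1)))⁻¹ • deriv k (2 * Real.arsinh (Real.sqrt s))) s := by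
    filter_upwards [lt_mem_nhds hpos] with s hs
    have := HasDerivAt.scomp (h := fun s => 2 * Real.arsinh (Real.sqrt s)) s (hd1 _)
      (hasDerivAt_arsinh_sqrt hs)
    rw [one_div] at this
    exact this
  have hg' := ((((hasDerivAt_id x.sinhSq).fun_mul ((hasDerivAt_id x.sinhSq).add_const 1)).sqrt
    (hw _ hpos).ne').fun_inv (Real.sqrt_pos.2 (hw _ hpos)).ne').fun_smul
    (HasDerivAt.scomp (h := fun s => 2 * Real.arsinh (Real.sqrt s)) x.sinhSq (hd2 _)
      (hasDerivAt_arsinh_sqrt hpos))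
  have hlap := laplacian_of_eventuallyEq (S := S) (x := x) (f := φ)
    (Filter.Eventually.of_forall fun y => by rw [h.apply_eq]; exact (congrFun hk _).symm) hg hg'
  rw [h.eigen] at hlap
  simp only [Function.comp_apply, hr, id] at hlap
  have hkt : φ (ofCoord S x) = k t := by rw [hk]
  rw [hkt] at hlap
  rw [radialDamping, ← hxs]
  have hsq : ((Real.sqrt (x.sinhSq * (x.sinhSq + 1)) : ℝ) : ℂ) ^ 2 =
      (x.sinhSq : ℂ) * (x.sinhSq + 1) := by
    have := Real.sq_sqrt (hw _ hpos).le
    exact_mod_cast this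
  have hne : ((Real.sqrt (x.sinhSq * (x.sinhSq + 1)) : ℝ) : ℂ) ≠ 0 := by
    exact_mod_cast (Real.sqrt_pos.2 (hw _ hpos)).ne'
  generalize Real.sqrt (x.sinhSq * (x.sinhSq + 1)) = w at *
  simp only [Complex.real_smul] at hlap
  push_cast at hlap ⊢
  rw [← hsq] at hlap
  field_simp at hlap ⊢
  linear_combination (-1 : ℂ) * hlap

theorem IsSphericalFunction.unique {lam : ℂ} {φ ψ : DamekRicci S → ℂ}
    (hφ : IsSphericalFunction S lam φ) (hψ : IsSphericalFunction S lam ψ) : φ = ψ := by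
  set k : ℝ → ℂ := fun t => φ (ofCoord S (DRCoord.mk 0 0 t)) with hk
  set l : ℝ → ℂ := fun t => ψ (ofCoord S (DRCoord.mk 0 0 t)) with hl
  have hkc : ContDiff ℝ 2 k := contDiff_infty.1 hφ.contDiff_comp_mk 2
  have hlc : ContDiff ℝ 2 l := contDiff_infty.1 hψ.contDiff_comp_mk 2
  have hkl1 : deriv (fun t => k t - l t) = fun t => deriv k t - deriv l t := funext fun t =>
    deriv_fun_sub (hkc.differentiable two_ne_zero t) (hlc.differentiable two_ne_zero t)
  have hk1 : ContDiff ℝ 1 (deriv k) := (contDiff_succ_iff_deriv (n := 1).1 hkc).2.2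
  have hl1 : ContDiff ℝ 1 (deriv l) := (contDiff_succ_iff_deriv (n := 1).1 hlc).2.2
  -- The points at t and −t are equally far from the identity, so the restriction is even. This
  -- gives the second initial condition.
  have heven : ∀ {θ : DamekRicci S → ℂ}, IsSphericalFunction S lam θ →
      deriv (fun t => θ (ofCoord S (DRCoord.mk 0 0 t))) 0 = 0 := fun {θ} hθ => by
    set m : ℝ → ℂ := fun t => θ (ofCoord S (DRCoord.mk 0 0 t)) with hm
    have e : (fun t => m (-t)) = m := funext fun t => hθ.radial _ _ ((edist_one_eq_iff _ _).2 (by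
      change (DRCoord.mk 0 0 (-t) : DRCoord p q).sinhSq = (DRCoord.mk 0 0 t : DRCoord p q).sinhSq
      rw [DRCoord.sinhSq_mk_zero_zero, DRCoord.sinhSq_mk_zero_zero, neg_div, Real.sinh_neg,
        neg_sq]))
    have h1 := deriv_comp_neg m 0
    rw [e, neg_zero] at h1
    exact self_eq_neg.1 h1
  have h10 : ofCoord S (DRCoord.mk 0 0 0) = 1 := rfl
  have key : ∀ t, 0 ≤ t → k t - l t = 0 := fun t ht => by
    refine eq_zero_of_damped_ode (hkc.sub hlc) ?_ ?_ (radialDamping p q) (fun t _ => ?_)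
      (lam ^ 2 + ((p : ℂ) / 4 + (q : ℂ) / 2) ^ 2) (fun t ht => ?_) ht
    · simp only [hk, hl, h10, hφ.map_one, hψ.map_one, sub_self]
    · simp only [hkl1]
      rw [heven hφ, heven hψ, sub_self]
    · rw [radialDamping]
      positivity
    · rw [hkl1, deriv_fun_sub (hk1.differentiable one_ne_zero t) (hl1.differentiable one_ne_zero t),
        hφ.ode hk ht, hψ.ode hl ht]
      ring
  funext x
  rw [hφ.apply_eq, hψ.apply_eq]
  exact sub_eq_zero.1 (key _ (by
    have := Real.arsinh_nonneg_iff.2 (Real.sqrt_nonneg x.coord.sinhSq); linarith))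

theorem existsUnique_isSphericalFunction (S : HTypeAlgebra p q) (lam : ℂ) :
    ∃! φ, IsSphericalFunction S lam φ :=
  ⟨_, isSphericalFunction_gaussF S lam, fun _ h => h.unique (isSphericalFunction_gaussF S lam)⟩

theorem sphericalFunction_eq (S : HTypeAlgebra p q) (lam : ℂ) :
    sphericalFunction S lam = fun x => sphericalProfile p q lam (-(x.coord.sinhSq : ℂ)) :=
  (Classical.epsilon_spec (existsUnique_isSphericalFunction S lam).exists).unique
    (isSphericalFunction_gaussF S lam)

end DamekRicci

end

noncomputable section

/-! ### The Riemannian volume in geodesic polar coordinates -/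

theorem lintegral_exp_add (c : ℝ) (g : ℝ → ENNReal) :
    ∫⁻ t : ℝ, ENNReal.ofReal (Real.exp t) * g (Real.exp t + c) = ∫⁻ h in Set.Ioi c, g h := by
  have h := lintegral_image_eq_lintegral_abs_deriv_mul (s := Set.univ)
    (f := fun t => Real.exp t + c) (f' := Real.exp) MeasurableSet.univ
    (fun t _ => ((Real.hasDerivAt_exp t).add_const c).hasDerivWithinAt)
    (fun s _ t _ hst => Real.exp_injective (add_right_cancel hst)) g
  have himg : (fun t => Real.exp t + c) '' Set.univ = Set.Ioi c := by
    ext y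
    simp only [Set.image_univ, Set.mem_range, Set.mem_Ioi]
    constructor
    · rintro ⟨t, rfl⟩
      linarith [Real.exp_pos t]
    · intro hy
      exact ⟨Real.log (y - c), by rw [Real.exp_log (by linarith)]; ring⟩
  rw [himg] at h
  rw [h]
  simp [abs_of_pos (Real.exp_pos _)]

theorem lintegral_comp_smul_of_pos {E : Type*} [NormedAddCommGroup E] [NormedSpace ℝ E]
    [MeasurableSpace E] [BorelSpace E] [FiniteDimensional ℝ E] (μ : Measure E)
    [μ.IsAddHaarMeasure] {s : ℝ} (hs : 0 < s) {g : E → ENNReal} :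
    ∫⁻ v, g v ∂μ = ENNReal.ofReal (s ^ Module.finrank ℝ E) * ∫⁻ w, g (s • w) ∂μ := by
  have he : MeasurableEmbedding fun x : E => s • x :=
    (Homeomorph.smulOfNeZero s hs.ne').measurableEmbedding
  have h := he.lintegral_map (μ := μ) g
  rw [Measure.map_addHaar_smul μ hs.ne', lintegral_smul_measure, abs_of_pos (by positivity)] at h
  rw [← h, smul_eq_mul, ← mul_assoc, ← ENNReal.ofReal_mul (by positivity),
    mul_inv_cancel₀ (by positivity), ENNReal.ofReal_one, one_mul]

/-- The derivative of the inversion is (R/|x − c|)² times a reflection, whose determinant is ±1. -/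
theorem lintegral_comp_inversion {F : Type*} [NormedAddCommGroup F] [InnerProductSpace ℝ F]
    [FiniteDimensional ℝ F] [MeasurableSpace F] [BorelSpace F] (μ : Measure F)
    [μ.IsAddHaarMeasure] [Nontrivial F] (c : F) {R : ℝ} (hR : R ≠ 0) (g : F → ENNReal) :
    ∫⁻ y, g y ∂μ = ∫⁻ x, ENNReal.ofReal (((R / dist x c) ^ 2) ^ Module.finrank ℝ F) *
      g (EuclideanGeometry.inversion c R x) ∂μ := by
  have h := lintegral_image_eq_lintegral_abs_det_fderiv_mul μ (s := {c}ᶜ)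
    (f := EuclideanGeometry.inversion c R) (measurableSet_singleton c).compl
    (fun x hx => (EuclideanGeometry.hasFDerivAt_inversion (R := R) hx).hasFDerivWithinAt)
    ((EuclideanGeometry.inversion_injective c hR).injOn) g
  have himg : EuclideanGeometry.inversion c R '' {c}ᶜ = {c}ᶜ := by
    rw [Set.image_compl_eq (EuclideanGeometry.inversion_involutive c hR).bijective,
      Set.image_singleton, EuclideanGeometry.inversion_self]
  rw [himg, restrict_compl_singleton] at h
  rw [h]
  refine lintegral_congr fun x => ?_
  congr 2
  rw [ContinuousLinearMap.det, ContinuousLinearMap.toLinearMap_smul, LinearMap.det_smul, abs_mul,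
    abs_of_nonneg (by positivity)]
  have := Submodule.det_reflection (𝕜 := ℝ) (Submodule.span ℝ {x - c})ᗮ
  have e : |LinearMap.det (((Submodule.span ℝ {x - c})ᗮ.reflection : F →L[ℝ] F) : F →ₗ[ℝ] F)| = 1 := by
    erw [this]
    simp
  rw [e, mul_one]

theorem lintegral_eq_of_comp_inversion {F : Type*} [NormedAddCommGroup F]
    [InnerProductSpace ℝ F] [FiniteDimensional ℝ F] [MeasurableSpace F] [BorelSpace F]
    (μ : Measure F) [μ.IsAddHaarMeasure] [Nontrivial F] (c : F) {R : ℝ} (hR : R ≠ 0)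
    {g g' : F → ENNReal} (h : ∀ x, x ≠ c →
      ENNReal.ofReal (((R / dist x c) ^ 2) ^ Module.finrank ℝ F) *
        g (EuclideanGeometry.inversion c R x) = g' x) :
    ∫⁻ y, g y ∂μ = ∫⁻ x, g' x ∂μ := by
  rw [lintegral_comp_inversion μ c hR]
  refine lintegral_congr_ae ?_
  filter_upwards [compl_mem_ae_iff.2 (measure_singleton c)] with x hx using h x hx

namespace DRCoord

variable {p q : ℕ}

theorem finrank_eq (p q : ℕ) : Module.finrank ℝ (DRCoord p q) = p + q + 1 := by
  rw [(prodEquiv p q).finrank_eq]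
  simp [Module.finrank_prod]
  ring

theorem continuous_sinhSq : Continuous (sinhSq : DRCoord p q → ℝ) :=
  (contDiff_sinhSq (n := 0)).continuous

/-- The coordinate `(z, t)`. -/
abbrev Base (q : ℕ) : Type := WithLp 2 (EuclideanSpace ℝ (Fin q) × ℝ)

theorem lintegral_eq_fiber (f : DRCoord p q → ENNReal) (hf : Measurable f) :
    ∫⁻ x, f x = ∫⁻ v : EuclideanSpace ℝ (Fin p), ∫⁻ y : Base q, f (mk v y.fst y.snd) := by
  have h := (WithLp.volume_preserving_toLp (U := EuclideanSpace ℝ (Fin p))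
    (V := Base q)).lintegral_comp hf
  refine h.symm.trans ?_
  rw [Measure.volume_eq_prod, lintegral_prod]
  · rfl
  · exact (hf.comp (WithLp.measurable_toLp 2 _)).aemeasurable

theorem lintegral_base (f : Base q → ENNReal) (hf : Measurable f) :
    ∫⁻ y, f y = ∫⁻ z : EuclideanSpace ℝ (Fin q), ∫⁻ t : ℝ, f (WithLp.toLp 2 (z, t)) := by
  have h := (WithLp.volume_preserving_toLp (U := EuclideanSpace ℝ (Fin q)) (V := ℝ)).lintegral_comp hf
  rw [← h, Measure.volume_eq_prod, lintegral_prod]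
  exact (hf.comp (WithLp.measurable_toLp 2 _)).aemeasurable

theorem finrank_base (q : ℕ) : Module.finrank ℝ (Base q) = q + 1 := by
  rw [(WithLp.linearEquiv 2 ℝ (EuclideanSpace ℝ (Fin q) × ℝ)).finrank_eq]
  simp [Module.finrank_prod]

/-- The density of the Riemannian volume in the ball model times a radial function. -/
def ballKernel (κ : ℝ) (f : ℝ → ENNReal) (τ : ℝ) : ENNReal :=
  if 0 < τ then ENNReal.ofReal (τ ^ (-κ)) * f (1 / τ - 1) else 0

theorem measurable_ballKernel (κ : ℝ) {f : ℝ → ENNReal} (hf : Measurable f) :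
    Measurable (ballKernel κ f) :=
  Measurable.ite measurableSet_Ioi
    ((measurable_id.pow_const _).ennreal_ofReal.mul
      (hf.comp ((measurable_const.div measurable_id).sub measurable_const))) measurable_const

/-- Substitute h = e^t + |v|²/4. The argument of `ballKernel` is then 4e^t/R = 1/(u + 1), with R =
(1 + h)² + |z|², and (4/R)^κ (4e^t/R)^(−κ) = e^{−κt}; the missing factor e^t comes from dh. -/
theorem lintegral_line (κ : ℝ) (f : ℝ → ENNReal) (v : EuclideanSpace ℝ (Fin p))
    (z : EuclideanSpace ℝ (Fin q)) :
    ∫⁻ t : ℝ, ENNReal.ofReal (Real.exp (-(κ - 1) * t)) * f (mk v z t).sinhSq =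
      ∫⁻ h : ℝ, ENNReal.ofReal ((4 / ((1 + h) ^ 2 + ‖z‖ ^ 2)) ^ κ) *
        ballKernel κ f ((4 * h - ‖v‖ ^ 2) / ((1 + h) ^ 2 + ‖z‖ ^ 2)) := by
  set G : ℝ → ENNReal := fun h => ENNReal.ofReal ((4 / ((1 + h) ^ 2 + ‖z‖ ^ 2)) ^ κ) *
        ballKernel κ f ((4 * h - ‖v‖ ^ 2) / ((1 + h) ^ 2 + ‖z‖ ^ 2)) with hG
  have h1 : ∫⁻ h in Set.Ioi (‖v‖ ^ 2 / 4), G h = ∫⁻ h, G h := by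
    refine setLIntegral_eq_of_support_subset ?_ 
    intro h hh
    by_contra hcon
    refine hh ?_
    simp only [Set.mem_Ioi, not_lt] at hcon
    have : ¬ 0 < (4 * h - ‖v‖ ^ 2) / ((1 + h) ^ 2 + ‖z‖ ^ 2) :=
      not_lt.2 (div_nonpos_of_nonpos_of_nonneg (by linarith) (by positivity))
    simp [hG, ballKernel, this]
  rw [← h1, ← lintegral_exp_add]
  refine lintegral_congr fun t => ?_
  have ha := Real.exp_pos t
  have hu := (mk v z t).sinhSq_add_one
  have hh : (mk v z t).height = 1 + (Real.exp t + ‖v‖ ^ 2 / 4) := by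
    simp only [height, v_mk, t_mk]
    ring
  rw [hh] at hu
  simp only [z_mk, t_mk] at hu
  have h0 := (mk v z t).sinhSq_nonneg
  have e1 : 4 * (Real.exp t + ‖v‖ ^ 2 / 4) - ‖v‖ ^ 2 = 4 * Real.exp t := by ring
  have hR : 0 < (1 + (Real.exp t + ‖v‖ ^ 2 / 4)) ^ 2 + ‖z‖ ^ 2 := by positivity
  have hpos : 0 < 4 * Real.exp t / ((1 + (Real.exp t + ‖v‖ ^ 2 / 4)) ^ 2 + ‖z‖ ^ 2) := by
    positivity
  rw [hG]
  simp only [e1, ballKernel, if_pos hpos]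
  have e2 : 1 / (4 * Real.exp t / ((1 + (Real.exp t + ‖v‖ ^ 2 / 4)) ^ 2 + ‖z‖ ^ 2)) - 1 =
      (mk v z t).sinhSq := by
    rw [← hu]
    field_simp
    ring
  rw [e2, ← mul_assoc, ← mul_assoc, ← ENNReal.ofReal_mul ha.le,
    ← ENNReal.ofReal_mul (by positivity)]
  congr 2
  rw [show 4 * Real.exp t / ((1 + (Real.exp t + ‖v‖ ^ 2 / 4)) ^ 2 + ‖z‖ ^ 2) =
    4 / ((1 + (Real.exp t + ‖v‖ ^ 2 / 4)) ^ 2 + ‖z‖ ^ 2) * Real.exp t by ring,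
    Real.mul_rpow (by positivity) ha.le, mul_assoc, ← mul_assoc (_ ^ κ),
    ← Real.rpow_add (by positivity), add_neg_cancel, Real.rpow_zero, one_mul, ← Real.exp_mul,
    ← Real.exp_add]
  congr 1
  ring

end DRCoord

end

/-! ### From the half space to the ball by an inversion -/

noncomputable section

namespace DRCoord

variable {p q : ℕ}

/-- The center of the inversion that exchanges the half space model and the ball model. -/
def baseCenter (q : ℕ) : Base q := WithLp.toLp 2 (0, -1)

theorem baseCenter_fst : (baseCenter q).fst = 0 := rfl

theorem baseCenter_snd : (baseCenter q).snd = -1 := rfl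

/-- The squared Euclidean distance to the center. -/
def baseSq (y : Base q) : ℝ := (1 + y.snd) ^ 2 + ‖y.fst‖ ^ 2

theorem baseSq_nonneg (y : Base q) : 0 ≤ baseSq y := by
  unfold baseSq
  positivity

theorem measurable_base_fst : Measurable (fun y : Base q => y.fst) :=
  measurable_fst.comp (WithLp.measurable_ofLp 2 _)

theorem measurable_base_snd : Measurable (fun y : Base q => y.snd) :=
  measurable_snd.comp (WithLp.measurable_ofLp 2 _)

theorem measurable_baseSq : Measurable (baseSq : Base q → ℝ) :=
  ((measurable_const.add measurable_base_snd).pow_const 2).add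
    (measurable_base_fst.norm.pow_const 2)

theorem norm_base_sq (y : Base q) : ‖y‖ ^ 2 = ‖y.fst‖ ^ 2 + y.snd ^ 2 := by
  rw [WithLp.prod_norm_sq_eq_of_L2, Real.norm_eq_abs, sq_abs]

theorem baseSq_eq (y : Base q) : baseSq y = dist y (baseCenter q) ^ 2 := by
  rw [dist_eq_norm, norm_base_sq, baseSq]
  simp only [WithLp.sub_fst, WithLp.sub_snd, baseCenter_fst, baseCenter_snd, sub_zero, sub_neg_eq_add]
  ring

theorem baseSq_eq_norm (y : Base q) : baseSq y = ‖y‖ ^ 2 + 2 * y.snd + 1 := by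
  rw [norm_base_sq, baseSq]
  ring

/-- By the second identity the image of x lies in the half space h > 0 exactly when |x| < 1. -/
theorem inversion_base {x : Base q} (hx : x ≠ baseCenter q) :
    baseSq (EuclideanGeometry.inversion (baseCenter q) (√2) x) = 4 / baseSq x ∧
    baseSq x * (EuclideanGeometry.inversion (baseCenter q) (√2) x).snd = 1 - ‖x‖ ^ 2 := by
  have hD : 0 < dist x (baseCenter q) := dist_pos.2 hx
  have hR : 0 < baseSq x := by rw [baseSq_eq]; positivity
  have h2 : √(2 : ℝ) ^ 2 = 2 := Real.sq_sqrt (by norm_num)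
  constructor
  · rw [baseSq_eq, EuclideanGeometry.dist_inversion_center, h2, div_pow, ← baseSq_eq]
    norm_num
  · rw [EuclideanGeometry.inversion, div_pow, h2, ← baseSq_eq]
    simp only [vsub_eq_sub, vadd_eq_add, WithLp.add_snd, WithLp.smul_snd, WithLp.sub_snd,
      smul_eq_mul, baseCenter_snd]
    have := baseSq_eq_norm x
    field_simp
    linarith

/-- The integrand after the substitution `h = e^t + |v|²/4`. -/
def fiberKernel (κ : ℝ) (f : ℝ → ENNReal) (v : EuclideanSpace ℝ (Fin p)) (y : Base q) : ENNReal :=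
  ENNReal.ofReal ((4 / baseSq y) ^ κ) * ballKernel κ f ((4 * y.snd - ‖v‖ ^ 2) / baseSq y)

theorem measurable_fiberKernel (κ : ℝ) {f : ℝ → ENNReal} (hf : Measurable f) :
    Measurable (fun x : EuclideanSpace ℝ (Fin p) × Base q => fiberKernel κ f x.1 x.2) := by
  have hR : Measurable fun x : EuclideanSpace ℝ (Fin p) × Base q => baseSq x.2 :=
    measurable_baseSq.comp measurable_snd
  have hs : Measurable fun x : EuclideanSpace ℝ (Fin p) × Base q => x.2.snd :=
    measurable_base_snd.comp measurable_snd
  exact ((measurable_const.div hR).pow_const _).ennreal_ofReal.mul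
    ((measurable_ballKernel κ hf).comp
      (((measurable_const.mul hs).sub (measurable_fst.norm.pow_const 2)).div hR))

/-- The integrand after the substitution `v = √R w`. -/
def scaledKernel (κ : ℝ) (f : ℝ → ENNReal) (w : EuclideanSpace ℝ (Fin p)) (y : Base q) : ENNReal :=
  ENNReal.ofReal (√(baseSq y) ^ p * (4 / baseSq y) ^ κ) *
    ballKernel κ f (4 * y.snd / baseSq y - ‖w‖ ^ 2)

theorem measurable_scaledKernel (κ : ℝ) {f : ℝ → ENNReal} (hf : Measurable f) :
    Measurable (fun x : Base q × EuclideanSpace ℝ (Fin p) => scaledKernel κ f x.2 x.1) := by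
  have hR : Measurable fun x : Base q × EuclideanSpace ℝ (Fin p) => baseSq x.1 :=
    measurable_baseSq.comp measurable_fst
  have hs : Measurable fun x : Base q × EuclideanSpace ℝ (Fin p) => x.1.snd :=
    measurable_base_snd.comp measurable_fst
  exact ((hR.sqrt.pow_const p).mul ((measurable_const.div hR).pow_const _)).ennreal_ofReal.mul
    ((measurable_ballKernel κ hf).comp
      (((measurable_const.mul hs).div hR).sub (measurable_snd.norm.pow_const 2)))

theorem lintegral_fiberKernel {κ : ℝ} (hκ : 0 < κ) (f : ℝ → ENNReal)
    (y : Base q) :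
    ∫⁻ v : EuclideanSpace ℝ (Fin p), fiberKernel κ f v y =
      ∫⁻ w : EuclideanSpace ℝ (Fin p), scaledKernel κ f w y := by
  rcases (baseSq_nonneg y).eq_or_lt with hR | hR
  -- At the center of the inversion both integrands vanish, since 4/0 = 0 and 0^κ = 0.
  · simp [fiberKernel, scaledKernel, ← hR, Real.zero_rpow hκ.ne']
  · rw [lintegral_comp_smul_of_pos volume (Real.sqrt_pos.2 hR), ← lintegral_const_mul']
    · refine lintegral_congr fun w => ?_
      rw [fiberKernel, scaledKernel, ← mul_assoc, ← ENNReal.ofReal_mul (by positivity)]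
      congr 2
      · simp
      · rw [norm_smul, Real.norm_eq_abs, mul_pow, sq_abs, Real.sq_sqrt hR.le]
        field_simp
    · exact ENNReal.ofReal_ne_top

theorem lintegral_scaledKernel (f : ℝ → ENNReal) (w : EuclideanSpace ℝ (Fin p)) :
    ∫⁻ y : Base q, scaledKernel ((p : ℝ) / 2 + q + 1) f w y =
      ∫⁻ x : Base q, ENNReal.ofReal (2 ^ (p + q + 1)) *
        ballKernel ((p : ℝ) / 2 + q + 1) f (1 - (‖w‖ ^ 2 + ‖x‖ ^ 2)) := by
  have : Nontrivial (Base q) := Module.nontrivial_of_finrank_pos (R := ℝ) (by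
    rw [finrank_base]; omega)
  refine lintegral_eq_of_comp_inversion volume (baseCenter q) (R := √2) (by positivity)
    fun x hx => ?_
  obtain ⟨h1, h2⟩ := inversion_base hx
  have hD : 0 < dist x (baseCenter q) := dist_pos.2 hx
  rw [scaledKernel, ← mul_assoc, ← ENNReal.ofReal_mul (by positivity), h1]
  set D := dist x (baseCenter q) with hDdef
  have hR : baseSq x = D ^ 2 := baseSq_eq x
  have hR0 : 0 < baseSq x := by rw [hR]; positivity
  congr 2
  -- The Jacobian (2/D²)^(q+1), the factor (2/D)^p from scaling v, and (D²)^κ combine to 2^(p+q+1):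
  -- all powers of D cancel because 2κ = p + 2q + 2.
  · rw [finrank_base, hR, div_pow, Real.sq_sqrt (by norm_num)]
    have e1 : √(4 / D ^ 2) = 2 / D := by
      rw [show (4 : ℝ) / D ^ 2 = (2 / D) ^ 2 by ring, Real.sqrt_sq (by positivity)]
    have e2 : (4 : ℝ) / (4 / D ^ 2) = D ^ 2 := by field_simp
    have e3 : (D ^ 2) ^ ((p : ℝ) / 2 + q + 1) = D ^ (p + 2 * q + 2) := by
      rw [← Real.rpow_natCast, ← Real.rpow_natCast, ← Real.rpow_mul hD.le]
      congr 1
      push_cast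
      ring
    rw [e1, e2, e3, show D ^ (p + 2 * q + 2) = D ^ p * (D ^ 2) ^ (q + 1) by ring, div_pow, div_pow]
    field_simp
    ring
  · have e : 4 * (EuclideanGeometry.inversion (baseCenter q) (√2) x).snd /
        (4 / baseSq x) =
        baseSq x * (EuclideanGeometry.inversion (baseCenter q) (√2) x).snd := by
      field_simp
    rw [e, h2]
    ring

theorem norm_mk_sq (v : EuclideanSpace ℝ (Fin p)) (y : Base q) :
    ‖mk v y.fst y.snd‖ ^ 2 = ‖v‖ ^ 2 + ‖y‖ ^ 2 := by
  rw [norm_sq_eq, norm_base_sq]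
  simp only [v_mk, z_mk, t_mk]
  try ring

theorem lintegral_comp_sinhSq {f : ℝ → ENNReal} (hf : Measurable f) :
    ∫⁻ x : DRCoord p q, ENNReal.ofReal (Real.exp (-((p : ℝ) / 2 + q) * x.t)) * f x.sinhSq =
      ∫⁻ x : DRCoord p q, ENNReal.ofReal (2 ^ (p + q + 1)) *
        ballKernel ((p : ℝ) / 2 + q + 1) f (1 - ‖x‖ ^ 2) := by
  set κ : ℝ := (p : ℝ) / 2 + q + 1 with hκ
  have hm : Measurable fun x : DRCoord p q =>
      ENNReal.ofReal (Real.exp (-((p : ℝ) / 2 + q) * x.t)) * f x.sinhSq :=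
    ((Real.measurable_exp.comp (measurable_const.mul
      (contDiff_t (n := 0)).continuous.measurable)).ennreal_ofReal).mul
      (hf.comp continuous_sinhSq.measurable)
  have hm' : Measurable fun x : DRCoord p q => ENNReal.ofReal (2 ^ (p + q + 1)) *
        ballKernel κ f (1 - ‖x‖ ^ 2) :=
    measurable_const.mul ((measurable_ballKernel κ hf).comp
      (measurable_const.sub (measurable_norm.pow_const 2)))
  have hmk : ∀ v : EuclideanSpace ℝ (Fin p), Measurable fun y : Base q => mk v y.fst y.snd :=
    fun v => (contDiff_mk (n := 0)).continuous.measurable.comp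
      (measurable_const.prodMk (measurable_base_fst.prodMk measurable_base_snd))
  -- Three substitutions, separated by Tonelli: t to h with v, z fixed; v = √R w with (z, h) fixed;
  -- the inversion of (z, h) with w fixed. The result depends only on |w|² + |x|².
  calc
    _ = ∫⁻ v : EuclideanSpace ℝ (Fin p), ∫⁻ y : Base q, fiberKernel κ f v y := by
      rw [lintegral_eq_fiber _ hm]
      refine lintegral_congr fun v => ?_
      refine (lintegral_base _ (hm.comp (hmk v))).trans (Eq.trans ?_ (lintegral_base _
        ((measurable_fiberKernel κ hf).comp measurable_prodMk_left)).symm)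
      refine lintegral_congr fun z => ?_
      have h := lintegral_line κ f v z
      rw [show κ - 1 = (p : ℝ) / 2 + q by rw [hκ]; ring] at h
      exact h
    _ = ∫⁻ y : Base q, ∫⁻ w : EuclideanSpace ℝ (Fin p), scaledKernel κ f w y := by
      rw [lintegral_lintegral_swap (measurable_fiberKernel κ hf).aemeasurable]
      exact lintegral_congr fun y => lintegral_fiberKernel (by positivity) f y
    _ = ∫⁻ w : EuclideanSpace ℝ (Fin p), ∫⁻ y : Base q, ENNReal.ofReal (2 ^ (p + q + 1)) *
          ballKernel κ f (1 - (‖w‖ ^ 2 + ‖y‖ ^ 2)) := by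
      rw [lintegral_lintegral_swap (measurable_scaledKernel κ hf).aemeasurable]
      exact lintegral_congr fun w => lintegral_scaledKernel f w
    _ = _ := by
      rw [lintegral_eq_fiber _ hm']
      simp only [norm_mk_sq]

end DRCoord

end

noncomputable section

/-! ### Compactness of balls and polar integration -/

namespace DRCoord

variable {p q : ℕ}

/-- If u ≤ s then H² + |z|² ≤ Ce^t with C = 4(s + 1). As e^t ≤ H this gives H ≤ C, which bounds v, z
and t from above; 1 ≤ H² ≤ Ce^t bounds t from below. -/
theorem isCompact_sinhSq_le {s : ℝ} (hs : 0 ≤ s) :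
    IsCompact {x : DRCoord p q | x.sinhSq ≤ s} := by
  refine Metric.isCompact_of_isClosed_isBounded
    (isClosed_le continuous_sinhSq continuous_const) ?_
  set C : ℝ := 4 * (s + 1) with hC
  refine (isBounded_iff_forall_norm_le).2 ⟨√(4 * C + (C ^ 2 + Real.log C ^ 2)), fun x hx => ?_⟩
  have hx : x.sinhSq ≤ s := hx
  have ha := Real.exp_pos x.t
  have hu := x.sinhSq_add_one
  have hC0 : 0 < C := by positivity
  have h1 : x.height ^ 2 + ‖x.z‖ ^ 2 ≤ C * Real.exp x.t := by
    rw [← hu, hC]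
    nlinarith
  have hh : x.height = 1 + Real.exp x.t + ‖x.v‖ ^ 2 / 4 := rfl
  have hv := sq_nonneg ‖x.v‖
  have hz := sq_nonneg ‖x.z‖
  have h2 : x.height ≤ C := by
    have : x.height * x.height ≤ C * x.height := by nlinarith
    exact le_of_mul_le_mul_right this (by linarith)
  have h3 : Real.exp x.t ≤ C := by linarith
  have h4 : 1 ≤ C * Real.exp x.t := by nlinarith
  have ht1 : x.t ≤ Real.log C := (Real.le_log_iff_exp_le hC0).2 h3
  have ht2 : -x.t ≤ Real.log C := by
    rw [Real.le_log_iff_exp_le hC0, Real.exp_neg, inv_le_iff_one_le_mul₀ ha]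
    exact h4
  refine Real.le_sqrt_of_sq_le ?_
  rw [norm_sq_eq]
  have ht : x.t ^ 2 ≤ Real.log C ^ 2 := sq_le_sq' (by linarith) ht1
  nlinarith

/-- Stated for image measures, the comparison of nonnegative integrals passes to complex valued
integrands. -/
theorem map_sinhSq (p q : ℕ) :
    ((volume : Measure (DRCoord p q)).withDensity
        fun x => ENNReal.ofReal (Real.exp (-((p : ℝ) / 2 + q) * x.t))).map sinhSq =
      ((volume : Measure (DRCoord p q)).withDensity
        fun x => ENNReal.ofReal (2 ^ (p + q + 1)) *
          ballKernel ((p : ℝ) / 2 + q + 1) 1 (1 - ‖x‖ ^ 2)).map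
        fun x => 1 / (1 - ‖x‖ ^ 2) - 1 := by
  have hn : Measurable fun x : DRCoord p q => 1 - ‖x‖ ^ 2 :=
    measurable_const.sub (measurable_norm.pow_const 2)
  have hn' : Measurable fun x : DRCoord p q => 1 / (1 - ‖x‖ ^ 2) - 1 :=
    (measurable_const.div hn).sub measurable_const
  refine Measure.ext_of_lintegral _ fun f hf => ?_
  rw [lintegral_map hf continuous_sinhSq.measurable,
    lintegral_map hf hn',
    lintegral_withDensity_eq_lintegral_mul₀, lintegral_withDensity_eq_lintegral_mul₀]
  · refine (lintegral_comp_sinhSq hf).trans (lintegral_congr fun x => ?_)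
    simp only [Pi.mul_apply, ballKernel]
    split_ifs <;> simp [mul_assoc]
  · exact (measurable_const.mul ((measurable_ballKernel _ measurable_one).comp hn)).aemeasurable
  · exact (hf.comp hn').aemeasurable
  · exact ((Real.measurable_exp.comp (measurable_const.mul
      (contDiff_t (n := 0)).continuous.measurable)).ennreal_ofReal).aemeasurable
  · exact (hf.comp continuous_sinhSq.measurable).aemeasurable

/-- Integrals of radial functions in geodesic polar coordinates. -/
theorem integral_comp_sinhSq {G : ℝ → ℂ} (hG : StronglyMeasurable G) :
    ∫ x : DRCoord p q, G x.sinhSq ∂((volume : Measure (DRCoord p q)).withDensity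
        fun x => ENNReal.ofReal (Real.exp (-((p : ℝ) / 2 + q) * x.t))) =
      ((p + q + 1 : ℕ) : ℝ) • volume.real (Metric.ball (0 : DRCoord p q) 1) •
        ∫ y in Set.Ioi (0 : ℝ), y ^ (p + q) •
          (if 0 < 1 - y ^ 2 then 2 ^ (p + q + 1) * (1 - y ^ 2) ^ (-((p : ℝ) / 2 + q + 1)) else 0 : ℝ) •
            G (1 / (1 - y ^ 2) - 1) := by
  have hn : Measurable fun x : DRCoord p q => 1 - ‖x‖ ^ 2 :=
    measurable_const.sub (measurable_norm.pow_const 2)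
  have hn' : Measurable fun x : DRCoord p q => 1 / (1 - ‖x‖ ^ 2) - 1 :=
    (measurable_const.div hn).sub measurable_const
  have : Nontrivial (DRCoord p q) := Module.nontrivial_of_finrank_pos (R := ℝ) (by
    rw [finrank_eq]; omega)
  rw [← integral_map (φ := sinhSq) continuous_sinhSq.measurable.aemeasurable
    hG.aestronglyMeasurable, map_sinhSq, integral_map
    hn'.aemeasurable hG.aestronglyMeasurable,
    integral_withDensity_eq_integral_toReal_smul]
  · have h := integral_fun_norm_addHaar (volume : Measure (DRCoord p q)) (fun y : ℝ =>
      (if 0 < 1 - y ^ 2 then 2 ^ (p + q + 1) * (1 - y ^ 2) ^ (-((p : ℝ) / 2 + q + 1)) else 0 : ℝ) •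
            G (1 / (1 - y ^ 2) - 1))
    rw [finrank_eq, Nat.add_sub_cancel, ← Nat.cast_smul_eq_nsmul ℝ] at h
    rw [← h]
    refine integral_congr_ae (Filter.Eventually.of_forall fun x => ?_)
    simp only [ballKernel, Pi.one_apply, mul_one]
    split_ifs with h
    · rw [ENNReal.toReal_mul, ENNReal.toReal_ofReal (by positivity),
        ENNReal.toReal_ofReal (by positivity)]
    · simp
  · exact measurable_const.mul ((measurable_ballKernel _ measurable_one).comp hn)
  · refine Filter.Eventually.of_forall fun x => ?_
    simp only [ballKernel]
    split_ifs
    · simpa using ENNReal.mul_lt_top (by simp) (by simp)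
    · simp

theorem volume_real_ball_one (p q : ℕ) :
    volume.real (Metric.ball (0 : DRCoord p q) 1) =
      Real.pi ^ (((p + q + 1 : ℕ) : ℝ) / 2) / Real.Gamma (1 + ((p + q + 1 : ℕ) : ℝ) / 2) := by
  have : Nontrivial (DRCoord p q) := Module.nontrivial_of_finrank_pos (R := ℝ) (by
    rw [finrank_eq]; omega)
  rw [Measure.real, InnerProductSpace.volume_ball, finrank_eq, ENNReal.ofReal_one, one_pow,
    one_mul, ENNReal.toReal_ofReal (by positivity), Real.sqrt_eq_rpow, ← Real.rpow_natCast,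
    ← Real.rpow_mul Real.pi_pos.le, add_comm (1 : ℝ)]
  congr 2
  ring

end DRCoord

end

noncomputable section

/-! ### The spherical transform of the ball -/

namespace DamekRicci

theorem analyticOnNhd_sphericalProfile (p q : ℕ) (lam : ℂ) :
    AnalyticOnNhd ℂ (sphericalProfile p q lam) {z | z.re < 1 / 2} :=
  analyticOnNhd_gaussF _ _ _ (halfDim_re_pos p q)

theorem neg_ofReal_mem_halfPlane {s : ℝ} (hs : 0 ≤ s) : -(s : ℂ) ∈ {z : ℂ | z.re < 1 / 2} := by
  simp only [Set.mem_ofPred_eq, Complex.neg_re, Complex.ofReal_re]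
  linarith

/-- Replacing q by q + 2 raises ρ and n/2, hence a, b and c, by one, so this is `gaussF_contiguous`
at z = −s. -/
theorem sphericalProfile_contiguous (p q : ℕ) (lam : ℂ) {s : ℝ} (hs : 0 ≤ s) :
    ((p + q + 1 : ℕ) : ℂ) * sphericalProfile p q lam (-(s : ℂ)) =
      (((p + q + 1 : ℕ) : ℂ) + 2 * ((p : ℂ) / 2 + q + 1) * s) *
        sphericalProfile p (q + 2) lam (-(s : ℂ)) -
      2 * s * (s + 1) * deriv (sphericalProfile p (q + 2) lam) (-(s : ℂ)) := by
  have h := gaussF_contiguous (((p : ℂ) / 4 + (q : ℂ) / 2) - Complex.I * lam)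
    (((p : ℂ) / 4 + (q : ℂ) / 2) + Complex.I * lam) (((p + q + 1 : ℕ) : ℂ) / 2)
    (halfDim_re_pos p q) (neg_ofReal_mem_halfPlane hs)
  have e : sphericalProfile p (q + 2) lam =
      gaussF (((p : ℂ) / 4 + (q : ℂ) / 2) - Complex.I * lam + 1)
        (((p : ℂ) / 4 + (q : ℂ) / 2) + Complex.I * lam + 1) (((p + q + 1 : ℕ) : ℂ) / 2 + 1) := by
    unfold sphericalProfile
    congr 1
    · push_cast; ring
    · push_cast; ring
    · push_cast; ring
  rw [e]
  unfold sphericalProfile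
  linear_combination 2 * h

/-- In y = tanh(r/2) one has u = y²/(1 − y²). The contiguous relation is exactly what the product
rule requires. -/
theorem hasDerivAt_radial_antideriv (p q : ℕ) (lam : ℂ) {y : ℝ} (hy : y ^ 2 < 1) :
    HasDerivAt (fun y : ℝ => ((y ^ (p + q + 1) * (1 - y ^ 2) ^ (-((p : ℝ) / 2 + q + 1)) : ℝ) : ℂ) *
        sphericalProfile p (q + 2) lam (-((1 / (1 - y ^ 2) - 1 : ℝ) : ℂ)))
      (((p + q + 1 : ℕ) : ℂ) * ((y ^ (p + q) * (1 - y ^ 2) ^ (-((p : ℝ) / 2 + q + 1)) : ℝ) : ℂ) *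
        sphericalProfile p q lam (-((1 / (1 - y ^ 2) - 1 : ℝ) : ℂ))) y := by
  set κ : ℝ := (p : ℝ) / 2 + q + 1 with hκ
  have hw : 0 < 1 - y ^ 2 := by linarith
  have hs : 0 ≤ 1 / (1 - y ^ 2) - 1 := by
    rw [sub_nonneg, le_div_iff₀ hw]
    nlinarith [sq_nonneg y]
  have hdw : HasDerivAt (fun y : ℝ => 1 - y ^ 2) (-(2 * y)) y := by
    simpa using (hasDerivAt_pow 2 y).const_sub 1
  have hα := (hasDerivAt_pow (p + q + 1) y).fun_mul
    (hdw.rpow_const (p := -κ) (Or.inl hw.ne'))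
  have hβ : HasDerivAt (fun y : ℝ => 1 / (1 - y ^ 2) - 1) (2 * y / (1 - y ^ 2) ^ 2) y := by
    have := (hdw.fun_inv hw.ne').sub_const 1
    simpa [one_div] using this
  have hH := (hasDerivAt_comp_neg_ofReal (s := 1 / (1 - y ^ 2) - 1)
    (analyticOnNhd_sphericalProfile p (q + 2) lam _
      (neg_ofReal_mem_halfPlane hs)).differentiableAt).scomp y hβ
  refine (hα.ofReal_comp.fun_mul hH).congr_deriv ?_
  have hc := sphericalProfile_contiguous p q lam hs
  have e1 : (1 - y ^ 2) ^ (-κ) = (1 - y ^ 2) ^ (-κ - 1) * (1 - y ^ 2) := by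
    rw [← Real.rpow_add_one hw.ne']
    ring_nf
  have e2 : ((1 / (1 - y ^ 2) - 1 : ℝ) : ℂ) = y ^ 2 / (1 - y ^ 2) := by
    have : (1 / (1 - y ^ 2) - 1 : ℝ) = y ^ 2 / (1 - y ^ 2) := by field_simp; ring
    rw [this]
    push_cast
    ring
  have hwc : (1 - (y : ℂ) ^ 2) ≠ 0 := by exact_mod_cast hw.ne'
  rw [e1, Complex.real_smul]
  rw [show ((p + q + 1 : ℕ) : ℂ) = (p : ℂ) + q + 1 by push_cast; ring] at hc ⊢
  rw [mul_comm ((p : ℂ) + q + 1) (Complex.ofReal _), mul_assoc (Complex.ofReal _) ((p : ℂ) + q + 1),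
    hc]
  simp only [Function.comp_apply]
  rw [e2]
  simp only [hκ]
  push_cast
  field_simp
  ring

end DamekRicci

end

noncomputable section

namespace DamekRicci

variable {p q : ℕ} {S : HTypeAlgebra p q}

theorem two_arsinh_sqrt_lt_iff {s r : ℝ} (hr : 0 < r) :
    2 * Real.arsinh (√s) < r ↔ s < Real.sinh (r / 2) ^ 2 := by
  rw [← Real.sqrt_lt' (Real.sinh_pos_iff.2 (half_pos hr)), ← Real.arsinh_lt_arsinh (x := √s), Real.arsinh_sinh, lt_div_iff₀' two_pos]

theorem geodBall_eq (S : HTypeAlgebra p q) {r : ℝ} (hr : 0 < r) :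
    geodBall S r = {x | x.coord.sinhSq < Real.sinh (r / 2) ^ 2} := by
  ext x
  simp only [geodBall, Set.mem_ofPred_eq, edist_one]
  rw [ENNReal.ofReal_lt_ofReal_iff hr, two_arsinh_sqrt_lt_iff hr]

theorem geodSphere_eq (S : HTypeAlgebra p q) {r : ℝ} (hr : 0 < r) :
    geodSphere S r = {x | x.coord.sinhSq = Real.sinh (r / 2) ^ 2} := by
  ext x
  have h0 : 0 ≤ Real.sinh (r / 2) := Real.sinh_nonneg_iff.2 (by positivity)
  have h1 := Real.arsinh_nonneg_iff.2 (Real.sqrt_nonneg x.coord.sinhSq)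
  simp only [geodSphere, Set.mem_ofPred_eq, edist_one]
  rw [ENNReal.ofReal_eq_ofReal_iff (by positivity) hr.le, ← Real.sqrt_eq_iff_eq_sq
    x.coord.sinhSq_nonneg h0, ← Real.arsinh_inj (x := √x.coord.sinhSq), Real.arsinh_sinh, eq_div_iff two_ne_zero, mul_comm]

theorem vol_eq (S : HTypeAlgebra p q) :
    vol S = ((volume : Measure (DRCoord p q)).withDensity
        fun x => ENNReal.ofReal (Real.exp (-((p : ℝ) / 2 + q) * x.t))) := by
  rw [vol]
  simp only [volDensity_eq]
  exact Measure.map_id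

theorem continuousOn_sphericalProfile_neg (p q : ℕ) (lam : ℂ) :
    ContinuousOn (fun s : ℝ => sphericalProfile p q lam (-(s : ℂ))) (Set.Ici 0) :=
  (analyticOnNhd_sphericalProfile p q lam).continuousOn.comp
    (Complex.continuous_ofReal.neg.continuousOn) fun _ hs => neg_ofReal_mem_halfPlane hs

theorem continuous_sphericalProfile_sinhSq (p q : ℕ) (lam : ℂ) :
    Continuous fun x : DRCoord p q => sphericalProfile p q lam (-(x.sinhSq : ℂ)) :=
  (continuousOn_sphericalProfile_neg p q lam).comp_continuous DRCoord.continuous_sinhSq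
    fun x => x.sinhSq_nonneg

theorem integrableOn_sphericalFunction_geodBall (S : HTypeAlgebra p q) {r : ℝ} (hr : 0 < r)
    (lam : ℂ) : IntegrableOn (sphericalFunction S lam) (geodBall S r) (vol S) := by
  rw [sphericalFunction_eq, geodBall_eq S hr, vol_eq]
  have hd : Continuous fun x : DRCoord p q => Real.exp (-((p : ℝ) / 2 + q) * x.t) :=
    Real.continuous_exp.comp (continuous_const.mul (DRCoord.contDiff_t (n := 0)).continuous)
  have hloc : IsLocallyFiniteMeasure ((volume : Measure (DRCoord p q)).withDensity
      fun x => ENNReal.ofReal (Real.exp (-((p : ℝ) / 2 + q) * x.t))) :=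
    IsLocallyFiniteMeasure.withDensity_ofReal hd
  have h := (continuous_sphericalProfile_sinhSq p q lam).continuousOn.integrableOn_compact
    (μ := (volume : Measure (DRCoord p q)).withDensity
      fun x => ENNReal.ofReal (Real.exp (-((p : ℝ) / 2 + q) * x.t)))
    (DRCoord.isCompact_sinhSq_le (sq_nonneg (Real.sinh (r / 2))))
  exact h.mono_set (Set.ofPred_subset_ofPred.2 fun x hx => le_of_lt hx)

theorem tanh_sq_lt_one (r : ℝ) : (Real.sinh r / Real.cosh r) ^ 2 < 1 := by
  rw [div_pow, div_lt_one (by positivity), Real.cosh_sq]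
  linarith

theorem one_sub_tanh_sq (r : ℝ) : 1 - (Real.sinh r / Real.cosh r) ^ 2 = 1 / Real.cosh r ^ 2 := by
  have := Real.cosh_pos r
  have := Real.cosh_sq r
  field_simp
  linarith

/-- The positivity of 1 − y² cannot be dropped: for y > 1 the expression 1/(1 − y²) − 1 is negative
and satisfies the inequality trivially. -/
theorem radial_lt_iff {y r : ℝ} (hy : 0 < y) (hr : 0 < r) :
    (0 < 1 - y ^ 2 ∧ 1 / (1 - y ^ 2) - 1 < Real.sinh r ^ 2) ↔ y < Real.sinh r / Real.cosh r := by
  have hc := Real.cosh_pos r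
  have hs := Real.sinh_pos_iff.2 hr
  have h1 : y < Real.sinh r / Real.cosh r ↔ 1 / Real.cosh r ^ 2 < 1 - y ^ 2 := by
    rw [← one_sub_tanh_sq, sub_lt_sub_iff_left, sq_lt_sq₀ hy.le (by positivity)]
  rw [h1]
  constructor
  · rintro ⟨h0, h⟩
    rw [sub_lt_iff_lt_add, ← Real.cosh_sq, div_lt_iff₀ h0] at h
    rwa [div_lt_iff₀' (by positivity)]
  · intro h
    have h0 : 0 < 1 - y ^ 2 := lt_trans (by positivity) h
    refine ⟨h0, ?_⟩
    rw [sub_lt_iff_lt_add, ← Real.cosh_sq, div_lt_iff₀ h0]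
    rwa [div_lt_iff₀' (by positivity)] at h

/-- Here `r` is half the geodesic radius. The truncation `max s 0` keeps the argument in the half
plane where the profile is controlled, and does not matter because 1/(1 − y²) − 1 ≥ 0 on the range
of integration. -/
theorem integral_radial (p q : ℕ) (lam : ℂ) {r : ℝ} (hr : 0 < r) :
    ((p + q + 1 : ℕ) : ℂ) * ∫ y in Set.Ioi (0 : ℝ), y ^ (p + q) •
          (if 0 < 1 - y ^ 2 then 2 ^ (p + q + 1) * (1 - y ^ 2) ^ (-((p : ℝ) / 2 + q + 1)) else 0 : ℝ) •
            (Set.Iio (Real.sinh r ^ 2)).indicator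
              (fun s : ℝ => sphericalProfile p q lam (-(max s 0 : ℝ))) (1 / (1 - y ^ 2) - 1) =
      ((2 ^ (p + q + 1) * Real.sinh r ^ (p + q + 1) * Real.cosh r ^ (q + 1) : ℝ) : ℂ) *
        sphericalProfile p (q + 2) lam (-(Real.sinh r ^ 2 : ℝ)) := by
  set R := Real.sinh r / Real.cosh r with hR
  have hc := Real.cosh_pos r
  have hs := Real.sinh_pos_iff.2 hr
  have hR0 : 0 < R := by positivity
  set F : ℝ → ℂ := fun y => ((p + q + 1 : ℕ) : ℂ) *
    ((y ^ (p + q) * (1 - y ^ 2) ^ (-((p : ℝ) / 2 + q + 1)) : ℝ) : ℂ) *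
        sphericalProfile p q lam (-((1 / (1 - y ^ 2) - 1 : ℝ) : ℂ)) with hF
  have hle : ∀ y ∈ Set.uIcc 0 R, y ^ 2 < 1 := fun y hy => by
    rw [Set.uIcc_of_le hR0.le] at hy
    exact lt_of_le_of_lt (pow_le_pow_left₀ hy.1 hy.2 2) (tanh_sq_lt_one r)
  have hcont : ContinuousOn F (Set.uIcc 0 R) := by
    have hw : ContinuousOn (fun y : ℝ => 1 - y ^ 2) (Set.uIcc 0 R) := by fun_prop
    have hw0 : ∀ y ∈ Set.uIcc 0 R, 1 - y ^ 2 ≠ 0 := fun y hy => by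
      have := hle y hy
      linarith
    refine (continuousOn_const.mul (Complex.continuous_ofReal.comp_continuousOn
      ((continuousOn_pow _).mul (hw.rpow_const fun y hy => Or.inl (hw0 y hy))))).mul
      ((continuousOn_sphericalProfile_neg p q lam).comp
        ((continuousOn_const.div hw hw0).sub continuousOn_const) fun y hy => ?_)
    have := hle y hy
    simp only [Set.mem_Ici, sub_nonneg]
    rw [le_div_iff₀ (by linarith)]
    nlinarith [sq_nonneg y]
  have hftc := intervalIntegral.integral_eq_sub_of_hasDerivAt
    (fun y hy => hasDerivAt_radial_antideriv p q lam (hle y hy)) hcont.intervalIntegrable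
  have h1 : ∀ y ∈ Set.Ioi (0 : ℝ), y ^ (p + q) •
          (if 0 < 1 - y ^ 2 then 2 ^ (p + q + 1) * (1 - y ^ 2) ^ (-((p : ℝ) / 2 + q + 1)) else 0 : ℝ) •
            (Set.Iio (Real.sinh r ^ 2)).indicator
              (fun s : ℝ => sphericalProfile p q lam (-(max s 0 : ℝ))) (1 / (1 - y ^ 2) - 1) =
      (Set.Iio R).indicator (fun y => (2 ^ (p + q + 1) / ((p + q + 1 : ℕ) : ℂ)) * F y) y := by
    intro y hy
    have hiff := radial_lt_iff (r := r) hy hr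
    by_cases hyR : y < R
    · obtain ⟨h0, h2⟩ := hiff.2 hyR
      have h3 : 0 ≤ 1 / (1 - y ^ 2) - 1 := by
        rw [sub_nonneg, le_div_iff₀ h0]
        nlinarith [sq_nonneg y]
      have hn : ((p + q + 1 : ℕ) : ℂ) ≠ 0 := Nat.cast_ne_zero.2 (Nat.succ_ne_zero _)
      rw [if_pos h0, Set.indicator_of_mem (Set.mem_Iio.2 h2), Set.indicator_of_mem (Set.mem_Iio.2 hyR),
        max_eq_left h3, hF]
      simp only [Complex.real_smul]
      push_cast
      push_cast at hn
      field_simp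
    · rw [Set.indicator_of_notMem (s := Set.Iio R) (mt Set.mem_Iio.1 hyR)]
      by_cases h0 : 0 < 1 - y ^ 2
      · rw [Set.indicator_of_notMem (fun h => hyR (hiff.1 ⟨h0, Set.mem_Iio.1 h⟩))]
        simp
      · simp [h0]
  rw [setIntegral_congr_fun measurableSet_Ioi h1, setIntegral_indicator measurableSet_Iio,
    Set.Ioi_inter_Iio, ← integral_Ioc_eq_integral_Ioo, ← intervalIntegral.integral_of_le hR0.le,
    intervalIntegral.integral_const_mul, hftc, one_sub_tanh_sq]
  have e1 : 1 / (1 / Real.cosh r ^ 2) - 1 = Real.sinh r ^ 2 := by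
    rw [one_div_one_div, Real.cosh_sq]
    ring
  -- The exponent p + 2q + 2 is split as n + (q + 1): the first power clears the denominator of
  -- tanh^n, the second is the factor in the result.
  have e2 : (1 / Real.cosh r ^ 2) ^ (-((p : ℝ) / 2 + q + 1)) = Real.cosh r ^ (p + q + 1) *
      Real.cosh r ^ (q + 1) := by
    rw [one_div, ← Real.rpow_neg_one, ← Real.rpow_mul (by positivity), ← Real.rpow_natCast,
      ← Real.rpow_mul hc.le, ← pow_add, ← Real.rpow_natCast]
    congr 1
    push_cast
    ring
  have hn : ((p + q + 1 : ℕ) : ℂ) ≠ 0 := Nat.cast_ne_zero.2 (Nat.succ_ne_zero _)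
  rw [e1, e2, zero_pow (Nat.succ_ne_zero _), zero_mul, Complex.ofReal_zero, zero_mul, sub_zero,
    ← mul_assoc, mul_div_cancel₀ _ hn, hR, div_pow,
    ← mul_assoc (_ / _), div_mul_cancel₀ _ (by positivity)]
  push_cast
  ring

theorem sphericalFourier_ball (S : HTypeAlgebra p q) {r : ℝ} (hr : 0 < r) (lam : ℂ) :
    sphericalFourier S (ballDistribution S r) lam =
        ((2 ^ (p + q + 1) * Real.pi ^ (((p + q + 1 : ℕ) : ℝ) / 2) /
            Real.Gamma (1 + ((p + q + 1 : ℕ) : ℝ) / 2) *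
          Real.sinh (r / 2) ^ (p + q + 1) * Real.cosh (r / 2) ^ (q + 1) : ℝ) : ℂ) *
          sphericalPhi p (q + 2) lam r := by
  have hG : StronglyMeasurable ((Set.Iio (Real.sinh (r / 2) ^ 2)).indicator
      fun s : ℝ => sphericalProfile p q lam (-(max s 0 : ℝ))) :=
    ((continuousOn_sphericalProfile_neg p q lam).comp_continuous
      (continuous_id.max continuous_const)
      fun s => Set.mem_Ici.2 (le_max_right _ _)).stronglyMeasurable.indicator measurableSet_Iio
  have h := DRCoord.integral_comp_sinhSq (p := p) (q := q) hG
  have hm : MeasurableSet {x : DRCoord p q | x.sinhSq < Real.sinh (r / 2) ^ 2} :=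
    DRCoord.continuous_sinhSq.measurable measurableSet_Iio
  rw [sphericalFourier, ballDistribution, geodBall_eq S hr, vol_eq, sphericalFunction_eq]
  refine (integral_indicator (f := fun x : DRCoord p q =>
    sphericalProfile p q lam (-(x.sinhSq : ℂ))) hm).symm.trans (Eq.trans ?_ (h.trans ?_))
  · refine integral_congr_ae (Filter.Eventually.of_forall fun x => ?_)
    simp only [Set.indicator, Set.mem_ofPred_eq, Set.mem_Iio, max_eq_left x.sinhSq_nonneg]
  · have hrad := integral_radial p q lam (half_pos hr)
    rw [smul_comm, Complex.real_smul, Complex.real_smul, Complex.ofReal_natCast, hrad,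
      DRCoord.volume_real_ball_one]
    have : sphericalPhi p (q + 2) lam r =
      sphericalProfile p (q + 2) lam (-((Real.sinh (r / 2) ^ 2 : ℝ) : ℂ)) := rfl
    rw [this, ← mul_assoc, ← Complex.ofReal_mul]
    congr 2
    ring

end DamekRicci

end

noncomputable section

/-! ### The hypersurface measure of geodesic spheres -/

/-- Near a regular point the implicit function parametrizes the level set by the kernel of the
derivative. It is strictly differentiable at 0, hence Lipschitz near 0. -/
theorem HasStrictFDerivAt.exists_lipschitzOnWith_image_levelSet {E : Type*}
    [NormedAddCommGroup E] [NormedSpace ℝ E] [FiniteDimensional ℝ E]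
    {f : E → ℝ} {f' : E →L[ℝ] ℝ} {a : E} (hf : HasStrictFDerivAt f f' a) (hf' : f' ≠ 0)
    {U : Set E} (hU : U ∈ nhds a) :
    ∃ (ψ : f'.ker → E) (K : NNReal) (V : Set f'.ker), Bornology.IsBounded V ∧
      LipschitzOnWith K ψ V ∧ Set.MapsTo ψ V U ∧ ψ '' V ∈ nhdsWithin a {x | f x = f a} := by
  have : CompleteSpace E := FiniteDimensional.complete ℝ E
  have hr : f'.range = ⊤ := Module.Dual.range_eq_top_of_ne_zero (f := (f' : E →ₗ[ℝ] ℝ))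
    fun h => hf' (ContinuousLinearMap.coe_injective h)
  set ψ := hf.implicitFunction f f' hr (f a) with hψ
  have hd := hf.to_implicitFunction hr
  have h0 : ψ 0 = a := hf.implicitFunction_apply_image hr
  obtain ⟨K, s, hs, hlip⟩ := hd.exists_lipschitzOnWith
  have hU' : ψ ⁻¹' U ∈ nhds (0 : f'.ker) :=
    hd.continuousAt.preimage_mem_nhds (by rwa [← hψ, h0])
  have hV : s ∩ ψ ⁻¹' U ∩ Metric.ball 0 1 ∈ nhds (0 : f'.ker) :=
    Filter.inter_mem (Filter.inter_mem hs hU') (Metric.ball_mem_nhds _ one_pos)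
  refine ⟨ψ, K, s ∩ ψ ⁻¹' U ∩ Metric.ball 0 1, Metric.isBounded_ball.subset Set.inter_subset_right,
    hlip.mono fun x hx => hx.1.1, fun x hx => hx.1.2, ?_⟩
  have hπ : Filter.Tendsto (fun x => (hf.implicitToOpenPartialHomeomorph f f' hr x).2)
      (nhds a) (nhds 0) := by
    have h1 := (hf.implicitToOpenPartialHomeomorph f f' hr).continuousAt
      (hf.mem_implicitToOpenPartialHomeomorph_source hr)
    have h2 := h1.snd
    rw [ContinuousAt, hf.implicitToOpenPartialHomeomorph_self hr] at h2
    exact h2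
  rw [mem_nhdsWithin_iff_eventually]
  filter_upwards [hf.eq_implicitFunction hr, hπ hV] with x hx hxV hfx
  rw [hfx] at hx
  exact ⟨_, hxV, hx⟩

theorem eventually_norm_apply_le {E F X : Type*} [NormedAddCommGroup E] [NormedSpace ℝ E]
    [NormedAddCommGroup F] [NormedSpace ℝ F] [TopologicalSpace X] {g : X → E →L[ℝ] F}
    (hg : Continuous g) (x : X) : ∃ K : NNReal, ∀ᶠ y in nhds x, ∀ ξ, ‖g y ξ‖ ≤ K * ‖ξ‖ := by
  refine ⟨‖g x‖₊ + 1, ?_⟩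
  filter_upwards [hg.norm.continuousAt.eventually_lt_const (lt_add_one ‖g x‖)] with y hy ξ
  exact (g y).le_of_opNorm_le hy.le ξ

theorem eventually_apply_self_le {E X : Type*} [NormedAddCommGroup E] [NormedSpace ℝ E]
    [TopologicalSpace X] {g : X → E →L[ℝ] E →L[ℝ] ℝ} (hg : Continuous g) (x : X) :
    ∃ K : NNReal, ∀ᶠ y in nhds x, ∀ ξ, g y ξ ξ ≤ K * ‖ξ‖ ^ 2 := by
  obtain ⟨K, hK⟩ := eventually_norm_apply_le hg x
  refine ⟨K, hK.mono fun y hy ξ => ?_⟩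
  calc g y ξ ξ ≤ ‖g y ξ‖ * ‖ξ‖ := (Real.le_norm_self _).trans ((g y ξ).le_opNorm ξ)
    _ ≤ K * ‖ξ‖ * ‖ξ‖ := by gcongr; exact hy ξ
    _ = K * ‖ξ‖ ^ 2 := by ring

namespace DamekRicci

variable {p q : ℕ} {S : HTypeAlgebra p q}

/-- The Riemannian distance is at most the length of the straight segment, which stays in the convex
set. -/
theorem edist_le_of_norm_frame_symm_le {s : Set (DRCoord p q)} (hs : Convex ℝ s) {K : NNReal}
    (hK : ∀ x ∈ s, ∀ ξ, ‖(frame (ofCoord S x)).symm ξ‖ ≤ K * ‖ξ‖) :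
    LipschitzOnWith K (ofCoord S) s := by
  intro x hx y hy
  let γ : ℝ → DRCoord p q := fun r => x + r • (y - x)
  have hγ : ContDiff ℝ 1 γ := contDiff_const.add (contDiff_id.smul contDiff_const)
  have hγd : ∀ r, HasDerivAt γ (y - x) r := fun r =>
    (((hasDerivAt_id r).smul_const (y - x)).const_add x).congr_deriv (one_smul ℝ _)
  have hmem : ∀ r ∈ Set.Icc (0 : ℝ) 1, γ r ∈ s := fun r hr => hs.add_smul_sub_mem hx hy hr
  let γ' : ℝ → DamekRicci S := fun r => ofCoord S (γ r)
  have hlen : Manifold.pathELength 𝓘(ℝ, DRCoord p q) γ' 0 1 ≤ K * edist x y := by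
    rw [Manifold.pathELength_eq_lintegral_mfderiv_Icc]
    calc _ ≤ ∫⁻ r in Set.Icc (0 : ℝ) 1, K * edist x y := by
          refine setLIntegral_mono' measurableSet_Icc fun r hr => ?_
          rw [enorm_tangent, mfderiv_path]
          have e : fderiv ℝ (fun s => (γ' s).coord) r 1 = y - x := by
            rw [fderiv_apply_one_eq_deriv]
            exact (hγd r).deriv
          erw [e]
          rw [edist_comm, edist_dist, dist_eq_norm, ← ofReal_norm,
            ← ENNReal.ofReal_coe_nnreal, ← ENNReal.ofReal_mul K.coe_nonneg]
          exact ENNReal.ofReal_le_ofReal (hK _ (hmem r hr) _)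
      _ = K * edist x y := by simp
  rw [IsRiemannianManifold.out (I := 𝓘(ℝ, DRCoord p q))]
  refine le_trans ?_ hlen
  exact Manifold.riemannianEDist_le_pathELength
    ((contMDiff_iff_contDiff (f := γ).2 hγ).contMDiffOn) (by simp [γ', γ]) (by simp [γ', γ])
    zero_le_one

theorem exists_lipschitzOnWith_ofCoord (S : HTypeAlgebra p q) (x : DRCoord p q) :
    ∃ (K : NNReal) (s : Set (DRCoord p q)), s ∈ nhds x ∧ LipschitzOnWith K (ofCoord S) s := by
  obtain ⟨K, hK⟩ := eventually_apply_self_le (contDiff_metric (S := S) (n := 0)).continuous x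
  obtain ⟨ε, hε, hball⟩ := Metric.eventually_nhds_iff_ball.1 hK
  refine ⟨NNReal.sqrt K, Metric.ball x ε, Metric.ball_mem_nhds x hε,
    edist_le_of_norm_frame_symm_le (convex_ball x ε) fun y hy ξ => ?_⟩
  rw [Real.coe_sqrt]
  refine (abs_le_of_sq_le_sq' ?_ (by positivity)).2
  rw [mul_pow, Real.sq_sqrt K.coe_nonneg, ← real_inner_self_eq_norm_sq, ← metric_apply]
  exact hball y hy ξ

/-- The sphere is compact, so finiteness near each point suffices. There it is a Lipschitz image of
a bounded set in a space of dimension p + q. The second Lipschitz map is the passage from the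
Euclidean to the Riemannian distance, which defines the Hausdorff measure. -/
theorem hausdorffMeasure_geodSphere_lt_top (S : HTypeAlgebra p q) {r : ℝ} (hr : 0 < r) :
    (μH[((p + q : ℕ) : ℝ)] : Measure (DamekRicci S)) (geodSphere S r) < ⊤ := by
  rw [geodSphere_eq S hr]
  set s := Real.sinh (r / 2) ^ 2 with hs
  have hs0 : 0 < s := pow_pos (Real.sinh_pos_iff.2 (half_pos hr)) 2
  have hcpt : IsCompact {x : DRCoord p q | x.sinhSq = s} :=
    (DRCoord.isCompact_sinhSq_le hs0.le).of_isClosed_subset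
      (isClosed_eq DRCoord.continuous_sinhSq continuous_const)
      (Set.ofPred_subset_ofPred.2 fun x hx => hx.le)
  refine IsCompact.measure_lt_top_of_nhdsWithin (s := {x : DamekRicci S | x.coord.sinhSq = s})
    hcpt fun x hx => ?_
  have hx : x.coord.sinhSq = s := hx
  have hd : HasStrictFDerivAt DRCoord.sinhSq (innerSL ℝ x.coord.sinhSqGradient) x.coord :=
    (DRCoord.contDiff_sinhSq (n := 1)).contDiffAt.hasStrictFDerivAt'
      (DRCoord.hasFDerivAt_sinhSq x.coord) one_ne_zero
  -- The sphere is regular: du(grad u) = s(s + 1) > 0 on it.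
  have hne : innerSL ℝ x.coord.sinhSqGradient ≠ 0 := by
    intro h
    have h1 := inner_sinhSqGradient_sinhSqGrad (S := S) x.coord
    have h2 : inner ℝ x.coord.sinhSqGradient (sinhSqGrad S x.coord) = 0 :=
      congrArg (fun L : DRCoord p q →L[ℝ] ℝ => L (sinhSqGrad S x.coord)) h
    rw [h2, hx] at h1
    have : 0 < s * (s + 1) := by positivity
    linarith
  obtain ⟨K, U, hU, hK⟩ := exists_lipschitzOnWith_ofCoord S x.coord
  obtain ⟨ψ, K', V, hV, hlip, hmaps, hnhds⟩ := hd.exists_lipschitzOnWith_image_levelSet hne hU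
  rw [hx] at hnhds
  refine ⟨ofCoord S '' (ψ '' V), ?_, ?_⟩
  · rw [show ofCoord S '' (ψ '' V) = ψ '' V from Set.image_id _]
    exact hnhds
  · rw [← Set.image_comp]
    refine ((hK.comp hlip hmaps).hausdorffMeasure_image_le (Nat.cast_nonneg _)).trans_lt ?_
    have hfin : Module.finrank ℝ (innerSL ℝ x.coord.sinhSqGradient : DRCoord p q →L[ℝ] ℝ).ker =
        p + q := by
      have h1 := Module.Dual.finrank_ker_add_one_of_ne_zero
        (f := ((innerSL ℝ x.coord.sinhSqGradient : DRCoord p q →L[ℝ] ℝ) : DRCoord p q →ₗ[ℝ] ℝ))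
        fun h => hne (ContinuousLinearMap.coe_injective h)
      rw [DRCoord.finrank_eq] at h1
      exact Nat.succ_injective h1
    rw [← hfin]
    exact ENNReal.mul_lt_top (ENNReal.rpow_lt_top_of_nonneg (Nat.cast_nonneg _)
      ENNReal.coe_ne_top) hV.measure_lt_top

theorem surfaceMeasure_geodSphere_lt_top (S : HTypeAlgebra p q) {r : ℝ} (hr : 0 < r) :
    surfaceMeasure S (geodSphere S r) < ⊤ := by
  rw [surfaceMeasure, Measure.euclideanHausdorffMeasure_def, Measure.smul_apply]
  exact ENNReal.mul_lt_top ENNReal.coe_lt_top (hausdorffMeasure_geodSphere_lt_top S hr)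

theorem sphericalFunction_of_mem_geodSphere {lam : ℂ} {r : ℝ} (hr : 0 < r) {x : DamekRicci S}
    (hx : x ∈ geodSphere S r) : sphericalFunction S lam x = sphericalPhi p q lam r := by
  rw [geodSphere_eq S hr] at hx
  have hx : x.coord.sinhSq = Real.sinh (r / 2) ^ 2 := hx
  simp only [sphericalFunction_eq, hx]
  rfl

theorem measurableSet_geodSphere (S : HTypeAlgebra p q) {r : ℝ} (hr : 0 < r) :
    MeasurableSet (geodSphere S r) := by
  rw [geodSphere_eq S hr]
  exact DRCoord.continuous_sinhSq.measurable (measurableSet_singleton _)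

theorem integrableOn_sphericalFunction_geodSphere (S : HTypeAlgebra p q) {r : ℝ} (hr : 0 < r)
    (lam : ℂ) : IntegrableOn (sphericalFunction S lam) (geodSphere S r) (surfaceMeasure S) :=
  (integrableOn_const (C := sphericalPhi p q lam r)
    (surfaceMeasure_geodSphere_lt_top S hr).ne).congr_fun
    (fun _ hx => (sphericalFunction_of_mem_geodSphere hr hx).symm) (measurableSet_geodSphere S hr)

theorem sphericalFourier_sphere (S : HTypeAlgebra p q) {r : ℝ} (hr : 0 < r) (lam : ℂ) :
    sphericalFourier S (sphereDistribution S r) lam =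
      ((surfaceMeasure S).real (geodSphere S r) : ℂ) * sphericalPhi p q lam r := by
  rw [sphericalFourier, sphereDistribution, setIntegral_congr_fun (measurableSet_geodSphere S hr)
    fun _ hx => sphericalFunction_of_mem_geodSphere hr hx, setIntegral_const, Complex.real_smul]

end DamekRicci

end

theorem mainTheorem10 {p q : ℕ} (S : HTypeAlgebra p q) (r : ℝ) (hr : 0 < r) (lam : ℂ) :
    (∃! φ, DamekRicci.IsSphericalFunction S lam φ) ∧
    (IntegrableOn (DamekRicci.sphericalFunction S lam) (DamekRicci.geodBall S r)
        (DamekRicci.vol S) ∧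
      DamekRicci.sphericalFourier S (DamekRicci.ballDistribution S r) lam =
        ((2 ^ (p + q + 1) * Real.pi ^ (((p + q + 1 : ℕ) : ℝ) / 2) /
            Real.Gamma (1 + ((p + q + 1 : ℕ) : ℝ) / 2) *
          Real.sinh (r / 2) ^ (p + q + 1) * Real.cosh (r / 2) ^ (q + 1) : ℝ) : ℂ) *
          sphericalPhi p (q + 2) lam r) ∧
    (DamekRicci.surfaceMeasure S (DamekRicci.geodSphere S r) ≠ ⊤ ∧
      IntegrableOn (DamekRicci.sphericalFunction S lam) (DamekRicci.geodSphere S r)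
        (DamekRicci.surfaceMeasure S) ∧
      DamekRicci.sphericalFourier S (DamekRicci.sphereDistribution S r) lam =
        ((DamekRicci.surfaceMeasure S).real (DamekRicci.geodSphere S r) : ℂ) *
          sphericalPhi p q lam r) := by
  exact ⟨DamekRicci.existsUnique_isSphericalFunction S lam,
    ⟨DamekRicci.integrableOn_sphericalFunction_geodBall S hr lam,
      DamekRicci.sphericalFourier_ball S hr lam⟩,
    ⟨(DamekRicci.surfaceMeasure_geodSphere_lt_top S hr).ne,
      DamekRicci.integrableOn_sphericalFunction_geodSphere S hr lam,
      DamekRicci.sphericalFourier_sphere S hr lam⟩⟩
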